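/- Theorem 2.1 (first variation formula). Let $(M^m,g)$ and $(N^n,h)$ be smooth Riemannian manifolds (without boundary, Hausdorff, second countable) and let $u:M\to N$ be a smooth map. For an orthonormal basis $e_1,\dots,e_m$ of $T_xM$ put $$d_{(3)}u(X)=\sum_{j,k=1}^m h\big(du(X),du(e_j)\big)\,h\big(du(e_j),du(e_k)\big)\,du(e_k),\qquad \|d_{(3)}u\|^2=\sum_{i=1}^m h\big(d_{(3)}u(e_i),du(e_i)\big),$$ $e_{\Phi_{(3)}}(u)=\tfrac16\|d_{(3)}u\|^2$, and, for measurable $D\subseteq M$, $E_{\Phi_{(3)}}(u;D)=\int_D e_{\Phi_{(3)}}(u)\,dv_g$ (so $E_{\Phi_{(3)}}(u)=E_{\Phi_{(3)}}(u;M)$). The $1$-form $d_{(3)}u$ has values in $u^{-1}TN$; with $\widetilde\nabla$ the connection induced on $u^{-1}TN$ by the Levi-Civita connection of $N$ and $\nabla$ the Levi-Civita connection of $M$, the $\Phi_{(3)}$-tension field is $$\tau_{\Phi_{(3)}}(u)=\operatorname{div}(d_{(3)}u)=\sum_{i=1}^m\Big(\widetilde\nabla_{e_i}\big(d_{(3)}u(e_i)\big)-d_{(3)}u(\nabla_{e_i}e_i)\Big)$$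 for a local orthonormal frame $(e_i)$. A smooth compactly supported variation of $u$ is a family $u_t:M\to N$, $-\delta<t<\delta$, with $\delta>0$, that is smooth in $(t,x)$ jointly, with $u_0=u$, for which there is a compact set $K\subseteq M$ with $u_t=u$ on $M\setminus K$ for all $t$; its variation field is $v=\frac{\partial u_t}{\partial t}\big|_{t=0}$. (a) The density $e_{\Phi_{(3)}}(u)$ is integrable on every compact subset of $M$. (b) For every such variation, $h(v,\tau_{\Phi_{(3)}}(u))$ is integrable on $M$, and for every measurable set $D\supseteq K$ on which $e_{\Phi_{(3)}}(u)$ is integrable (for example $D=K$, or $D=M$ if $u$ has finite energy) all $e_{\Phi_{(3)}}(u_t)$ are integrable on $D$, the function $t\mapsto E_{\Phi_{(3)}}(u_t;D)$ is differentiable at $t=0$, and $$\frac{d}{dt}E_{\Phi_{(3)}}(u_t;D)\Big|_{t=0}=-\int_M h\big(v,\tau_{\Phi_{(3)}}(u)\big)\,dv_g .$$ (c) Call $u$ $\Phi_{(3)}$-harmonic if $\frac{d}{dt}E_{\Phi_{(3)}}(u_t;K)\big|_{t=0}=0$ for every smooth compactly supported variation $u_t$ of $u$ and every compact $K$ with $u_t=u$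 off $K$ for all $t$. Then $u$ is $\Phi_{(3)}$-harmonic if and only if $\tau_{\Phi_{(3)}}(u)=0$ on $M$. -/

import Mathlib

open Set Filter MeasureTheory Bundle
open scoped Manifold ContDiff Topology Bundle

noncomputable section

namespace PhiThree

/-- The model space `ℝᵐ` with its Euclidean norm. -/
abbrev Eu (m : ℕ) : Type := EuclideanSpace ℝ (Fin m)

section Coordinates

variable (m : ℕ) {M : Type*} [TopologicalSpace M] [ChartedSpace (Eu m) M]
  [IsManifold (𝓡 m) ∞ M]

/-- The coordinate vector field `∂/∂xⁱ` of the chart at `x₀`, evaluated at a point `x` of the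
domain of that chart. (The trivialization of `TM` at `x₀` is the derivative of the chart at
`x₀`.) -/
def coordVec (x₀ : M) (i : Fin m) (x : M) : TangentSpace (𝓡 m) x :=
  (trivializationAt (Eu m) (TangentSpace (𝓡 m) : M → Type _) x₀).symm x
    (EuclideanSpace.single i (1 : ℝ))

/-- The `i`-th component, with respect to `∂/∂x¹, …, ∂/∂xᵐ` of the chart at `x₀`, of a tangent
vector `a` at a point `x` of the domain of that chart. -/
def coordComp (x₀ : M) (i : Fin m) (x : M) (a : TangentSpace (𝓡 m) x) : ℝ :=
  (trivializationAt (Eu m) (TangentSpace (𝓡 m) : M → Type _) x₀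
    (⟨x, a⟩ : TotalSpace (Eu m) (TangentSpace (𝓡 m) : M → Type _))).2 i

variable [RiemannianBundle (fun x : M ↦ TangentSpace (𝓡 m) x)]

/-- The matrix `(g_ij)` of the metric in the chart at `x₀`, as a function on the image of the
chart. -/
def metricMatrix (x₀ : M) (y : Eu m) : Matrix (Fin m) (Fin m) ℝ :=
  Matrix.of fun i j ↦
    inner ℝ (coordVec m x₀ i ((extChartAt (𝓡 m) x₀).symm y))
      (coordVec m x₀ j ((extChartAt (𝓡 m) x₀).symm y))

/-- The partial derivative `∂_l g_ij` of the metric in the chart at `x₀`. -/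
def metricDeriv (x₀ : M) (y : Eu m) (l i j : Fin m) : ℝ :=
  fderiv ℝ (fun z ↦ metricMatrix m x₀ z i j) y (EuclideanSpace.single l (1 : ℝ))

/-- The Christoffel symbol `Γᵏ_ij = ½ ∑ₗ gᵏˡ (∂_i g_jl + ∂_j g_il - ∂_l g_ij)` of the Levi-Civita
connection in the chart at `x₀`. -/
def christoffel (x₀ : M) (y : Eu m) (k i j : Fin m) : ℝ :=
  (1 / 2) * ∑ l, (metricMatrix m x₀ y)⁻¹ k l *
    (metricDeriv m x₀ y i j l + metricDeriv m x₀ y j i l - metricDeriv m x₀ y l i j)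

/-- The measure `√det(g_ij) dx¹⋯dxᵐ` of the chart at `x₀`, carried to the domain of the chart and
extended by zero outside of it. -/
def chartVolume [MeasurableSpace M] (x₀ : M) : Measure M :=
  (((volume : Measure (Eu m)).restrict (extChartAt (𝓡 m) x₀).target).withDensity
    (fun y ↦ ENNReal.ofReal (Real.sqrt (metricMatrix m x₀ y).det))).map (extChartAt (𝓡 m) x₀).symm

variable (M) in
/-- The Riemannian volume measure `dv_g`. The measures `√det(g_ij) dx¹⋯dxᵐ` of any two charts agree
on the overlap of the charts, and on a second countable manifold the measure that they
determine is the least measure that dominates all of them. -/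
def riemannianVolume [MeasurableSpace M] : Measure M :=
  ⨆ x₀ : M, chartVolume m x₀

end Coordinates

section Maps

variable (m n : ℕ)
  {M : Type*} [TopologicalSpace M] [ChartedSpace (Eu m) M]
  {N : Type*} [TopologicalSpace N] [ChartedSpace (Eu n) N]

/-- The differential `du_x : T_x M → T_{u(x)} N`. -/
def differential (u : M → N) (x : M) :
    TangentSpace (𝓡 m) x →L[ℝ] TangentSpace (𝓡 n) (u x) :=
  mfderiv (𝓡 m) (𝓡 n) u x

section Density

variable [RiemannianBundle (fun x : M ↦ TangentSpace (𝓡 m) x)]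

/-- An orthonormal basis `e_1, …, e_m` of `(T_x M, g)`. -/
def orthoBasis (x : M) :
    OrthonormalBasis (Fin (Module.finrank ℝ (TangentSpace (𝓡 m) x))) ℝ (TangentSpace (𝓡 m) x) :=
  haveI : FiniteDimensional ℝ (TangentSpace (𝓡 m) x) :=
    inferInstanceAs (FiniteDimensional ℝ (Eu m))
  stdOrthonormalBasis ℝ (TangentSpace (𝓡 m) x)

variable [RiemannianBundle (fun y : N ↦ TangentSpace (𝓡 n) y)]

/-- The `1`-form `d_(3)u` with values in `u⁻¹TN`, see `dThree_apply`. -/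
def dThree (u : M → N) (x : M) : TangentSpace (𝓡 m) x →L[ℝ] TangentSpace (𝓡 n) (u x) :=
  ∑ j, ∑ k, inner ℝ (differential m n u x (orthoBasis m x j))
      (differential m n u x (orthoBasis m x k)) •
    ((innerSL ℝ (differential m n u x (orthoBasis m x j))).comp (differential m n u x)).smulRight
      (differential m n u x (orthoBasis m x k))

/-- `d_(3)u(X) = ∑ⱼₖ h(du X, du e_j) h(du e_j, du e_k) du e_k`. -/
theorem dThree_apply (u : M → N) (x : M) (X : TangentSpace (𝓡 m) x) :
    dThree m n u x X = ∑ j, ∑ k,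
      (inner ℝ (differential m n u x X) (differential m n u x (orthoBasis m x j)) *
        inner ℝ (differential m n u x (orthoBasis m x j))
          (differential m n u x (orthoBasis m x k))) •
        differential m n u x (orthoBasis m x k) := by
  simp only [dThree, _root_.sum_apply, _root_.smul_apply,
    ContinuousLinearMap.smulRight_apply, ContinuousLinearMap.comp_apply, innerSL_apply_apply,
    smul_smul]
  refine Finset.sum_congr rfl fun j _ ↦ Finset.sum_congr rfl fun k _ ↦ ?_
  rw [mul_comm, real_inner_comm]

/-- The energy density `e(u) = ‖d_(3)u‖² / 6`, where `‖d_(3)u‖² = ∑ᵢ h(d_(3)u(e_i), du(e_i))`. -/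
def energyDensity (u : M → N) (x : M) : ℝ :=
  (∑ i, inner ℝ (dThree m n u x (orthoBasis m x i)) (differential m n u x (orthoBasis m x i))) / 6

end Density

variable [IsManifold (𝓡 m) ∞ M] [IsManifold (𝓡 n) ∞ N]

section

variable [RiemannianBundle (fun y : N ↦ TangentSpace (𝓡 n) y)]

/-- The connection `∇̃` that the Levi-Civita connection of `N` induces on the pullback bundle
`u⁻¹TN`: for a section `W` of `u⁻¹TN` (a vector field along `u`) and `a ∈ T_x M`,
`∇̃_a W = ∑ₖ (a(Wᵏ) + ∑ᵢⱼ Γᵏ_ij(u(x)) du(a)ⁱ W(x)ʲ) ∂/∂yᵏ`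
in the chart of `N` at `u(x)`. -/
def pullbackCov (u : M → N) (W : (x : M) → TangentSpace (𝓡 n) (u x)) (x : M)
    (a : TangentSpace (𝓡 m) x) : TangentSpace (𝓡 n) (u x) :=
  ∑ k, (mvfderiv (𝓡 m) (fun z : M ↦ coordComp n (u x) k (u z) (W z)) x a +
      ∑ i, ∑ j, christoffel n (u x) (extChartAt (𝓡 n) (u x) (u x)) k i j *
        coordComp n (u x) i (u x) (differential m n u x a) *
        coordComp n (u x) j (u x) (W x)) • coordVec n (u x) k (u x)

end

variable [RiemannianBundle (fun x : M ↦ TangentSpace (𝓡 m) x)]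

/-- The Levi-Civita connection of `M`, as the connection induced by the identity map. -/
def leviCivita (Y : (x : M) → TangentSpace (𝓡 m) x) (x : M) (a : TangentSpace (𝓡 m) x) :
    TangentSpace (𝓡 m) x :=
  pullbackCov m m (fun z : M ↦ z) Y x a

variable [RiemannianBundle (fun y : N ↦ TangentSpace (𝓡 n) y)]

/-- The covariant derivative of a `1`-form `α` with values in `u⁻¹TN`:
`(∇_a α)(b) = ∇̃_a (α(B)) - α(∇_a B)`, where `B` is a vector field near `x` with `B(x) = b`
(here: the one with constant components in the chart at `x`). -/
def covDerivForm (u : M → N)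
    (α : (x : M) → TangentSpace (𝓡 m) x →L[ℝ] TangentSpace (𝓡 n) (u x)) (x : M)
    (a b : TangentSpace (𝓡 m) x) : TangentSpace (𝓡 n) (u x) :=
  pullbackCov m n u (fun z ↦ α z (FiberBundle.extend (Eu m) b z)) x a -
    α x (leviCivita m (FiberBundle.extend (Eu m) b) x a)

/-- The divergence `div α = ∑ᵢ (∇_{e_i} α)(e_i)` of a `1`-form with values in `u⁻¹TN`. -/
def formDiv (u : M → N)
    (α : (x : M) → TangentSpace (𝓡 m) x →L[ℝ] TangentSpace (𝓡 n) (u x)) (x : M) :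
    TangentSpace (𝓡 n) (u x) :=
  ∑ i, covDerivForm m n u α x (orthoBasis m x i) (orthoBasis m x i)

/-- The `Φ_(3)`-energy `∫_D e(u) dv_g` of `u` on `D ⊆ M`; the total energy is the case
`D = M`. -/
def energyOn [MeasurableSpace M] (D : Set M) (u : M → N) : ℝ :=
  ∫ x in D, energyDensity m n u x ∂(riemannianVolume m M)

/-- The `Φ_(3)`-tension field `τ(u) = div (d_(3)u)`. -/
def tension (u : M → N) (x : M) : TangentSpace (𝓡 n) (u x) :=
  formDiv m n u (dThree m n u) x

end Maps

section Variations

variable (m n : ℕ)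
  {M : Type*} [TopologicalSpace M] [ChartedSpace (Eu m) M]
  {N : Type*} [TopologicalSpace N] [ChartedSpace (Eu n) N]

/-- `u_t = U t`, `-δ < t < δ`, is a smooth variation of `u`, supported in the compact set `K`. -/
structure IsVariation (u : M → N) (δ : ℝ) (K : Set M) (U : ℝ → M → N) : Prop where
  pos : 0 < δ
  initial : U 0 = u
  smooth : ContMDiffOn ((𝓘(ℝ, ℝ)).prod (𝓡 m)) (𝓡 n) ∞ (fun p : ℝ × M ↦ U p.1 p.2)
    (Ioo (-δ) δ ×ˢ univ)
  isCompact : IsCompact K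
  eq_off : ∀ t ∈ Ioo (-δ) δ, ∀ x ∉ K, U t x = u x

/-- The variation field `v = ∂u_t/∂t` at `t = 0`, a vector field along `u_0`. -/
def variationField (U : ℝ → M → N) (x : M) : TangentSpace (𝓡 n) (U 0 x) :=
  mfderiv 𝓘(ℝ, ℝ) (𝓡 n) (fun t : ℝ ↦ U t x) 0 (1 : ℝ)

/-- A smooth map `u` is `Φ_(3)`-harmonic if it is a critical point of the `Φ_(3)`-energy with
respect to all smooth compactly supported variations. Since `u_t = u` outside of the compact set
`K`, the energy is taken over `K`, where it is finite. -/
def IsHarmonic [IsManifold (𝓡 m) ∞ M] [RiemannianBundle (fun x : M ↦ TangentSpace (𝓡 m) x)]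
    [IsManifold (𝓡 n) ∞ N] [RiemannianBundle (fun y : N ↦ TangentSpace (𝓡 n) y)]
    [MeasurableSpace M] (u : M → N) : Prop :=
  ContMDiff (𝓡 m) (𝓡 n) ∞ u ∧
    ∀ (δ : ℝ) (K : Set M) (U : ℝ → M → N), IsVariation m n u δ K U →
      HasDerivAt (fun t ↦ energyOn m n K (U t)) 0 0

end Variations

end PhiThree

end

set_option linter.unusedSectionVars false

open Set Filter MeasureTheory Bundle
open scoped Manifold ContDiff Topology Bundle

noncomputable section

namespace PhiThree

/-! ### Coordinate frames of the tangent bundle -/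

section ChartFrames

variable {m n : ℕ} {M : Type*} [TopologicalSpace M] [ChartedSpace (Eu m) M]
  [IsManifold (𝓡 m) ∞ M] {N : Type*} [TopologicalSpace N] [ChartedSpace (Eu n) N]
  [IsManifold (𝓡 n) ∞ N]

/-! In charts every object is a matrix. Let J be the Jacobian of `u_t`, H the target metric along
`u_t`, A = JᵀHJ the pullback metric, B = g⁻¹Ag⁻¹Ag⁻¹ and Q = JB. A sum over an orthonormal basis is
a contraction with g⁻¹ (`frameMatrix_mul_transpose`), so d_(3)u has the matrix Qg and its density is
tr(BA)/6, which is smooth in time and space. Since the trace is cyclic and B, H are symmetric, the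
time derivative of the density is tr(QᵀHJ') + ½ tr(QᵀH'J) (`IsVariation.fderiv_localDensity_time`).

Let X be the vector field dual to the form h(v, d_(3)u(·)); it has the components QᵀHv. The product
rule gives div X = ⟨∇̃v, d_(3)u⟩ + h(v, τ), and the first term is the rate of change of the density,
because the covariant time derivative of du is ∇̃v. In coordinates this is the matrix identity
`divergence_algebra`, which rests on the symmetry of QJᵀ = JBJᵀ and on the formula for the
Christoffel symbols; the commutation of mixed partials identifies ∂v with J'. The result is
`IsVariation.fieldDiv_fluxField`.

The field X vanishes off K, so ∫ div X = 0 (`integral_fieldDiv_eq_zero`) and the rate integrates to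
-∫ h(v, τ). The divergence theorem itself needs that the coordinate divergence does not depend on
the chart (`divergence_comp_eq`), that `dv_g` is √det g dx on each chart domain
(`riemannianVolume_restrict`), and a partition of unity. Differentiation under the integral is
allowed because the rate is bounded on a compact time interval times K; off K the density does not
depend on t, so any admissible D reduces to K.

If τ = 0, the formula makes every derivative vanish. If τ(x₀) ≠ 0, pushing u in the chart direction
of τ(x₀), with a cut-off supported where the pairing with τ is positive, gives a nonzero derivative
(`IsHarmonic.tension_eq_zero`). -/

theorem mem_baseSet {x₀ x : M} (hx : x ∈ (extChartAt (𝓡 m) x₀).source) :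
    x ∈ (trivializationAt (Eu m) (TangentSpace (𝓡 m) : M → Type _) x₀).baseSet := by
  simpa using hx

/-- The trivialization acts on the total space, where linearity is not visible; over its base set it
is a continuous linear map on fibres, and the linearity of components follows from this form. -/
theorem coordComp_eq_continuousLinearMapAt {x₀ x : M} (hx : x ∈ (extChartAt (𝓡 m) x₀).source)
    (i : Fin m) (a : TangentSpace (𝓡 m) x) :
    coordComp m x₀ i x a =
      (trivializationAt (Eu m) (TangentSpace (𝓡 m) : M → Type _) x₀).continuousLinearMapAt
        ℝ x a i := by
  rw [Trivialization.continuousLinearMapAt_apply_of_mem ℝ _ (mem_baseSet hx)]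
  rfl

theorem coordVec_eq_symmL {x₀ x : M} (hx : x ∈ (extChartAt (𝓡 m) x₀).source) (i : Fin m) :
    coordVec m x₀ i x =
      (trivializationAt (Eu m) (TangentSpace (𝓡 m) : M → Type _) x₀).symmL ℝ x
        (EuclideanSpace.single i (1 : ℝ)) := by
  rw [Trivialization.symmL_apply _ (mem_baseSet hx)]
  rfl

theorem coordComp_add {x₀ x : M} (hx : x ∈ (extChartAt (𝓡 m) x₀).source) (i : Fin m)
    (a b : TangentSpace (𝓡 m) x) :
    coordComp m x₀ i x (a + b) = coordComp m x₀ i x a + coordComp m x₀ i x b := by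
  simp only [coordComp_eq_continuousLinearMapAt hx, map_add]
  rfl

theorem coordComp_smul {x₀ x : M} (hx : x ∈ (extChartAt (𝓡 m) x₀).source) (i : Fin m)
    (c : ℝ) (a : TangentSpace (𝓡 m) x) :
    coordComp m x₀ i x (c • a) = c * coordComp m x₀ i x a := by
  simp only [coordComp_eq_continuousLinearMapAt hx, map_smul]
  rfl

theorem coordComp_zero {x₀ x : M} (hx : x ∈ (extChartAt (𝓡 m) x₀).source) (i : Fin m) :
    coordComp m x₀ i x 0 = 0 := by
  simpa using coordComp_smul hx i 0 0

theorem coordComp_sum {ι : Type*} (s : Finset ι) {x₀ x : M}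
    (hx : x ∈ (extChartAt (𝓡 m) x₀).source) (i : Fin m) (f : ι → TangentSpace (𝓡 m) x) :
    coordComp m x₀ i x (∑ j ∈ s, f j) = ∑ j ∈ s, coordComp m x₀ i x (f j) := by
  classical
  induction s using Finset.induction_on with
  | empty => simp [coordComp_zero hx]
  | insert a s ha ih => rw [Finset.sum_insert ha, Finset.sum_insert ha, coordComp_add hx, ih]

theorem sum_coordComp_smul_coordVec {x₀ x : M} (hx : x ∈ (extChartAt (𝓡 m) x₀).source)
    (a : TangentSpace (𝓡 m) x) :
    ∑ i, coordComp m x₀ i x a • coordVec m x₀ i x = a := by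
  simp only [coordComp_eq_continuousLinearMapAt hx, coordVec_eq_symmL hx]
  rw [← Trivialization.symmL_continuousLinearMapAt (R := ℝ)
    (trivializationAt (Eu m) (TangentSpace (𝓡 m) : M → Type _) x₀) (mem_baseSet hx) a]
  set b := (trivializationAt (Eu m) (TangentSpace (𝓡 m) : M → Type _)
    x₀).continuousLinearMapAt ℝ x a
  simp only [← map_smul, ← map_sum]
  rw [Trivialization.continuousLinearMapAt_symmL _ (mem_baseSet hx)]
  congr 1
  have := (EuclideanSpace.basisFun (Fin m) ℝ).sum_repr b
  simpa using this

theorem coordComp_coordVec {x₀ x : M} (hx : x ∈ (extChartAt (𝓡 m) x₀).source) (i j : Fin m) :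
    coordComp m x₀ i x (coordVec m x₀ j x) = if i = j then 1 else 0 := by
  rw [coordComp_eq_continuousLinearMapAt hx, coordVec_eq_symmL hx,
    Trivialization.continuousLinearMapAt_symmL _ (mem_baseSet hx)]
  simp

theorem coordComp_eq_mfderiv {x₀ x : M} (hx : x ∈ (extChartAt (𝓡 m) x₀).source)
    (i : Fin m) (a : TangentSpace (𝓡 m) x) :
    coordComp m x₀ i x a =
      (show Eu m from mfderiv (𝓡 m) 𝓘(ℝ, Eu m) (extChartAt (𝓡 m) x₀) x a) i := by
  rw [coordComp_eq_continuousLinearMapAt hx,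
    TangentBundle.continuousLinearMapAt_trivializationAt (by simpa using hx)]
  rfl

theorem coordVec_eq_mfderiv {x₀ x : M} (hx : x ∈ (extChartAt (𝓡 m) x₀).source) (i : Fin m) :
    coordVec m x₀ i x =
      mfderivWithin 𝓘(ℝ, Eu m) (𝓡 m) (extChartAt (𝓡 m) x₀).symm (range (𝓡 m))
        (extChartAt (𝓡 m) x₀ x) (EuclideanSpace.single i (1 : ℝ)) := by
  rw [coordVec_eq_symmL hx, TangentBundle.symmL_trivializationAt (by simpa using hx)]
  rfl

/-- The components of `du(∂/∂xⁱ)` are the partial derivatives of `u` read in the charts. -/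
theorem coordComp_differential_coordVec {u : M → N} {x₀ x : M} {q₀ : N}
    (hu : MDifferentiableAt (𝓡 m) (𝓡 n) u x) (hx : x ∈ (extChartAt (𝓡 m) x₀).source)
    (hq : u x ∈ (extChartAt (𝓡 n) q₀).source) (α : Fin n) (i : Fin m) :
    coordComp n q₀ α (u x) (differential m n u x (coordVec m x₀ i x)) =
      fderiv ℝ (extChartAt (𝓡 n) q₀ ∘ u ∘ (extChartAt (𝓡 m) x₀).symm) (extChartAt (𝓡 m) x₀ x)
        (EuclideanSpace.single i (1 : ℝ)) α := by
  rw [coordComp_eq_mfderiv hq, coordVec_eq_mfderiv hx, differential]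
  have hxs : (extChartAt (𝓡 m) x₀).symm (extChartAt (𝓡 m) x₀ x) = x :=
    (extChartAt (𝓡 m) x₀).left_inv hx
  have h1 : HasMFDerivAt 𝓘(ℝ, Eu m) (𝓡 m) (extChartAt (𝓡 m) x₀).symm (extChartAt (𝓡 m) x₀ x)
      (mfderivWithin 𝓘(ℝ, Eu m) (𝓡 m) (extChartAt (𝓡 m) x₀).symm (range (𝓡 m))
        (extChartAt (𝓡 m) x₀ x)) := by
    rw [← hasMFDerivWithinAt_univ]
    have := (mdifferentiableWithinAt_extChartAt_symm (I := 𝓡 m) (x := x₀)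
      ((extChartAt (𝓡 m) x₀).map_source hx)).hasMFDerivWithinAt
    simpa using! this
  have h2 : HasMFDerivAt (𝓡 m) (𝓡 n) u ((extChartAt (𝓡 m) x₀).symm (extChartAt (𝓡 m) x₀ x))
      (mfderiv (𝓡 m) (𝓡 n) u ((extChartAt (𝓡 m) x₀).symm (extChartAt (𝓡 m) x₀ x))) := by
    rw [hxs]; exact hu.hasMFDerivAt
  have h3 : HasMFDerivAt (𝓡 n) 𝓘(ℝ, Eu n) (extChartAt (𝓡 n) q₀)
      (u ((extChartAt (𝓡 m) x₀).symm (extChartAt (𝓡 m) x₀ x)))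
      (mfderiv (𝓡 n) 𝓘(ℝ, Eu n) (extChartAt (𝓡 n) q₀)
        (u ((extChartAt (𝓡 m) x₀).symm (extChartAt (𝓡 m) x₀ x)))) := by
    rw [hxs]
    exact (mdifferentiableAt_extChartAt (by simpa using hq)).hasMFDerivAt
  have h4 := (HasMFDerivAt.comp (extChartAt (𝓡 m) x₀ x) h3
    (HasMFDerivAt.comp (extChartAt (𝓡 m) x₀ x) h2 h1)).mfderiv
  rw [mfderiv_eq_fderiv] at h4
  refine Eq.trans ?_ (congrArg (fun L : Eu m →L[ℝ] Eu n ↦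
    L (EuclideanSpace.single i (1 : ℝ)) α) h4).symm
  -- The derivatives at x and at `symm (extChartAt x)` live in different tangent spaces. Viewing all
  -- of them as maps of the model spaces removes the dependence, so that `hxs` can be applied.
  exact (congrArg (fun z ↦ (show Eu n →L[ℝ] Eu n from
      mfderiv (𝓡 n) 𝓘(ℝ, Eu n) (extChartAt (𝓡 n) q₀) (u z))
    ((show Eu m →L[ℝ] Eu n from mfderiv (𝓡 m) (𝓡 n) u z)
      ((show Eu m →L[ℝ] Eu m from mfderivWithin 𝓘(ℝ, Eu m) (𝓡 m) (extChartAt (𝓡 m) x₀).symm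
        (range (𝓡 m)) (extChartAt (𝓡 m) x₀ x)) (EuclideanSpace.single i (1 : ℝ)))) α) hxs).symm

end ChartFrames

/-! ### The metric, du, d_(3)u and the energy density as matrices in charts -/

section MetricInCharts

open Matrix

variable {m n : ℕ} {M : Type*} [TopologicalSpace M] [ChartedSpace (Eu m) M]
  [IsManifold (𝓡 m) ∞ M] {N : Type*} [TopologicalSpace N] [ChartedSpace (Eu n) N]
  [IsManifold (𝓡 n) ∞ N] [RiemannianBundle (fun x : M ↦ TangentSpace (𝓡 m) x)]
  [RiemannianBundle (fun y : N ↦ TangentSpace (𝓡 n) y)]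

theorem metricMatrix_extChartAt {x₀ x : M} (hx : x ∈ (extChartAt (𝓡 m) x₀).source)
    (i j : Fin m) :
    metricMatrix m x₀ (extChartAt (𝓡 m) x₀ x) i j =
      inner ℝ (coordVec m x₀ i x) (coordVec m x₀ j x) :=
  congrArg (fun z ↦ inner ℝ (coordVec m x₀ i z) (coordVec m x₀ j z))
    ((extChartAt (𝓡 m) x₀).left_inv hx)

variable (m) in
/-- The vector of the components of a tangent vector in the chart at `x₀`. -/
def coordTuple (x₀ x : M) (a : TangentSpace (𝓡 m) x) : Fin m → ℝ :=
  fun i ↦ coordComp m x₀ i x a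

theorem inner_eq_dotProduct_metricMatrix {x₀ x : M} (hx : x ∈ (extChartAt (𝓡 m) x₀).source)
    (a b : TangentSpace (𝓡 m) x) :
    inner ℝ a b = coordTuple m x₀ x a ⬝ᵥ
      (metricMatrix m x₀ (extChartAt (𝓡 m) x₀ x) *ᵥ coordTuple m x₀ x b) := by
  conv_lhs => rw [← sum_coordComp_smul_coordVec hx a, ← sum_coordComp_smul_coordVec hx b]
  simp only [sum_inner, inner_sum, inner_smul_left, inner_smul_right, dotProduct, mulVec,
    metricMatrix_extChartAt hx, coordTuple, Finset.mul_sum]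
  rw [Finset.sum_comm]
  refine Finset.sum_congr rfl fun i _ ↦ Finset.sum_congr rfl fun j _ ↦ ?_
  simp only [conj_trivial]
  ring

theorem linearIndependent_coordVec {x₀ x : M} (hx : x ∈ (extChartAt (𝓡 m) x₀).source) :
    LinearIndependent ℝ (fun i ↦ coordVec m x₀ i x) := by
  rw [Fintype.linearIndependent_iff]
  intro c hc i
  have := congrArg (coordComp m x₀ i x) hc
  rw [coordComp_sum _ hx, coordComp_zero hx] at this
  simpa [coordComp_smul hx, coordComp_coordVec hx] using this

theorem posDef_metricMatrix {x₀ : M} {y : Eu m} (hy : y ∈ (extChartAt (𝓡 m) x₀).target) :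
    (metricMatrix m x₀ y).PosDef :=
  posDef_gram_of_linearIndependent
    (linearIndependent_coordVec ((extChartAt (𝓡 m) x₀).map_target hy))

theorem metricMatrix_comm (x₀ : M) (y : Eu m) (i j : Fin m) :
    metricMatrix m x₀ y i j = metricMatrix m x₀ y j i := by
  simp only [metricMatrix, of_apply]
  exact (real_inner_comm _ _).symm

theorem transpose_metricMatrix (x₀ : M) (y : Eu m) :
    (metricMatrix m x₀ y)ᵀ = metricMatrix m x₀ y := by
  ext i j
  exact metricMatrix_comm x₀ y j i

theorem isUnit_det_metricMatrix {x₀ : M} {y : Eu m} (hy : y ∈ (extChartAt (𝓡 m) x₀).target) :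
    IsUnit (metricMatrix m x₀ y).det :=
  (posDef_metricMatrix hy).det_pos.ne'.isUnit

theorem contDiffOn_metricMatrix
    [IsContMDiffRiemannianBundle (𝓡 m) ∞ (Eu m) (fun x : M ↦ TangentSpace (𝓡 m) x)]
    (x₀ : M) (i j : Fin m) :
    ContDiffOn ℝ ∞ (fun y ↦ metricMatrix m x₀ y i j) (extChartAt (𝓡 m) x₀).target := by
  have h : ∀ i : Fin m, ContMDiffOn (𝓡 m) ((𝓡 m).prod 𝓘(ℝ, Eu m)) ∞
      (fun x : M ↦ (⟨x, coordVec m x₀ i x⟩ : TotalSpace (Eu m) (TangentSpace (𝓡 m) : M → Type _)))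
      (extChartAt (𝓡 m) x₀).source := by
    intro i
    have hs : (extChartAt (𝓡 m) x₀).source =
      (trivializationAt (Eu m) (TangentSpace (𝓡 m) : M → Type _) x₀).baseSet := by simp
    rw [hs]
    rw [Trivialization.contMDiffOn_section_baseSet_iff]
    -- In the trivialization at `x₀` the coordinate field is a constant section.
    refine (contMDiffOn_const (c := EuclideanSpace.single i (1 : ℝ))).congr fun y hy ↦ ?_
    simp only [coordVec]
    rw [Trivialization.apply_mk_symm _ hy]
  rw [← contMDiffOn_iff_contDiffOn]
  exact ((h i).inner_bundle (h j)).comp (contMDiffOn_extChartAt_symm x₀)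
    fun y hy ↦ (extChartAt (𝓡 m) x₀).map_target hy

variable (m) in
/-- The matrix of the components of a family of tangent vectors in the chart at `x₀`. -/
def frameMatrix {κ : Type*} (x₀ x : M) (e : κ → TangentSpace (𝓡 m) x) : Matrix (Fin m) κ ℝ :=
  of fun i s ↦ coordComp m x₀ i x (e s)

/-- Expanding each coordinate vector in the orthonormal basis and taking components gives (E Eᵀ) g =
1. The basis is chosen separately at every point, without any continuity; this identity removes it
from all formulas. -/
theorem frameMatrix_mul_transpose {κ : Type*} [Fintype κ] {x₀ x : M}
    (hx : x ∈ (extChartAt (𝓡 m) x₀).source) (e : OrthonormalBasis κ ℝ (TangentSpace (𝓡 m) x)) :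
    frameMatrix m x₀ x e * (frameMatrix m x₀ x e)ᵀ =
      (metricMatrix m x₀ (extChartAt (𝓡 m) x₀ x))⁻¹ := by
  refine (Matrix.inv_eq_left_inv ?_).symm
  ext j i
  have h := congrArg (coordComp m x₀ j x) (e.sum_repr (coordVec m x₀ i x))
  rw [coordComp_coordVec hx, coordComp_sum _ hx] at h
  rw [Matrix.one_apply, ← h, Matrix.mul_assoc, Matrix.mul_apply]
  refine Finset.sum_congr rfl fun s _ ↦ ?_
  rw [coordComp_smul hx, OrthonormalBasis.repr_apply_apply, inner_eq_dotProduct_metricMatrix hx,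
    mul_comm]
  congr 1
  simp only [Matrix.mul_apply, dotProduct, mulVec, coordTuple, coordComp_coordVec hx,
    transpose_apply, frameMatrix, of_apply]
  simp

variable (m n) in
/-- The Jacobian matrix of `u` at `x` with respect to the charts at `x₀` and `q₀`. -/
def diffMatrix (u : M → N) (x₀ : M) (q₀ : N) (x : M) : Matrix (Fin n) (Fin m) ℝ :=
  of fun α i ↦ coordComp n q₀ α (u x) (differential m n u x (coordVec m x₀ i x))

variable {u : M → N} {x₀ x : M} {q₀ : N}

theorem coordTuple_sum {ι : Type*} (s : Finset ι) (hx : x ∈ (extChartAt (𝓡 m) x₀).source)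
    (f : ι → TangentSpace (𝓡 m) x) :
    coordTuple m x₀ x (∑ j ∈ s, f j) = ∑ j ∈ s, coordTuple m x₀ x (f j) :=
  funext fun i ↦ by simpa [coordTuple] using! coordComp_sum s hx i f

theorem coordTuple_smul (hx : x ∈ (extChartAt (𝓡 m) x₀).source) (c : ℝ)
    (a : TangentSpace (𝓡 m) x) : coordTuple m x₀ x (c • a) = c • coordTuple m x₀ x a :=
  funext fun i ↦ coordComp_smul hx i c a

theorem coordTuple_differential (hx : x ∈ (extChartAt (𝓡 m) x₀).source)
    (hq : u x ∈ (extChartAt (𝓡 n) q₀).source) (a : TangentSpace (𝓡 m) x) :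
    coordTuple n q₀ (u x) (differential m n u x a) =
      diffMatrix m n u x₀ q₀ x *ᵥ coordTuple m x₀ x a := by
  conv_lhs => rw [← sum_coordComp_smul_coordVec hx a]
  simp only [map_sum, map_smul, coordTuple_sum _ hq, coordTuple_smul hq]
  ext α
  simp [mulVec, dotProduct, diffMatrix, coordTuple, mul_comm]

variable (m n) in
/-- The Gram matrix of the pullback `u^*h` of the metric in the chart at `x₀`. -/
def pullGram (u : M → N) (x₀ : M) (q₀ : N) (x : M) : Matrix (Fin m) (Fin m) ℝ :=
  (diffMatrix m n u x₀ q₀ x)ᵀ * metricMatrix n q₀ (extChartAt (𝓡 n) q₀ (u x)) * diffMatrix m n u x₀ q₀ x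

theorem inner_differential (hx : x ∈ (extChartAt (𝓡 m) x₀).source)
    (hq : u x ∈ (extChartAt (𝓡 n) q₀).source) (a b : TangentSpace (𝓡 m) x) :
    inner ℝ (differential m n u x a) (differential m n u x b) =
      coordTuple m x₀ x a ⬝ᵥ (pullGram m n u x₀ q₀ x *ᵥ coordTuple m x₀ x b) := by
  rw [inner_eq_dotProduct_metricMatrix hq, coordTuple_differential hx hq,
    coordTuple_differential hx hq, pullGram, ← mulVec_mulVec, ← mulVec_mulVec,
    Matrix.dotProduct_mulVec _ (diffMatrix m n u x₀ q₀ x)ᵀ, vecMul_transpose]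

theorem transpose_pullGram (u : M → N) (x₀ : M) (q₀ : N) (x : M) :
    (pullGram m n u x₀ q₀ x)ᵀ = pullGram m n u x₀ q₀ x := by
  simp [pullGram, transpose_mul, transpose_metricMatrix, Matrix.mul_assoc]

/-- The matrix algebra behind d_(3)u: symmetry of A lets each inner product be read as an entry of a
product, and each summation over the basis then produces one factor E Eᵀ. -/
theorem sum_sum_mul_smul_mulVec {κ ι ι' : Type*} [Fintype κ] [Fintype ι] [Fintype ι']
    (E : Matrix ι κ ℝ) (A : Matrix ι ι ℝ) (hA : Aᵀ = A) (J : Matrix ι' ι ℝ) (ξ : ι → ℝ) :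
    ∑ j, ∑ k, ((ξ ⬝ᵥ A *ᵥ E.col j) * (E.col j ⬝ᵥ A *ᵥ E.col k)) • (J *ᵥ E.col k) =
      (J * (E * Eᵀ) * A * (E * Eᵀ) * A) *ᵥ ξ := by
  have h1 : ∀ j, ξ ⬝ᵥ A *ᵥ E.col j = ((Eᵀ * A) *ᵥ ξ) j := by
    intro j
    rw [← mulVec_mulVec, Matrix.dotProduct_mulVec, ← mulVec_transpose, hA, dotProduct_comm]
    rfl
  have h2 : ∀ j k, E.col j ⬝ᵥ A *ᵥ E.col k = (Eᵀ * A * E) k j := by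
    intro j k
    rw [Matrix.dotProduct_mulVec, ← mulVec_transpose, hA, dotProduct_comm, Matrix.mul_assoc]
    rfl
  have h3 : ∀ k, J *ᵥ E.col k = (J * E).col k := fun k ↦ rfl
  simp only [h1, h2, h3]
  have h4 : (J * (E * Eᵀ) * A * (E * Eᵀ) * A) *ᵥ ξ =
      (J * E) *ᵥ ((Eᵀ * A * E) *ᵥ ((Eᵀ * A) *ᵥ ξ)) := by
    rw [mulVec_mulVec, mulVec_mulVec]
    simp only [Matrix.mul_assoc]
  rw [h4]
  generalize (Eᵀ * A) *ᵥ ξ = w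
  ext α
  simp only [Finset.sum_apply, Pi.smul_apply, smul_eq_mul]
  rw [Finset.sum_comm]
  simp only [mulVec, dotProduct, col_apply, Finset.mul_sum]
  refine Finset.sum_congr rfl fun k _ ↦ Finset.sum_congr rfl fun j _ ↦ ?_
  ring

/-- The two summations over the orthonormal basis give two factors g⁻¹, so the outcome is
independent of the basis and smooth wherever u is. -/
theorem coordTuple_dThree (hx : x ∈ (extChartAt (𝓡 m) x₀).source)
    (hq : u x ∈ (extChartAt (𝓡 n) q₀).source) (a : TangentSpace (𝓡 m) x) :
    coordTuple n q₀ (u x) (dThree m n u x a) =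
      (diffMatrix m n u x₀ q₀ x * (metricMatrix m x₀ (extChartAt (𝓡 m) x₀ x))⁻¹ *
        pullGram m n u x₀ q₀ x * (metricMatrix m x₀ (extChartAt (𝓡 m) x₀ x))⁻¹ *
        pullGram m n u x₀ q₀ x) *ᵥ coordTuple m x₀ x a := by
  rw [dThree_apply, ← frameMatrix_mul_transpose hx (orthoBasis m x)]
  simp only [coordTuple_sum _ hq, coordTuple_smul hq, inner_differential hx hq,
    coordTuple_differential hx hq]
  exact sum_sum_mul_smul_mulVec (frameMatrix m x₀ x (orthoBasis m x)) _
    (transpose_pullGram u x₀ q₀ x) _ _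

theorem sum_dotProduct_mulVec_col {κ ι : Type*} [Fintype κ] [Fintype ι]
    (E : Matrix ι κ ℝ) (B : Matrix ι ι ℝ) :
    ∑ s, E.col s ⬝ᵥ B *ᵥ E.col s = (B * (E * Eᵀ)).trace := by
  rw [← Matrix.mul_assoc, Matrix.trace_mul_comm, Matrix.trace]
  rfl

/-- The trace of a bilinear form over an orthonormal basis is its contraction with g⁻¹. This serves
both the energy density and the divergence that defines the tension field. -/
theorem sum_inner_eq_trace {κ : Type*} [Fintype κ] (hx : x ∈ (extChartAt (𝓡 m) x₀).source)
    (e : OrthonormalBasis κ ℝ (TangentSpace (𝓡 m) x)) (B : Matrix (Fin m) (Fin m) ℝ) :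
    ∑ s, coordTuple m x₀ x (e s) ⬝ᵥ B *ᵥ coordTuple m x₀ x (e s) =
      (B * (metricMatrix m x₀ (extChartAt (𝓡 m) x₀ x))⁻¹).trace := by
  rw [← frameMatrix_mul_transpose hx e, ← sum_dotProduct_mulVec_col]
  rfl

/-- The density is tr((g⁻¹A)³)/6: two factors g⁻¹ come from d_(3)u, the third from the trace over
the basis. -/
theorem energyDensity_eq_trace (hx : x ∈ (extChartAt (𝓡 m) x₀).source)
    (hq : u x ∈ (extChartAt (𝓡 n) q₀).source) :
    energyDensity m n u x = ((metricMatrix m x₀ (extChartAt (𝓡 m) x₀ x))⁻¹ *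
        pullGram m n u x₀ q₀ x * (metricMatrix m x₀ (extChartAt (𝓡 m) x₀ x))⁻¹ *
        pullGram m n u x₀ q₀ x * (metricMatrix m x₀ (extChartAt (𝓡 m) x₀ x))⁻¹ *
        pullGram m n u x₀ q₀ x).trace / 6 := by
  rw [energyDensity]
  congr 1
  have h1 : ∀ s, inner ℝ (dThree m n u x (orthoBasis m x s))
      (differential m n u x (orthoBasis m x s)) = coordTuple m x₀ x (orthoBasis m x s) ⬝ᵥ
      (pullGram m n u x₀ q₀ x * (metricMatrix m x₀ (extChartAt (𝓡 m) x₀ x))⁻¹ *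
        pullGram m n u x₀ q₀ x * (metricMatrix m x₀ (extChartAt (𝓡 m) x₀ x))⁻¹ *
        pullGram m n u x₀ q₀ x) *ᵥ coordTuple m x₀ x (orthoBasis m x s) := by
    intro s
    -- The target metric is absorbed into Jᵀ H J, which leaves a bilinear form on tangent vectors of
    -- the source.
    have ht : ∀ J : Matrix (Fin n) (Fin m) ℝ, ∀ ξ : Fin m → ℝ, ∀ H : Matrix (Fin n) (Fin n) ℝ,
        ∀ B : Matrix (Fin m) (Fin m) ℝ,
        ((J * B) *ᵥ ξ) ⬝ᵥ H *ᵥ (J *ᵥ ξ) = (B *ᵥ ξ) ⬝ᵥ ((Jᵀ * H * J) *ᵥ ξ) := by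
      intro J ξ H B
      rw [← mulVec_mulVec, ← mulVec_mulVec, ← mulVec_mulVec, Matrix.dotProduct_mulVec _ Jᵀ,
        vecMul_transpose]
    rw [inner_eq_dotProduct_metricMatrix hq, coordTuple_dThree hx hq,
      coordTuple_differential hx hq]
    simp only [Matrix.mul_assoc (diffMatrix m n u x₀ q₀ x)]
    rw [ht, ← pullGram, Matrix.dotProduct_mulVec, ← mulVec_transpose, mulVec_mulVec,
      transpose_pullGram, dotProduct_comm]
    simp only [Matrix.mul_assoc]
  simp only [h1]
  rw [sum_inner_eq_trace hx, Matrix.trace_mul_comm]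
  simp only [Matrix.mul_assoc]

end MetricInCharts

/-! ### Calculus of matrix valued functions -/

section MatrixCalculus

open Matrix

variable {E : Type*} [NormedAddCommGroup E] [NormedSpace ℝ E]
  {ι κ μ : Type*} [Fintype ι] [Fintype κ] [Fintype μ]

/-- A matrix valued function whose entries are smooth on `s`. -/
def SmoothMatrixOn (F : E → Matrix ι κ ℝ) (s : Set E) : Prop :=
  ∀ i j, ContDiffOn ℝ ∞ (fun z ↦ F z i j) s

namespace SmoothMatrixOn

variable {F : E → Matrix ι κ ℝ} {G : E → Matrix κ μ ℝ} {s : Set E}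

theorem mul (hF : SmoothMatrixOn F s) (hG : SmoothMatrixOn G s) :
    SmoothMatrixOn (fun z ↦ F z * G z) s := fun i j ↦ by
  simp only [Matrix.mul_apply]
  exact ContDiffOn.sum fun k _ ↦ (hF i k).mul (hG k j)

theorem transpose (hF : SmoothMatrixOn F s) : SmoothMatrixOn (fun z ↦ (F z)ᵀ) s :=
  fun i j ↦ hF j i

theorem trace {F : E → Matrix ι ι ℝ} (hF : SmoothMatrixOn F s) :
    ContDiffOn ℝ ∞ (fun z ↦ (F z).trace) s := by
  simp only [Matrix.trace, diag_apply]
  exact ContDiffOn.sum fun i _ ↦ hF i i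

theorem det [DecidableEq ι] {F : E → Matrix ι ι ℝ} (hF : SmoothMatrixOn F s) :
    ContDiffOn ℝ ∞ (fun z ↦ (F z).det) s := by
  simp only [Matrix.det_apply']
  exact ContDiffOn.sum fun σ _ ↦ contDiffOn_const.mul (contDiffOn_prod fun i _ ↦ hF _ _)

/-- By Cramer's rule an entry of the inverse is a determinant divided by det F. The determinant in
the numerator has one row replaced by a constant row, so all its entries are smooth. -/
theorem inv [DecidableEq ι] {F : E → Matrix ι ι ℝ} (hF : SmoothMatrixOn F s)
    (h : ∀ z ∈ s, IsUnit (F z).det) : SmoothMatrixOn (fun z ↦ (F z)⁻¹) s := fun i j ↦ by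
  simp only [Matrix.inv_def, Ring.inverse_eq_inv', Matrix.smul_apply, adjugate_apply, smul_eq_mul]
  refine (hF.det.inv fun z hz ↦ (h z hz).ne_zero).mul (det fun k l ↦ ?_)
  by_cases hk : k = j
  · subst hk
    simpa using contDiffOn_const
  · simpa [updateRow_ne hk] using hF k l

end SmoothMatrixOn

/-- A matrix valued function whose entries are differentiable at `y`. -/
def DiffMatrixAt (F : E → Matrix ι κ ℝ) (y : E) : Prop :=
  ∀ i j, DifferentiableAt ℝ (fun z ↦ F z i j) y

theorem SmoothMatrixOn.diffMatrixAt {F : E → Matrix ι κ ℝ} {s : Set E} {y : E}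
    (hF : SmoothMatrixOn F s) (hs : s ∈ 𝓝 y) : DiffMatrixAt F y :=
  fun i j ↦ ((hF i j).contDiffAt hs).differentiableAt (by simp)

/-- The entrywise derivative at `y` in the direction `v` of a matrix valued function. -/
def matrixDeriv (F : E → Matrix ι κ ℝ) (y v : E) : Matrix ι κ ℝ :=
  of fun i j ↦ fderiv ℝ (fun z ↦ F z i j) y v

theorem DiffMatrixAt.mul {F : E → Matrix ι κ ℝ} {G : E → Matrix κ μ ℝ} {y : E}
    (hF : DiffMatrixAt F y) (hG : DiffMatrixAt G y) : DiffMatrixAt (fun z ↦ F z * G z) y :=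
  fun i j ↦ by
    simp only [Matrix.mul_apply]
    exact DifferentiableAt.fun_sum fun k _ ↦ (hF i k).mul (hG k j)

theorem matrixDeriv_mul {F : E → Matrix ι κ ℝ} {G : E → Matrix κ μ ℝ} {y : E}
    (hF : DiffMatrixAt F y) (hG : DiffMatrixAt G y) (v : E) :
    matrixDeriv (fun z ↦ F z * G z) y v =
      matrixDeriv F y v * G y + F y * matrixDeriv G y v := by
  ext i j
  simp only [matrixDeriv, Matrix.mul_apply, of_apply, Matrix.add_apply]
  rw [fderiv_fun_sum fun k _ ↦ (hF i k).fun_mul (hG k j), _root_.sum_apply, ← Finset.sum_add_distrib]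
  refine Finset.sum_congr rfl fun k _ ↦ ?_
  rw [fderiv_fun_mul (hF i k) (hG k j)]
  simp only [_root_.add_apply, _root_.smul_apply, smul_eq_mul]
  ring

theorem matrixDeriv_transpose (F : E → Matrix ι κ ℝ) (y v : E) :
    matrixDeriv (fun z ↦ (F z)ᵀ) y v = (matrixDeriv F y v)ᵀ := rfl

theorem DiffMatrixAt.transpose {F : E → Matrix ι κ ℝ} {y : E} (hF : DiffMatrixAt F y) :
    DiffMatrixAt (fun z ↦ (F z)ᵀ) y := fun i j ↦ hF j i

theorem fderiv_trace {F : E → Matrix ι ι ℝ} {y : E} (hF : DiffMatrixAt F y) (v : E) :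
    fderiv ℝ (fun z ↦ (F z).trace) y v = (matrixDeriv F y v).trace := by
  simp only [Matrix.trace, diag_apply, matrixDeriv, of_apply]
  rw [fderiv_fun_sum fun k _ ↦ hF k k, _root_.sum_apply]

/-- **Jacobi's formula** for the derivative of a determinant. -/
theorem hasFDerivAt_det [DecidableEq ι] {F : E → Matrix ι ι ℝ} {F' : ι → ι → E →L[ℝ] ℝ} {y : E}
    (hF : ∀ i j, HasFDerivAt (fun z ↦ F z i j) (F' i j) y) :
    HasFDerivAt (fun z ↦ (F z).det) (∑ i, ∑ j, (F y).adjugate j i • F' i j) y := by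
  have h1 : HasFDerivAt (fun z ↦ (F z : ι → ι → ℝ))
      (ContinuousLinearMap.pi fun i ↦ ContinuousLinearMap.pi fun j ↦ F' i j) y :=
    hasFDerivAt_pi.2 fun i ↦ hasFDerivAt_pi.2 fun j ↦ hF i j
  -- As a multilinear function of the rows, the determinant has a derivative that replaces one row
  -- at a time by its derivative.
  let D : ContinuousMultilinearMap ℝ (fun _ : ι ↦ ι → ℝ) ℝ :=
    { toMultilinearMap := (detRowAlternating (R := ℝ) (n := ι)).toMultilinearMap
      cont := by
        change Continuous fun A : Matrix ι ι ℝ ↦ A.det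
        exact Continuous.matrix_det continuous_id }
  have h2 := (D.hasFDerivAt (F y)).comp y h1
  refine h2.congr_fderiv ?_
  ext v
  refine (ContinuousMultilinearMap.linearDeriv_apply D (F y) _).trans ?_
  simp only [_root_.sum_apply, _root_.smul_apply, smul_eq_mul]
  refine Finset.sum_congr rfl fun i _ ↦ ?_
  change ((F y).updateRow i fun j ↦ F' i j v).det = _
  -- A determinant with a replaced row is an entry of Cramer's solution, hence a combination of
  -- entries of the adjugate.
  rw [← cramer_transpose_apply, cramer_eq_adjugate_mulVec, ← adjugate_transpose]
  simp [mulVec, dotProduct]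

/-- Jacobi's formula divided by the determinant turns the adjugate into the inverse. It is used
twice: for the metric, where it gives the volume term of the divergence, and for the Jacobian of a
change of charts. -/
theorem fderiv_log_det [DecidableEq ι] {F : E → Matrix ι ι ℝ} {y : E} (hF : DiffMatrixAt F y)
    (h : IsUnit (F y).det) (v : E) :
    fderiv ℝ (fun z ↦ Real.log (F z).det) y v = ((F y)⁻¹ * matrixDeriv F y v).trace := by
  have h1 := hasFDerivAt_det fun i j ↦ (hF i j).hasFDerivAt
  rw [(h1.log h.ne_zero).fderiv]
  simp only [_root_.smul_apply, _root_.sum_apply, smul_eq_mul, Matrix.trace, diag_apply,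
    Matrix.mul_apply, Matrix.inv_def, Ring.inverse_eq_inv', Matrix.smul_apply, matrixDeriv,
    of_apply, Finset.mul_sum]
  rw [Finset.sum_comm]
  refine Finset.sum_congr rfl fun k _ ↦ Finset.sum_congr rfl fun j _ ↦ ?_
  ring

theorem DiffMatrixAt.det [DecidableEq ι] {F : E → Matrix ι ι ℝ} {y : E} (hF : DiffMatrixAt F y) :
    DifferentiableAt ℝ (fun z ↦ (F z).det) y :=
  (hasFDerivAt_det fun i j ↦ (hF i j).hasFDerivAt).differentiableAt

end MatrixCalculus

/-! ### A variation in charts on space-time, and the time derivative of its density -/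

section LocalVariation

open Matrix

variable {m n : ℕ} {M : Type*} [TopologicalSpace M] [ChartedSpace (Eu m) M]
  {N : Type*} [TopologicalSpace N] [ChartedSpace (Eu n) N]

variable (m n) in
/-- A family of maps `U t : M → N`, read in the charts at `x₀` and `q₀`. -/
def localMap (x₀ : M) (q₀ : N) (U : ℝ → M → N) (p : ℝ × Eu m) : Eu n :=
  extChartAt (𝓡 n) q₀ (U p.1 ((extChartAt (𝓡 m) x₀).symm p.2))

variable (m n) in
/-- The domain of `localMap`, for times in `(-δ, δ)`. -/
def localDom (x₀ : M) (q₀ : N) (U : ℝ → M → N) (δ : ℝ) : Set (ℝ × Eu m) :=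
  (Ioo (-δ) δ ×ˢ (extChartAt (𝓡 m) x₀).target) ∩
    (fun p : ℝ × Eu m ↦ U p.1 ((extChartAt (𝓡 m) x₀).symm p.2)) ⁻¹' (extChartAt (𝓡 n) q₀).source

/-- The spatial Jacobian matrix of a map defined on space-time. -/
def jac (w : ℝ × Eu m → Eu n) (p : ℝ × Eu m) : Matrix (Fin n) (Fin m) ℝ :=
  of fun α i ↦ fderiv ℝ w p (0, EuclideanSpace.single i (1 : ℝ)) α

theorem fderiv_slice {F : Type*} [NormedAddCommGroup F] [NormedSpace ℝ F]
    {f : ℝ × Eu m → F} {t : ℝ} {y : Eu m} (hf : DifferentiableAt ℝ f (t, y)) (e : Eu m) :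
    fderiv ℝ (fun z ↦ f (t, z)) y e = fderiv ℝ f (t, y) (0, e) := by
  have h := hf.hasFDerivAt.comp y (hasFDerivAt_prodMk_right (𝕜 := ℝ) t y)
  have h' : fderiv ℝ (fun z ↦ f (t, z)) y = _ := h.fderiv
  rw [h']
  simp

theorem hasDerivAt_slice {F : Type*} [NormedAddCommGroup F] [NormedSpace ℝ F]
    {f : ℝ × Eu m → F} {t : ℝ} {y : Eu m} (hf : DifferentiableAt ℝ f (t, y)) :
    HasDerivAt (fun s ↦ f (s, y)) (fderiv ℝ f (t, y) (1, 0)) t := by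
  have h := (hf.hasFDerivAt.comp t (hasFDerivAt_prodMk_left (𝕜 := ℝ) t y)).hasDerivAt
  simpa using! h

section Smoothness

variable [IsManifold (𝓡 m) ∞ M] [IsManifold (𝓡 n) ∞ N] {u : M → N} {δ : ℝ} {K : Set M}
  {U : ℝ → M → N} {x₀ : M} {q₀ : N}

theorem IsVariation.contMDiffOn_symm (hU : IsVariation m n u δ K U) (x₀ : M) :
    ContMDiffOn 𝓘(ℝ, ℝ × Eu m) (𝓡 n) ∞
      (fun p : ℝ × Eu m ↦ U p.1 ((extChartAt (𝓡 m) x₀).symm p.2))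
      (Ioo (-δ) δ ×ˢ (extChartAt (𝓡 m) x₀).target) := by
  have h1 : ContMDiffOn 𝓘(ℝ, ℝ × Eu m) (𝓘(ℝ, ℝ).prod (𝓡 m)) ∞
      (fun p : ℝ × Eu m ↦ (p.1, (extChartAt (𝓡 m) x₀).symm p.2))
      (Ioo (-δ) δ ×ˢ (extChartAt (𝓡 m) x₀).target) :=
    contDiff_fst.contMDiff.contMDiffOn.prodMk
      ((contMDiffOn_extChartAt_symm x₀).comp contDiff_snd.contMDiff.contMDiffOn
        fun p hp ↦ hp.2)
  exact hU.smooth.comp h1 fun p hp ↦ ⟨hp.1, mem_univ _⟩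

theorem IsVariation.isOpen_localDom (hU : IsVariation m n u δ K U) (x₀ : M) (q₀ : N) :
    IsOpen (localDom m n x₀ q₀ U δ) :=
  (hU.contMDiffOn_symm x₀).continuousOn.isOpen_inter_preimage
    (isOpen_Ioo.prod (isOpen_extChartAt_target x₀)) (isOpen_extChartAt_source q₀)

theorem IsVariation.contDiffOn_localMap (hU : IsVariation m n u δ K U) (x₀ : M) (q₀ : N) :
    ContDiffOn ℝ ∞ (localMap m n x₀ q₀ U) (localDom m n x₀ q₀ U δ) := by
  rw [← contMDiffOn_iff_contDiffOn]
  refine (contMDiffOn_extChartAt (x := q₀)).comp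
    ((hU.contMDiffOn_symm x₀).mono inter_subset_left) fun p hp ↦ ?_
  simpa using hp.2

theorem IsVariation.contMDiff (hU : IsVariation m n u δ K U) {t : ℝ} (ht : t ∈ Ioo (-δ) δ) :
    ContMDiff (𝓡 m) (𝓡 n) ∞ (U t) := by
  rw [← contMDiffOn_univ]
  exact hU.smooth.comp (contMDiffOn_const.prodMk contMDiffOn_id) fun x hx ↦ ⟨ht, mem_univ _⟩

theorem mem_localDom {t : ℝ} {x : M} (ht : t ∈ Ioo (-δ) δ)
    (hx : x ∈ (extChartAt (𝓡 m) x₀).source) (hq : U t x ∈ (extChartAt (𝓡 n) q₀).source) :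
    (t, extChartAt (𝓡 m) x₀ x) ∈ localDom m n x₀ q₀ U δ := by
  refine ⟨⟨ht, (extChartAt (𝓡 m) x₀).map_source hx⟩, ?_⟩
  simpa only [mem_preimage, (extChartAt (𝓡 m) x₀).left_inv hx] using hq

theorem localMap_extChartAt (q₀ : N) (U : ℝ → M → N) (t : ℝ) {x : M}
    (hx : x ∈ (extChartAt (𝓡 m) x₀).source) :
    localMap m n x₀ q₀ U (t, extChartAt (𝓡 m) x₀ x) = extChartAt (𝓡 n) q₀ (U t x) := by
  simp only [localMap, (extChartAt (𝓡 m) x₀).left_inv hx]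

theorem IsVariation.differentiableAt_localMap (hU : IsVariation m n u δ K U) {p : ℝ × Eu m}
    (hp : p ∈ localDom m n x₀ q₀ U δ) : DifferentiableAt ℝ (localMap m n x₀ q₀ U) p :=
  ((hU.contDiffOn_localMap x₀ q₀).contDiffAt
    ((hU.isOpen_localDom x₀ q₀).mem_nhds hp)).differentiableAt (by simp)

theorem IsVariation.contDiffOn_fderiv_localMap (hU : IsVariation m n u δ K U) (x₀ : M) (q₀ : N)
    (v : ℝ × Eu m) (α : Fin n) :
    ContDiffOn ℝ ∞ (fun p ↦ fderiv ℝ (localMap m n x₀ q₀ U) p v α) (localDom m n x₀ q₀ U δ) := by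
  have h := ((hU.contDiffOn_localMap x₀ q₀).fderiv_of_isOpen (m := ∞)
    (hU.isOpen_localDom x₀ q₀) (by simp)).clm_apply (contDiffOn_const (c := v))
  exact contDiffOn_euclidean.1 h α

theorem IsVariation.smoothMatrixOn_jac (hU : IsVariation m n u δ K U) (x₀ : M) (q₀ : N) :
    SmoothMatrixOn (jac (localMap m n x₀ q₀ U)) (localDom m n x₀ q₀ U δ) :=
  fun α _ ↦ hU.contDiffOn_fderiv_localMap x₀ q₀ _ α

/-- The Jacobians of all the maps `U t` are spatial derivatives of one smooth function on an open
set of space-time, so time and space derivatives can be exchanged later. -/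
theorem IsVariation.diffMatrix_eq_jac (hU : IsVariation m n u δ K U) {t : ℝ} {x : M}
    (ht : t ∈ Ioo (-δ) δ) (hx : x ∈ (extChartAt (𝓡 m) x₀).source)
    (hq : U t x ∈ (extChartAt (𝓡 n) q₀).source) :
    diffMatrix m n (U t) x₀ q₀ x = jac (localMap m n x₀ q₀ U) (t, extChartAt (𝓡 m) x₀ x) := by
  ext α i
  simp only [diffMatrix, jac, of_apply]
  rw [coordComp_differential_coordVec ((hU.contMDiff ht).mdifferentiableAt (by simp)) hx hq,
    ← fderiv_slice (hU.differentiableAt_localMap (mem_localDom ht hx hq))]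
  rfl

end Smoothness

section Metric

variable [IsManifold (𝓡 m) ∞ M] [IsManifold (𝓡 n) ∞ N] {u : M → N} {δ : ℝ} {K : Set M}
  {U : ℝ → M → N} {x₀ : M} {q₀ : N}
  [RiemannianBundle (fun x : M ↦ TangentSpace (𝓡 m) x)]
  [RiemannianBundle (fun y : N ↦ TangentSpace (𝓡 n) y)]

variable (m) in
/-- The inverse metric `(gⁱʲ)` in the chart at `x₀`, as a function on space-time. -/
def localInvMetric (x₀ : M) (p : ℝ × Eu m) : Matrix (Fin m) (Fin m) ℝ :=
  (metricMatrix m x₀ p.2)⁻¹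

variable (m n) in
/-- The metric of the target along a family of maps, in charts. -/
def localTargetMetric (x₀ : M) (q₀ : N) (U : ℝ → M → N) (p : ℝ × Eu m) :
    Matrix (Fin n) (Fin n) ℝ :=
  metricMatrix n q₀ (localMap m n x₀ q₀ U p)

variable (m n) in
/-- The pullback metric of a family of maps, in charts. -/
def localGram (x₀ : M) (q₀ : N) (U : ℝ → M → N) (p : ℝ × Eu m) : Matrix (Fin m) (Fin m) ℝ :=
  (jac (localMap m n x₀ q₀ U) p)ᵀ * localTargetMetric m n x₀ q₀ U p * jac (localMap m n x₀ q₀ U) p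

variable (m n) in
/-- The symmetric contravariant tensor `g⁻¹ A g⁻¹ A g⁻¹`, where `A` is the pullback metric. -/
def localTensor (x₀ : M) (q₀ : N) (U : ℝ → M → N) (p : ℝ × Eu m) : Matrix (Fin m) (Fin m) ℝ :=
  localInvMetric m x₀ p * localGram m n x₀ q₀ U p * localInvMetric m x₀ p *
    localGram m n x₀ q₀ U p * localInvMetric m x₀ p

variable (m n) in
/-- The components of `d_(3)u`, with the form index raised. -/
def localFlux (x₀ : M) (q₀ : N) (U : ℝ → M → N) (p : ℝ × Eu m) : Matrix (Fin n) (Fin m) ℝ :=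
  jac (localMap m n x₀ q₀ U) p * localTensor m n x₀ q₀ U p

variable (m n) in
/-- The energy density of a family of maps, in charts. -/
def localDensity (x₀ : M) (q₀ : N) (U : ℝ → M → N) (p : ℝ × Eu m) : ℝ :=
  (localTensor m n x₀ q₀ U p * localGram m n x₀ q₀ U p).trace / 6

theorem transpose_localGram (x₀ : M) (q₀ : N) (U : ℝ → M → N) (p : ℝ × Eu m) :
    (localGram m n x₀ q₀ U p)ᵀ = localGram m n x₀ q₀ U p := by
  simp [localGram, localTargetMetric, transpose_mul, transpose_metricMatrix, Matrix.mul_assoc]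

theorem transpose_localInvMetric (x₀ : M) (p : ℝ × Eu m) :
    (localInvMetric m x₀ p)ᵀ = localInvMetric m x₀ p := by
  rw [localInvMetric, transpose_nonsing_inv, transpose_metricMatrix]

theorem transpose_localTensor (x₀ : M) (q₀ : N) (U : ℝ → M → N) (p : ℝ × Eu m) :
    (localTensor m n x₀ q₀ U p)ᵀ = localTensor m n x₀ q₀ U p := by
  simp only [localTensor, transpose_mul, transpose_localGram, transpose_localInvMetric,
    Matrix.mul_assoc]

theorem IsVariation.pullGram_eq (hU : IsVariation m n u δ K U) {t : ℝ} {x : M}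
    (ht : t ∈ Ioo (-δ) δ) (hx : x ∈ (extChartAt (𝓡 m) x₀).source)
    (hq : U t x ∈ (extChartAt (𝓡 n) q₀).source) :
    pullGram m n (U t) x₀ q₀ x = localGram m n x₀ q₀ U (t, extChartAt (𝓡 m) x₀ x) := by
  rw [pullGram, localGram, hU.diffMatrix_eq_jac ht hx hq, localTargetMetric,
    localMap_extChartAt q₀ U t hx]

theorem IsVariation.energyDensity_eq (hU : IsVariation m n u δ K U) {t : ℝ} {x : M}
    (ht : t ∈ Ioo (-δ) δ) (hx : x ∈ (extChartAt (𝓡 m) x₀).source)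
    (hq : U t x ∈ (extChartAt (𝓡 n) q₀).source) :
    energyDensity m n (U t) x = localDensity m n x₀ q₀ U (t, extChartAt (𝓡 m) x₀ x) := by
  rw [energyDensity_eq_trace hx hq, hU.pullGram_eq ht hx hq]
  rfl

/-- The last factor g⁻¹ in `localTensor` is compensated by g. Keeping d_(3)u in the form Qg
separates the part with raised index, which enters the flux, from the metric, whose derivative will
meet the Christoffel symbols of M. -/
theorem IsVariation.coordTuple_dThree (hU : IsVariation m n u δ K U) {t : ℝ} {x : M}
    (ht : t ∈ Ioo (-δ) δ) (hx : x ∈ (extChartAt (𝓡 m) x₀).source)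
    (hq : U t x ∈ (extChartAt (𝓡 n) q₀).source) (a : TangentSpace (𝓡 m) x) :
    coordTuple n q₀ (U t x) (dThree m n (U t) x a) =
      (localFlux m n x₀ q₀ U (t, extChartAt (𝓡 m) x₀ x) *
        metricMatrix m x₀ (extChartAt (𝓡 m) x₀ x)) *ᵥ coordTuple m x₀ x a := by
  rw [PhiThree.coordTuple_dThree hx hq, hU.pullGram_eq ht hx hq, hU.diffMatrix_eq_jac ht hx hq]
  simp only [localFlux, localTensor, localInvMetric, Matrix.mul_assoc]
  rw [nonsing_inv_mul _ (isUnit_det_metricMatrix ((extChartAt (𝓡 m) x₀).map_source hx)),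
    Matrix.mul_one]

variable [IsContMDiffRiemannianBundle (𝓡 m) ∞ (Eu m) (fun x : M ↦ TangentSpace (𝓡 m) x)]
  [IsContMDiffRiemannianBundle (𝓡 n) ∞ (Eu n) (fun y : N ↦ TangentSpace (𝓡 n) y)]

theorem smoothMatrixOn_metricMatrix (x₀ : M) :
    SmoothMatrixOn (metricMatrix m x₀) (extChartAt (𝓡 m) x₀).target :=
  contDiffOn_metricMatrix x₀

theorem smoothMatrixOn_localInvMetric (x₀ : M) (q₀ : N) (U : ℝ → M → N) (δ : ℝ) :
    SmoothMatrixOn (localInvMetric m x₀) (localDom m n x₀ q₀ U δ) := fun i j ↦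
  (((smoothMatrixOn_metricMatrix x₀).inv fun _ hy ↦ isUnit_det_metricMatrix hy) i j).comp
    contDiff_snd.contDiffOn fun _ hp ↦ hp.1.2

theorem localMap_mem_target {p : ℝ × Eu m} (hp : p ∈ localDom m n x₀ q₀ U δ) :
    localMap m n x₀ q₀ U p ∈ (extChartAt (𝓡 n) q₀).target :=
  (extChartAt (𝓡 n) q₀).map_source hp.2

theorem IsVariation.smoothMatrixOn_localTargetMetric (hU : IsVariation m n u δ K U) (x₀ : M)
    (q₀ : N) : SmoothMatrixOn (localTargetMetric m n x₀ q₀ U) (localDom m n x₀ q₀ U δ) :=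
  fun α β ↦ (contDiffOn_metricMatrix q₀ α β).comp (hU.contDiffOn_localMap x₀ q₀)
    fun _ hp ↦ localMap_mem_target hp

theorem IsVariation.smoothMatrixOn_localGram (hU : IsVariation m n u δ K U) (x₀ : M) (q₀ : N) :
    SmoothMatrixOn (localGram m n x₀ q₀ U) (localDom m n x₀ q₀ U δ) :=
  ((hU.smoothMatrixOn_jac x₀ q₀).transpose.mul (hU.smoothMatrixOn_localTargetMetric x₀ q₀)).mul
    (hU.smoothMatrixOn_jac x₀ q₀)

theorem IsVariation.smoothMatrixOn_localTensor (hU : IsVariation m n u δ K U) (x₀ : M) (q₀ : N) :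
    SmoothMatrixOn (localTensor m n x₀ q₀ U) (localDom m n x₀ q₀ U δ) := by
  have h1 := smoothMatrixOn_localInvMetric (m := m) (n := n) x₀ q₀ U δ
  have h2 := hU.smoothMatrixOn_localGram x₀ q₀
  exact (((h1.mul h2).mul h1).mul h2).mul h1

theorem IsVariation.smoothMatrixOn_localFlux (hU : IsVariation m n u δ K U) (x₀ : M) (q₀ : N) :
    SmoothMatrixOn (localFlux m n x₀ q₀ U) (localDom m n x₀ q₀ U δ) :=
  (hU.smoothMatrixOn_jac x₀ q₀).mul (hU.smoothMatrixOn_localTensor x₀ q₀)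

theorem IsVariation.contDiffOn_localDensity (hU : IsVariation m n u δ K U) (x₀ : M) (q₀ : N) :
    ContDiffOn ℝ ∞ (localDensity m n x₀ q₀ U) (localDom m n x₀ q₀ U δ) :=
  ((hU.smoothMatrixOn_localTensor x₀ q₀).mul (hU.smoothMatrixOn_localGram x₀ q₀)).trace.div_const 6

/-- Chain rule: the target metric depends on space-time only through the image point. The direction
v is arbitrary because both the time derivative and the spatial derivatives are needed. -/
theorem IsVariation.matrixDeriv_localTargetMetric (hU : IsVariation m n u δ K U)
    {p : ℝ × Eu m} (hp : p ∈ localDom m n x₀ q₀ U δ) (v : ℝ × Eu m) (α β : Fin n) :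
    matrixDeriv (localTargetMetric m n x₀ q₀ U) p v α β =
      ∑ γ, fderiv ℝ (localMap m n x₀ q₀ U) p v γ * metricDeriv n q₀ (localMap m n x₀ q₀ U p) γ α β := by
  have h1 : DifferentiableAt ℝ (fun z ↦ metricMatrix n q₀ z α β) (localMap m n x₀ q₀ U p) :=
    ((contDiffOn_metricMatrix q₀ α β).contDiffAt
      ((isOpen_extChartAt_target q₀).mem_nhds (localMap_mem_target hp))).differentiableAt (by simp)
  have h2 := (h1.hasFDerivAt.comp p (hU.differentiableAt_localMap hp).hasFDerivAt).fderiv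
  simp only [matrixDeriv, of_apply, metricDeriv]
  refine (congrArg (fun L : ℝ × Eu m →L[ℝ] ℝ ↦ L v) h2).trans ?_
  rw [ContinuousLinearMap.comp_apply]
  set ξ := fderiv ℝ (localMap m n x₀ q₀ U) p v
  conv_lhs => rw [← (EuclideanSpace.basisFun (Fin n) ℝ).sum_repr ξ]
  simp

/-- The time derivative of the energy density, in charts. -/
theorem IsVariation.fderiv_localDensity_time (hU : IsVariation m n u δ K U) {p : ℝ × Eu m}
    (hp : p ∈ localDom m n x₀ q₀ U δ) :
    fderiv ℝ (localDensity m n x₀ q₀ U) p (1, 0) =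
      ((localFlux m n x₀ q₀ U p)ᵀ * localTargetMetric m n x₀ q₀ U p *
        matrixDeriv (jac (localMap m n x₀ q₀ U)) p (1, 0)).trace +
      (1 / 2) * ((localFlux m n x₀ q₀ U p)ᵀ * matrixDeriv (localTargetMetric m n x₀ q₀ U) p (1, 0) *
        jac (localMap m n x₀ q₀ U) p).trace := by
  have hs := (hU.isOpen_localDom x₀ q₀).mem_nhds hp
  have hJ := (hU.smoothMatrixOn_jac x₀ q₀).diffMatrixAt hs
  have hH := (hU.smoothMatrixOn_localTargetMetric x₀ q₀).diffMatrixAt hs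
  have hA := (hU.smoothMatrixOn_localGram x₀ q₀).diffMatrixAt hs
  have hG := (smoothMatrixOn_localInvMetric (m := m) x₀ q₀ U δ).diffMatrixAt hs
  have hB := (hU.smoothMatrixOn_localTensor x₀ q₀).diffMatrixAt hs
  -- The metric of M does not depend on time.
  have hG0 : matrixDeriv (localInvMetric m x₀) p (1, 0) = 0 := by
    ext i j
    have := (hasDerivAt_slice (t := p.1) (y := p.2) (hG i j)).unique
      (hasDerivAt_const p.1 (localInvMetric m x₀ p i j))
    simpa [matrixDeriv] using this
  have hA' : matrixDeriv (localGram m n x₀ q₀ U) p (1, 0) =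
      ((matrixDeriv (jac (localMap m n x₀ q₀ U)) p (1, 0))ᵀ * localTargetMetric m n x₀ q₀ U p +
        (jac (localMap m n x₀ q₀ U) p)ᵀ * matrixDeriv (localTargetMetric m n x₀ q₀ U) p (1, 0)) *
        jac (localMap m n x₀ q₀ U) p + (jac (localMap m n x₀ q₀ U) p)ᵀ * localTargetMetric m n x₀ q₀ U p *
        matrixDeriv (jac (localMap m n x₀ q₀ U)) p (1, 0) := by
    change matrixDeriv (fun z ↦ (jac (localMap m n x₀ q₀ U) z)ᵀ * localTargetMetric m n x₀ q₀ U z *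
      jac (localMap m n x₀ q₀ U) z) p (1, 0) = _
    rw [matrixDeriv_mul (hJ.transpose.mul hH) hJ, matrixDeriv_mul hJ.transpose hH,
      matrixDeriv_transpose]
  have hB' : matrixDeriv (localTensor m n x₀ q₀ U) p (1, 0) =
      localInvMetric m x₀ p * matrixDeriv (localGram m n x₀ q₀ U) p (1, 0) *
        localInvMetric m x₀ p * localGram m n x₀ q₀ U p * localInvMetric m x₀ p +
      localInvMetric m x₀ p * localGram m n x₀ q₀ U p * localInvMetric m x₀ p *
        matrixDeriv (localGram m n x₀ q₀ U) p (1, 0) * localInvMetric m x₀ p := by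
    change matrixDeriv (fun z ↦ localInvMetric m x₀ z * localGram m n x₀ q₀ U z *
      localInvMetric m x₀ z * localGram m n x₀ q₀ U z * localInvMetric m x₀ z) p (1, 0) = _
    rw [matrixDeriv_mul (((hG.mul hA).mul hG).mul hA) hG,
      matrixDeriv_mul ((hG.mul hA).mul hG) hA, matrixDeriv_mul (hG.mul hA) hG,
      matrixDeriv_mul hG hA, hG0]
    simp only [Matrix.zero_mul, Matrix.mul_zero, zero_add, add_zero, Matrix.add_mul]
  have hD : fderiv ℝ (localDensity m n x₀ q₀ U) p (1, 0) =
      (matrixDeriv (fun z ↦ localTensor m n x₀ q₀ U z * localGram m n x₀ q₀ U z) p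
        (1, 0)).trace / 6 := by
    rw [← fderiv_trace (hB.mul hA)]
    have h1 : DifferentiableAt ℝ
        (fun z ↦ (localTensor m n x₀ q₀ U z * localGram m n x₀ q₀ U z).trace) p :=
      (((hU.smoothMatrixOn_localTensor x₀ q₀).mul
        (hU.smoothMatrixOn_localGram x₀ q₀)).trace.contDiffAt hs).differentiableAt (by simp)
    have h2 := (h1.hasFDerivAt.mul_const (6 : ℝ)⁻¹).fderiv
    have h3 := congrArg (fun L : ℝ × Eu m →L[ℝ] ℝ ↦ L (1, 0)) h2
    simp only [_root_.smul_apply, smul_eq_mul] at h3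
    rw [div_eq_inv_mul, ← h3]
    rfl
  have hBt := transpose_localTensor (m := m) (n := n) x₀ q₀ U p
  have hHt : (localTargetMetric m n x₀ q₀ U p)ᵀ = localTargetMetric m n x₀ q₀ U p :=
    transpose_metricMatrix _ _
  rw [hD, matrixDeriv_mul hB hA, hB', localFlux, transpose_mul, hBt]
  -- By cyclicity of the trace, the derivative of each of the three factors A contributes the same.
  -- The factor 3 against the 1/6 of the density leaves 1/2.
  have e1 : ∀ X A A' : Matrix (Fin m) (Fin m) ℝ,
      ((X * A' * X * A * X + X * A * X * A' * X) * A + X * A * X * A * X * A').trace =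
      3 * ((X * A * X * A * X) * A').trace := by
    intro X A A'
    rw [Matrix.add_mul, trace_add, trace_add]
    have c1 : (X * A' * X * A * X * A).trace = (X * A * X * A * X * A').trace := by
      simpa only [Matrix.mul_assoc] using trace_mul_comm (X * A') (X * A * X * A)
    have c2 : (X * A * X * A' * X * A).trace = (X * A * X * A * X * A').trace := by
      simpa only [Matrix.mul_assoc] using trace_mul_comm (X * A * X * A') (X * A)
    rw [c1, c2]
    ring
  rw [localTensor, e1, ← localTensor, hA']
  generalize localTensor m n x₀ q₀ U p = B at *
  generalize localTargetMetric m n x₀ q₀ U p = H at *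
  generalize jac (localMap m n x₀ q₀ U) p = J at *
  generalize matrixDeriv (jac (localMap m n x₀ q₀ U)) p (1, 0) = J' at *
  generalize matrixDeriv (localTargetMetric m n x₀ q₀ U) p (1, 0) = H' at *
  -- Transposition identifies the contributions of J'ᵀ and J', since B and H are symmetric; together
  -- they cancel the factor 1/2 in front of the J' term, while the H' term keeps it.
  have e2 : (B * (J'ᵀ * H * J)).trace = (B * (Jᵀ * H * J')).trace := by
    rw [← trace_transpose, transpose_mul, transpose_mul, transpose_mul, transpose_transpose,
      hBt, hHt, trace_mul_comm, Matrix.mul_assoc Jᵀ]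
  rw [Matrix.add_mul, Matrix.mul_add, Matrix.mul_add, trace_add, trace_add, e2]
  simp only [Matrix.mul_assoc]
  ring

end Metric

end LocalVariation

/-! ### Invariance of the coordinate divergence under changes of charts -/

section ChartChange

open Matrix

/-- The matrix of the derivative of a map between Euclidean spaces. -/
def jacobian {m n : ℕ} (T : Eu m → Eu n) (y : Eu m) : Matrix (Fin n) (Fin m) ℝ :=
  of fun k i ↦ fderiv ℝ T y (EuclideanSpace.single i (1 : ℝ)) k

theorem det_jacobian {m : ℕ} (T : Eu m → Eu m) (y : Eu m) :
    (jacobian T y).det = (fderiv ℝ T y).det := by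
  have h : jacobian T y = LinearMap.toMatrix (EuclideanSpace.basisFun (Fin m) ℝ).toBasis
      (EuclideanSpace.basisFun (Fin m) ℝ).toBasis (fderiv ℝ T y : Eu m →ₗ[ℝ] Eu m) := by
    ext k i
    simp [jacobian, LinearMap.toMatrix_apply]
  rw [h, LinearMap.det_toMatrix]

theorem fderiv_comp_single {m n : ℕ} {T : Eu m → Eu n} {f : Eu n → ℝ} {y : Eu m}
    (hf : DifferentiableAt ℝ f (T y)) (hT : DifferentiableAt ℝ T y) (j : Fin m) :
    fderiv ℝ (fun z ↦ f (T z)) y (EuclideanSpace.single j (1 : ℝ)) =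
      ∑ l, fderiv ℝ f (T y) (EuclideanSpace.single l (1 : ℝ)) * jacobian T y l j := by
  have h2 := (hf.hasFDerivAt.comp y hT.hasFDerivAt).fderiv
  refine (congrArg (fun L : Eu m →L[ℝ] ℝ ↦ L (EuclideanSpace.single j (1 : ℝ))) h2).trans ?_
  rw [ContinuousLinearMap.comp_apply]
  simp only [jacobian, of_apply]
  set ξ := fderiv ℝ T y (EuclideanSpace.single j (1 : ℝ))
  conv_lhs => rw [← (EuclideanSpace.basisFun (Fin n) ℝ).sum_repr ξ]
  simp [mul_comm]

theorem diffMatrixAt_jacobian {m n : ℕ} {T : Eu m → Eu n} {y : Eu m} (hT : ContDiffAt ℝ 2 T y) :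
    DiffMatrixAt (jacobian T) y := fun k i ↦ by
  have h : ContDiffAt ℝ 1 (fderiv ℝ T) y := hT.fderiv_right (by norm_num)
  have h' := (h.clm_apply (contDiffAt_const (c := EuclideanSpace.single i (1 : ℝ)))).differentiableAt
    (by simp)
  exact differentiableAt_euclidean.1 h' k

/-- Symmetry of the second derivative of a C² map, in terms of the entries of its Jacobian. -/
theorem matrixDeriv_jacobian_comm {m n : ℕ} {T : Eu m → Eu n} {y : Eu m}
    (hT : ContDiffAt ℝ 2 T y) (i j : Fin m) (k : Fin n) :
    matrixDeriv (jacobian T) y (EuclideanSpace.single i (1 : ℝ)) k j =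
      matrixDeriv (jacobian T) y (EuclideanSpace.single j (1 : ℝ)) k i := by
  have h : ContDiffAt ℝ 1 (fderiv ℝ T) y := hT.fderiv_right (by norm_num)
  have hd : DifferentiableAt ℝ (fderiv ℝ T) y := h.differentiableAt (by simp)
  have key : ∀ a b : Eu m, fderiv ℝ (fun z ↦ fderiv ℝ T z b k) y a =
      fderiv ℝ (fderiv ℝ T) y a b k := by
    intro a b
    have h1 := (hd.hasFDerivAt.clm_apply (hasFDerivAt_const b y))
    have h2 := ((EuclideanSpace.proj (𝕜 := ℝ) k).hasFDerivAt.comp y h1).fderiv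
    have h3 := congrArg (fun L : Eu m →L[ℝ] ℝ ↦ L a) h2
    refine Eq.trans ?_ (h3.trans ?_)
    · rfl
    · simp
  simp only [matrixDeriv, jacobian, of_apply, key]
  rw [(hT.isSymmSndFDerivAt (by simp)).eq]

theorem trace_inv_mul_sum {m : ℕ} (D : Matrix (Fin m) (Fin m) ℝ) (X : Fin m → ℝ)
    (C : Fin m → Matrix (Fin m) (Fin m) ℝ) :
    ∑ i, X i * (D⁻¹ * C i).trace = (D⁻¹ * ∑ i, X i • C i).trace := by
  rw [Matrix.mul_sum, trace_sum]
  refine Finset.sum_congr rfl fun i _ ↦ ?_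
  rw [Matrix.mul_smul, trace_smul, smul_eq_mul]

/-- The divergence with respect to a density is invariant under changes of coordinates. -/
theorem divergence_comp_eq {m : ℕ} {T : Eu m → Eu m} {y : Eu m} {X₀ X₁ : Fin m → Eu m → ℝ}
    {L₀ L₁ : Eu m → ℝ} (hT : ContDiffAt ℝ 2 T y) (hD : IsUnit (jacobian T y).det)
    (hX₀ : ∀ i, DifferentiableAt ℝ (X₀ i) y) (hX₁ : ∀ i, DifferentiableAt ℝ (X₁ i) (T y))
    (hL₁ : DifferentiableAt ℝ L₁ (T y))
    (hX : ∀ᶠ z in 𝓝 y, ∀ k, X₁ k (T z) = ∑ i, jacobian T z k i * X₀ i z)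
    (hL : ∀ᶠ z in 𝓝 y, L₀ z = 2 * Real.log (jacobian T z).det + L₁ (T z)) :
    ∑ i, (fderiv ℝ (X₁ i) (T y) (EuclideanSpace.single i (1 : ℝ)) +
        1 / 2 * (X₁ i (T y) * fderiv ℝ L₁ (T y) (EuclideanSpace.single i (1 : ℝ)))) =
      ∑ i, (fderiv ℝ (X₀ i) y (EuclideanSpace.single i (1 : ℝ)) +
        1 / 2 * (X₀ i y * fderiv ℝ L₀ y (EuclideanSpace.single i (1 : ℝ)))) := by
  have hTd : DifferentiableAt ℝ T y := hT.differentiableAt (by simp)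
  have hJ := diffMatrixAt_jacobian hT
  set D := jacobian T y with hDdef
  set C : Fin m → Matrix (Fin m) (Fin m) ℝ :=
    fun j ↦ matrixDeriv (jacobian T) y (EuclideanSpace.single j (1 : ℝ)) with hC
  set W₀ : Matrix (Fin m) (Fin m) ℝ :=
    of fun i j ↦ fderiv ℝ (X₀ i) y (EuclideanSpace.single j (1 : ℝ)) with hW₀
  set W₁ : Matrix (Fin m) (Fin m) ℝ :=
    of fun i j ↦ fderiv ℝ (X₁ i) (T y) (EuclideanSpace.single j (1 : ℝ)) with hW₁
  -- Differentiating X₁ ∘ T = T' X₀ gives a term with second derivatives of T. By their symmetry it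
  -- is the derivative of T' in the direction X₀.
  have e1 : W₁ * D = (∑ i, X₀ i y • C i) + D * W₀ := by
    ext k j
    have h1 := fderiv_comp_single (hX₁ k) hTd j
    have h2 : (fun z ↦ X₁ k (T z)) =ᶠ[𝓝 y] fun z ↦ ∑ i, jacobian T z k i * X₀ i z :=
      hX.mono fun z hz ↦ hz k
    rw [h2.fderiv_eq, fderiv_fun_sum fun i _ ↦ (hJ k i).fun_mul (hX₀ i), _root_.sum_apply] at h1
    rw [Matrix.mul_apply, Matrix.add_apply, Matrix.sum_apply, Matrix.mul_apply]
    simp only [hW₁, of_apply]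
    rw [← h1, ← Finset.sum_add_distrib]
    refine Finset.sum_congr rfl fun i _ ↦ ?_
    rw [fderiv_fun_mul (hJ k i) (hX₀ i)]
    simp only [_root_.add_apply, _root_.smul_apply, smul_eq_mul, Matrix.smul_apply, hC, hW₀,
      of_apply, ← hDdef]
    rw [matrixDeriv_jacobian_comm hT i j k]
    simp only [matrixDeriv, of_apply]
    ring
  -- Conjugation by D preserves the trace, so the defect of the Euclidean divergence is tr(D⁻¹
  -- ∂_{X₀} T').
  have e2 : W₁.trace = (D⁻¹ * ∑ i, X₀ i y • C i).trace + W₀.trace := by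
    have h1 := congrArg (fun A ↦ (D⁻¹ * A).trace) e1
    simp only [Matrix.mul_add, trace_add] at h1
    rw [← Matrix.mul_assoc D⁻¹ D, nonsing_inv_mul _ hD, Matrix.one_mul, trace_mul_comm,
      Matrix.mul_assoc, mul_nonsing_inv _ hD, Matrix.mul_one] at h1
    exact h1
  -- By Jacobi's formula 2 log det T' contributes 2 tr(D⁻¹ ∂_i T'). The weight 1/2 in the divergence
  -- makes this equal to the defect found in `e2`, and the two cancel at the end.
  have e3 : ∀ i, fderiv ℝ L₀ y (EuclideanSpace.single i (1 : ℝ)) = 2 * (D⁻¹ * C i).trace +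
      ∑ l, fderiv ℝ L₁ (T y) (EuclideanSpace.single l (1 : ℝ)) * D l i := by
    intro i
    have h1 : L₀ =ᶠ[𝓝 y] fun z ↦ 2 * Real.log (jacobian T z).det + L₁ (T z) := hL
    have hlog : DifferentiableAt ℝ (fun z ↦ Real.log (jacobian T z).det) y :=
      hJ.det.log hD.ne_zero
    have hLT : DifferentiableAt ℝ (fun z ↦ L₁ (T z)) y := hL₁.comp y hTd
    rw [h1.fderiv_eq, fderiv_fun_add (hlog.const_mul 2) hLT, _root_.add_apply,
      fderiv_comp_single hL₁ hTd, fderiv_const_mul hlog, _root_.smul_apply,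
      fderiv_log_det hJ hD, smul_eq_mul]
  have e4 : ∑ i, X₀ i y * fderiv ℝ L₀ y (EuclideanSpace.single i (1 : ℝ)) =
      2 * (D⁻¹ * ∑ i, X₀ i y • C i).trace +
        ∑ l, X₁ l (T y) * fderiv ℝ L₁ (T y) (EuclideanSpace.single l (1 : ℝ)) := by
    simp only [e3, hX.self_of_nhds, ← hDdef]
    rw [← trace_inv_mul_sum]
    simp only [mul_add, Finset.sum_add_distrib, Finset.mul_sum, Finset.sum_mul]
    congr 1
    · exact Finset.sum_congr rfl fun i _ ↦ by ring
    · rw [Finset.sum_comm]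
      exact Finset.sum_congr rfl fun i _ ↦ Finset.sum_congr rfl fun j _ ↦ by ring
  rw [Finset.sum_add_distrib, Finset.sum_add_distrib, ← Finset.mul_sum, ← Finset.mul_sum, e4]
  change W₁.trace + _ = W₀.trace + _
  rw [e2]
  ring

end ChartChange

/-! ### Divergence of a C¹ vector field on M -/

section Divergence

open Matrix

variable {m : ℕ} {M : Type*} [TopologicalSpace M] [ChartedSpace (Eu m) M]
  [IsManifold (𝓡 m) ∞ M]

/-- The `i`-th component of a vector field in the chart at `x₀`. -/
def fieldComp (X : (x : M) → TangentSpace (𝓡 m) x) (x₀ : M) (i : Fin m) (y : Eu m) : ℝ :=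
  coordComp m x₀ i ((extChartAt (𝓡 m) x₀).symm y) (X ((extChartAt (𝓡 m) x₀).symm y))

/-- Vector fields with continuously differentiable components. -/
def IsC1Field (X : (x : M) → TangentSpace (𝓡 m) x) : Prop :=
  ∀ (x₀ : M) (i : Fin m), ContDiffOn ℝ 1 (fieldComp X x₀ i) (extChartAt (𝓡 m) x₀).target

theorem fieldComp_extChartAt (X : (x : M) → TangentSpace (𝓡 m) x) {x₀ x : M}
    (hx : x ∈ (extChartAt (𝓡 m) x₀).source) (i : Fin m) :
    fieldComp X x₀ i (extChartAt (𝓡 m) x₀ x) = coordComp m x₀ i x (X x) :=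
  congrArg (fun z ↦ coordComp m x₀ i z (X z)) ((extChartAt (𝓡 m) x₀).left_inv hx)

theorem fieldComp_smul (f : M → ℝ) (X : (x : M) → TangentSpace (𝓡 m) x) {x₀ : M} {y : Eu m}
    (hy : y ∈ (extChartAt (𝓡 m) x₀).target) (i : Fin m) :
    fieldComp (fun x ↦ f x • X x) x₀ i y =
      f ((extChartAt (𝓡 m) x₀).symm y) * fieldComp X x₀ i y :=
  coordComp_smul ((extChartAt (𝓡 m) x₀).map_target hy) i _ _

theorem IsC1Field.smul {X : (x : M) → TangentSpace (𝓡 m) x} (hX : IsC1Field X) {f : M → ℝ}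
    (hf : ContMDiff (𝓡 m) 𝓘(ℝ, ℝ) ∞ f) : IsC1Field (fun x ↦ f x • X x) := fun x₀ i ↦ by
  have h : ContDiffOn ℝ 1 (fun y ↦ f ((extChartAt (𝓡 m) x₀).symm y))
      (extChartAt (𝓡 m) x₀).target := by
    rw [← contMDiffOn_iff_contDiffOn]
    exact ((hf.comp_contMDiffOn (contMDiffOn_extChartAt_symm x₀)).of_le (by simp))
  exact (h.mul (hX x₀ i)).congr fun y hy ↦ fieldComp_smul f X hy i

theorem extChartAt_target_mem_nhds_of_mem {x₀ : M} {y : Eu m}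
    (hy : y ∈ (extChartAt (𝓡 m) x₀).target) : (extChartAt (𝓡 m) x₀).target ∈ 𝓝 y :=
  (isOpen_extChartAt_target x₀).mem_nhds hy

theorem IsC1Field.differentiableAt {X : (x : M) → TangentSpace (𝓡 m) x} (hX : IsC1Field X)
    {x₀ : M} (i : Fin m) {y : Eu m} (hy : y ∈ (extChartAt (𝓡 m) x₀).target) :
    DifferentiableAt ℝ (fieldComp X x₀ i) y :=
  ((hX x₀ i).contDiffAt (extChartAt_target_mem_nhds_of_mem hy)).differentiableAt (by simp)

/-- The transition map between the charts at `x₀` and `x₁`. -/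
def transition (m : ℕ) {M : Type*} [TopologicalSpace M] [ChartedSpace (Eu m) M] (x₀ x₁ : M)
    (y : Eu m) : Eu m :=
  extChartAt (𝓡 m) x₁ ((extChartAt (𝓡 m) x₀).symm y)

/-- The domain of `transition`. -/
def transitionDom (m : ℕ) {M : Type*} [TopologicalSpace M] [ChartedSpace (Eu m) M] (x₀ x₁ : M) :
    Set (Eu m) :=
  (extChartAt (𝓡 m) x₀).target ∩ (extChartAt (𝓡 m) x₀).symm ⁻¹' (extChartAt (𝓡 m) x₁).source

theorem isOpen_transitionDom (x₀ x₁ : M) : IsOpen (transitionDom m x₀ x₁) :=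
  (continuousOn_extChartAt_symm x₀).isOpen_inter_preimage (isOpen_extChartAt_target x₀)
    (isOpen_extChartAt_source x₁)

theorem contDiffOn_transition (x₀ x₁ : M) :
    ContDiffOn ℝ ∞ (transition m x₀ x₁) (transitionDom m x₀ x₁) := by
  rw [← contMDiffOn_iff_contDiffOn]
  refine (contMDiffOn_extChartAt (x := x₁)).comp
    ((contMDiffOn_extChartAt_symm x₀).mono inter_subset_left) fun p hp ↦ ?_
  simpa using hp.2

theorem contDiffAt_transition {x₀ x₁ : M} {y : Eu m} (hy : y ∈ transitionDom m x₀ x₁) :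
    ContDiffAt ℝ ∞ (transition m x₀ x₁) y :=
  (contDiffOn_transition x₀ x₁).contDiffAt ((isOpen_transitionDom x₀ x₁).mem_nhds hy)

/-- The transition map is the identity of M read in two charts, so its Jacobian is the matrix that
changes one coordinate frame into the other. -/
theorem coordComp_coordVec_eq_jacobian {x₀ x₁ : M} {y : Eu m} (hy : y ∈ transitionDom m x₀ x₁)
    (k i : Fin m) :
    coordComp m x₁ k ((extChartAt (𝓡 m) x₀).symm y)
        (coordVec m x₀ i ((extChartAt (𝓡 m) x₀).symm y)) =
      jacobian (transition m x₀ x₁) y k i := by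
  have hs := (extChartAt (𝓡 m) x₀).map_target hy.1
  have h := coordComp_differential_coordVec (u := fun x : M ↦ x) (q₀ := x₁)
    mdifferentiableAt_id hs hy.2 k i
  rw [(extChartAt (𝓡 m) x₀).right_inv hy.1] at h
  refine Eq.trans ?_ h
  have : differential m m (fun x : M ↦ x) ((extChartAt (𝓡 m) x₀).symm y) =
      ContinuousLinearMap.id ℝ _ := mfderiv_id
  rw [this]
  rfl

theorem fieldComp_transition (X : (x : M) → TangentSpace (𝓡 m) x) {x₀ x₁ : M} {y : Eu m}
    (hy : y ∈ transitionDom m x₀ x₁) (k : Fin m) :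
    fieldComp X x₁ k (transition m x₀ x₁ y) =
      ∑ i, jacobian (transition m x₀ x₁) y k i * fieldComp X x₀ i y := by
  have hs := (extChartAt (𝓡 m) x₀).map_target hy.1
  rw [transition, fieldComp_extChartAt X hy.2]
  conv_lhs => rw [← sum_coordComp_smul_coordVec hs (X ((extChartAt (𝓡 m) x₀).symm y))]
  rw [coordComp_sum _ hy.2]
  refine Finset.sum_congr rfl fun i _ ↦ ?_
  rw [coordComp_smul hy.2, coordComp_coordVec_eq_jacobian hy, mul_comm]
  rfl

/-- The change of frames in the opposite direction is a left inverse. -/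
theorem isUnit_det_jacobian_transition {x₀ x₁ : M} {y : Eu m} (hy : y ∈ transitionDom m x₀ x₁) :
    IsUnit (jacobian (transition m x₀ x₁) y).det := by
  have hs := (extChartAt (𝓡 m) x₀).map_target hy.1
  refine isUnit_det_of_left_inverse (B := of fun i k ↦
    coordComp m x₀ i ((extChartAt (𝓡 m) x₀).symm y)
        (coordVec m x₁ k ((extChartAt (𝓡 m) x₀).symm y))) ?_
  ext i j
  rw [Matrix.mul_apply, Matrix.one_apply, ← coordComp_coordVec hs i j]
  conv_rhs => rw [← sum_coordComp_smul_coordVec hy.2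
    (coordVec m x₀ j ((extChartAt (𝓡 m) x₀).symm y))]
  rw [coordComp_sum _ hs]
  refine Finset.sum_congr rfl fun k _ ↦ ?_
  rw [coordComp_smul hs, coordComp_coordVec_eq_jacobian hy, mul_comm]
  rfl

variable [RiemannianBundle (fun x : M ↦ TangentSpace (𝓡 m) x)]

theorem metricMatrix_transition {x₀ x₁ : M} {y : Eu m} (hy : y ∈ transitionDom m x₀ x₁) :
    metricMatrix m x₀ y = (jacobian (transition m x₀ x₁) y)ᵀ *
      metricMatrix m x₁ (transition m x₀ x₁ y) * jacobian (transition m x₀ x₁) y := by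
  ext i j
  have h : metricMatrix m x₀ y i j = inner ℝ (coordVec m x₀ i ((extChartAt (𝓡 m) x₀).symm y))
    (coordVec m x₀ j ((extChartAt (𝓡 m) x₀).symm y)) := rfl
  have hc : ∀ i, coordTuple m x₁ ((extChartAt (𝓡 m) x₀).symm y)
      (coordVec m x₀ i ((extChartAt (𝓡 m) x₀).symm y)) =
      (jacobian (transition m x₀ x₁) y).col i :=
    fun i ↦ funext fun k ↦ coordComp_coordVec_eq_jacobian hy k i
  rw [h, inner_eq_dotProduct_metricMatrix hy.2, hc, hc, Matrix.mul_assoc]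
  rfl

theorem det_metricMatrix_transition {x₀ x₁ : M} {y : Eu m} (hy : y ∈ transitionDom m x₀ x₁) :
    (metricMatrix m x₀ y).det = (jacobian (transition m x₀ x₁) y).det ^ 2 *
      (metricMatrix m x₁ (transition m x₀ x₁ y)).det := by
  rw [metricMatrix_transition hy, det_mul, det_mul, det_transpose]
  ring

/-- The divergence of a vector field, computed in the chart at `x₀`. -/
def chartDiv (X : (x : M) → TangentSpace (𝓡 m) x) (x₀ : M) (y : Eu m) : ℝ :=
  ∑ i, (fderiv ℝ (fieldComp X x₀ i) y (EuclideanSpace.single i (1 : ℝ)) +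
    1 / 2 * (fieldComp X x₀ i y * fderiv ℝ (fun z ↦ Real.log (metricMatrix m x₀ z).det) y
      (EuclideanSpace.single i (1 : ℝ))))

/-- The divergence of a vector field. -/
def fieldDiv (X : (x : M) → TangentSpace (𝓡 m) x) (x : M) : ℝ :=
  chartDiv X x (extChartAt (𝓡 m) x x)

variable [IsContMDiffRiemannianBundle (𝓡 m) ∞ (Eu m) (fun x : M ↦ TangentSpace (𝓡 m) x)]

theorem contDiffOn_log_det_metricMatrix (x₀ : M) :
    ContDiffOn ℝ ∞ (fun z ↦ Real.log (metricMatrix m x₀ z).det) (extChartAt (𝓡 m) x₀).target :=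
  (smoothMatrixOn_metricMatrix x₀).det.log fun _ hy ↦ (posDef_metricMatrix hy).det_pos.ne'

theorem chartDiv_transition {X : (x : M) → TangentSpace (𝓡 m) x} (hX : IsC1Field X)
    {x₀ x₁ : M} {y : Eu m} (hy : y ∈ transitionDom m x₀ x₁) :
    chartDiv X x₁ (transition m x₀ x₁ y) = chartDiv X x₀ y := by
  have hy1 : transition m x₀ x₁ y ∈ (extChartAt (𝓡 m) x₁).target :=
    (extChartAt (𝓡 m) x₁).map_source hy.2
  have hn := (isOpen_transitionDom x₀ x₁).mem_nhds hy
  refine divergence_comp_eq ((contDiffAt_transition hy).of_le (by norm_cast))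
    (isUnit_det_jacobian_transition hy) (fun i ↦ hX.differentiableAt i hy.1)
    (fun i ↦ hX.differentiableAt i hy1)
    (((contDiffOn_log_det_metricMatrix x₁).contDiffAt
      (extChartAt_target_mem_nhds_of_mem hy1)).differentiableAt (by simp))
    (Filter.eventually_of_mem hn fun z hz k ↦ fieldComp_transition X hz k)
    (Filter.eventually_of_mem hn fun z hz ↦ ?_)
  have hz1 : transition m x₀ x₁ z ∈ (extChartAt (𝓡 m) x₁).target :=
    (extChartAt (𝓡 m) x₁).map_source hz.2
  -- The determinant of the transition map may be negative. `Real.log` is the logarithm of the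
  -- absolute value, so log(d²) = 2 log d holds for either sign and no orientation is needed.
  rw [det_metricMatrix_transition hz, Real.log_mul
    (pow_ne_zero _ (isUnit_det_jacobian_transition hz).ne_zero)
    (posDef_metricMatrix hz1).det_pos.ne', Real.log_pow]
  norm_cast

/-- `fieldDiv` uses at every point the chart centred there, and this chart changes from point to
point. Invariance allows one fixed chart near a point, whence continuity and the integral formulas.
-/
theorem fieldDiv_eq_chartDiv {X : (x : M) → TangentSpace (𝓡 m) x} (hX : IsC1Field X) {x₀ x : M}
    (hx : x ∈ (extChartAt (𝓡 m) x₀).source) :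
    fieldDiv X x = chartDiv X x₀ (extChartAt (𝓡 m) x₀ x) := by
  have hs := mem_extChartAt_source (I := 𝓡 m) x
  have h : extChartAt (𝓡 m) x₀ x = transition m x x₀ (extChartAt (𝓡 m) x x) := by
    rw [transition, (extChartAt (𝓡 m) x).left_inv hs]
  rw [h, chartDiv_transition hX, fieldDiv]
  refine ⟨(extChartAt (𝓡 m) x).map_source hs, ?_⟩
  simpa only [mem_preimage, (extChartAt (𝓡 m) x).left_inv hs] using hx

theorem IsC1Field.continuousOn_chartDiv {X : (x : M) → TangentSpace (𝓡 m) x}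
    (hX : IsC1Field X) (x₀ : M) : ContinuousOn (chartDiv X x₀) (extChartAt (𝓡 m) x₀).target := by
  have ho := isOpen_extChartAt_target (I := 𝓡 m) x₀
  refine continuousOn_finsetSum _ fun i _ ↦ ContinuousOn.add ?_ (continuousOn_const.mul
    ((hX x₀ i).continuousOn.mul ?_))
  · exact ((hX x₀ i).continuousOn_fderiv_of_isOpen ho le_rfl).clm_apply continuousOn_const
  · exact ((contDiffOn_log_det_metricMatrix x₀).continuousOn_fderiv_of_isOpen ho
      (by simp)).clm_apply continuousOn_const

theorem IsC1Field.continuous_fieldDiv {X : (x : M) → TangentSpace (𝓡 m) x}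
    (hX : IsC1Field X) : Continuous (fieldDiv X) := by
  refine continuous_iff_continuousAt.2 fun x₀ ↦ ?_
  have hs := extChartAt_source_mem_nhds (I := 𝓡 m) x₀
  have h1 : ContinuousAt (fun x ↦ chartDiv X x₀ (extChartAt (𝓡 m) x₀ x)) x₀ :=
    ContinuousAt.comp (f := extChartAt (𝓡 m) x₀) ((hX.continuousOn_chartDiv x₀).continuousAt
      (extChartAt_target_mem_nhds x₀)) (continuousAt_extChartAt x₀)
  exact h1.congr (Filter.eventually_of_mem hs fun x hx ↦ (fieldDiv_eq_chartDiv hX hx).symm)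

end Divergence

/-! ### The algebraic identity of the first variation -/

section TensorAlgebra

open Matrix

theorem sum_sum_mul_antisymm {ι : Type*} [Fintype ι] {s : ι → ι → ℝ} (hs : ∀ i j, s i j = s j i)
    {a : ι → ι → ℝ} (ha : ∀ i j, a i j = -a j i) : ∑ i, ∑ j, a i j * s i j = 0 := by
  have h : ∑ i, ∑ j, a i j * s i j = -∑ i, ∑ j, a i j * s i j := by
    conv_lhs => rw [Finset.sum_comm]
    simp only [← Finset.sum_neg_distrib]
    refine Finset.sum_congr rfl fun i _ ↦ Finset.sum_congr rfl fun j _ ↦ ?_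
    rw [ha j i, hs j i]
    ring
  linarith

/-- The trace of the first Christoffel symbols contracted with a vector. -/
theorem sum_christoffel_trace {m : ℕ} {ginv : Matrix (Fin m) (Fin m) ℝ}
    {dg : Fin m → Matrix (Fin m) (Fin m) ℝ} (hginv : ∀ i j, ginv i j = ginv j i)
    (hdg : ∀ l i j, dg l i j = dg l j i) (q : Fin m → ℝ) :
    ∑ i, ∑ j, (∑ p, q p * dg i p j) * ginv j i -
      ∑ i, ∑ j, (∑ p, q p * (1 / 2 * (dg i j p + dg j i p - dg p i j))) * ginv j i =
      ∑ p, 1 / 2 * (q p * (ginv * dg p).trace) := by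
  -- The two sides differ by a term antisymmetric in i and j, which the symmetric inverse metric
  -- annihilates.
  have h1 : ∑ i, ∑ j, (∑ p, q p * (1 / 2 * (dg i j p - dg j i p))) * ginv i j = 0 := by
    refine sum_sum_mul_antisymm hginv fun i j ↦ ?_
    rw [← Finset.sum_neg_distrib]
    exact Finset.sum_congr rfl fun p _ ↦ by ring
  have h2 : ∑ p, 1 / 2 * (q p * (ginv * dg p).trace) =
      ∑ i, ∑ j, (∑ p, q p * (1 / 2 * dg p i j)) * ginv i j := by
    simp only [Matrix.trace, diag_apply, Matrix.mul_apply, Finset.mul_sum, Finset.sum_mul]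
    rw [Finset.sum_comm]
    refine Finset.sum_congr rfl fun i _ ↦ ?_
    rw [Finset.sum_comm]
    refine Finset.sum_congr rfl fun j _ ↦ Finset.sum_congr rfl fun p _ ↦ ?_
    rw [hdg p j i]
    ring
  rw [h2, ← sub_eq_zero, ← h1]
  simp only [← Finset.sum_sub_distrib]
  refine Finset.sum_congr rfl fun i _ ↦ Finset.sum_congr rfl fun j _ ↦ ?_
  simp only [Finset.sum_mul, ← Finset.sum_sub_distrib]
  refine Finset.sum_congr rfl fun p _ ↦ ?_
  rw [hginv j i, hdg i p j]
  ring

/-- Against a symmetric N the first two terms of the Christoffel symbol of the first kind contribute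
equally: their difference is antisymmetric. -/
theorem sum_christoffel_target {n : ℕ} {dH : Fin n → Matrix (Fin n) (Fin n) ℝ}
    (N : Matrix (Fin n) (Fin n) ℝ) (hN : ∀ i j, N i j = N j i) (v : Fin n → ℝ) :
    ∑ β, ∑ γ, (∑ δ, v δ * (1 / 2 * (dH β γ δ + dH γ β δ - dH δ β γ))) * N β γ =
      ∑ β, ∑ γ, (∑ δ, v δ * dH β γ δ) * N β γ -
        1 / 2 * ∑ β, ∑ γ, (∑ δ, v δ * dH δ β γ) * N β γ := by
  have h1 : ∑ β, ∑ γ, (∑ δ, v δ * (1 / 2 * (dH γ β δ - dH β γ δ))) * N β γ = 0 := by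
    refine sum_sum_mul_antisymm hN fun i j ↦ ?_
    rw [← Finset.sum_neg_distrib]
    exact Finset.sum_congr rfl fun p _ ↦ by ring
  rw [← sub_eq_zero, ← h1, Finset.mul_sum]
  simp only [Finset.mul_sum, ← Finset.sum_sub_distrib]
  refine Finset.sum_congr rfl fun i _ ↦ Finset.sum_congr rfl fun j _ ↦ ?_
  simp only [Finset.sum_mul, Finset.mul_sum, ← Finset.sum_sub_distrib]
  exact Finset.sum_congr rfl fun p _ ↦ by ring

/-- The algebraic identity behind the first variation formula: the divergence of the vector field
`Qᵀ H v` is the sum of the time derivative of the density and of the product of `v` with the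
divergence of the form `Q g`. Here `J` is the Jacobian matrix, `N = Q Jᵀ` is symmetric, and `ΓM`,
`ΓN` are the Christoffel symbols. -/
theorem divergence_algebra {m n : ℕ} {g ginv : Matrix (Fin m) (Fin m) ℝ}
    {dg : Fin m → Matrix (Fin m) (Fin m) ℝ} {H : Matrix (Fin n) (Fin n) ℝ}
    {dH : Fin n → Matrix (Fin n) (Fin n) ℝ} {Q J J' : Matrix (Fin n) (Fin m) ℝ}
    {dQ : Fin m → Matrix (Fin n) (Fin m) ℝ} {v : Fin n → ℝ}
    {ΓM : Fin m → Fin m → Fin m → ℝ} {ΓN : Fin n → Fin n → Fin n → ℝ}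
    (hg : g * ginv = 1) (hginv : ∀ i j, ginv i j = ginv j i)
    (hdg : ∀ l i j, dg l i j = dg l j i)
    (hH : ∀ i j, H i j = H j i) (hN : ∀ α β, (Q * Jᵀ) α β = (Q * Jᵀ) β α)
    (hΓM : ∀ p i j, ∑ l, g p l * ΓM l i j = 1 / 2 * (dg i j p + dg j i p - dg p i j))
    (hΓN : ∀ p i j, ∑ l, H p l * ΓN l i j = 1 / 2 * (dH i j p + dH j i p - dH p i j)) :
    ∑ i, ((∑ k, dQ i k i * (H *ᵥ v) k) + (∑ α, Q α i * ∑ β, (∑ γ, J γ i * dH γ α β) * v β) +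
        (∑ α, Q α i * ∑ β, H α β * J' β i) +
        1 / 2 * ((∑ k, Q k i * (H *ᵥ v) k) * (ginv * dg i).trace)) =
      (Qᵀ * H * J').trace +
      1 / 2 * (Qᵀ * (of fun α β ↦ ∑ γ, v γ * dH γ α β : Matrix (Fin n) (Fin n) ℝ) * J).trace +
      ((of fun i j ↦ ∑ k, (H *ᵥ v) k * ((dQ i * g + Q * dg i) k j +
        ∑ β, ∑ γ, ΓN k β γ * J β i * (Q * g) γ j - ∑ l, (Q * g) k l * ΓM l i j) :
        Matrix (Fin m) (Fin m) ℝ) * ginv).trace := by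
  set w := H *ᵥ v with hw
  set q : Fin m → ℝ := fun p ↦ ∑ k, w k * Q k p with hq
  -- The lowered form index of Qg is raised again by the trace.
  have hgg : ∀ A : Matrix (Fin m) (Fin m) ℝ, (A * g * ginv).trace = A.trace := fun A ↦ by
    rw [Matrix.mul_assoc, hg, Matrix.mul_one]
  -- the four summands of the last trace
  have hsplit : (of fun i j ↦ ∑ k, w k * ((dQ i * g + Q * dg i) k j +
        ∑ β, ∑ γ, ΓN k β γ * J β i * (Q * g) γ j - ∑ l, (Q * g) k l * ΓM l i j) :
        Matrix (Fin m) (Fin m) ℝ) =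
      (of fun i l ↦ ∑ k, w k * dQ i k l : Matrix (Fin m) (Fin m) ℝ) * g +
      (of fun i j ↦ ∑ p, q p * dg i p j) +
      (of fun i l ↦ ∑ k, w k * ∑ β, ∑ γ, ΓN k β γ * J β i * Q γ l :
        Matrix (Fin m) (Fin m) ℝ) * g -
      (of fun i j ↦ ∑ p, q p * (1 / 2 * (dg i j p + dg j i p - dg p i j))) := by
    have b1 : ∀ i j, ((of fun i l ↦ ∑ k, w k * dQ i k l : Matrix (Fin m) (Fin m) ℝ) * g) i j =
        ∑ k, w k * (dQ i * g) k j := fun i j ↦ by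
      simp only [Matrix.mul_apply, of_apply, Finset.mul_sum, Finset.sum_mul]
      rw [Finset.sum_comm]
      exact Finset.sum_congr rfl fun _ _ ↦ Finset.sum_congr rfl fun _ _ ↦ by ring
    have b2 : ∀ i j, ∑ p, q p * dg i p j = ∑ k, w k * (Q * dg i) k j := fun i j ↦ by
      simp only [Matrix.mul_apply, hq, Finset.mul_sum, Finset.sum_mul]
      rw [Finset.sum_comm]
      exact Finset.sum_congr rfl fun _ _ ↦ Finset.sum_congr rfl fun _ _ ↦ by ring
    have b3 : ∀ i j, ((of fun i l ↦ ∑ k, w k * ∑ β, ∑ γ, ΓN k β γ * J β i * Q γ l :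
        Matrix (Fin m) (Fin m) ℝ) * g) i j =
        ∑ k, w k * ∑ β, ∑ γ, ΓN k β γ * J β i * (Q * g) γ j := fun i j ↦ by
      simp only [Matrix.mul_apply, of_apply, Finset.mul_sum, Finset.sum_mul]
      rw [Finset.sum_comm]
      refine Finset.sum_congr rfl fun k _ ↦ ?_
      rw [Finset.sum_comm]
      refine Finset.sum_congr rfl fun β _ ↦ ?_
      rw [Finset.sum_comm]
      exact Finset.sum_congr rfl fun _ _ ↦ Finset.sum_congr rfl fun _ _ ↦ by ring
    have b4 : ∀ i j, ∑ p, q p * (1 / 2 * (dg i j p + dg j i p - dg p i j)) =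
        ∑ k, w k * ∑ l, (Q * g) k l * ΓM l i j := fun i j ↦ by
      simp only [← hΓM, hq, Matrix.mul_apply, Finset.mul_sum, Finset.sum_mul]
      rw [Finset.sum_comm]
      conv_lhs => enter [2, l]; rw [Finset.sum_comm]
      rw [Finset.sum_comm]
      refine Finset.sum_congr rfl fun k _ ↦ ?_
      exact Finset.sum_congr rfl fun _ _ ↦ Finset.sum_congr rfl fun _ _ ↦ by ring
    ext i j
    rw [Matrix.sub_apply, Matrix.add_apply, Matrix.add_apply, b1, b3]
    simp only [of_apply]
    rw [b2, b4]
    simp only [Matrix.add_apply, mul_sub, mul_add, Finset.sum_sub_distrib, Finset.sum_add_distrib]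
  have ht1 : ((of fun i l ↦ ∑ k, w k * dQ i k l : Matrix (Fin m) (Fin m) ℝ) * g * ginv).trace =
      ∑ i, ∑ k, dQ i k i * w k := by
    rw [hgg, Matrix.trace]
    refine Finset.sum_congr rfl fun i _ ↦ ?_
    simp only [diag_apply, of_apply, mul_comm]
  -- The derivative of g in Qg and the Christoffel term of M combine to the logarithmic derivative
  -- of det g, which is the volume term of div X.
  have ht24 : ((of fun i j ↦ ∑ p, q p * dg i p j : Matrix (Fin m) (Fin m) ℝ) * ginv).trace -
      ((of fun i j ↦ ∑ p, q p * (1 / 2 * (dg i j p + dg j i p - dg p i j)) :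
        Matrix (Fin m) (Fin m) ℝ) * ginv).trace = ∑ p, 1 / 2 * (q p * (ginv * dg p).trace) :=
    sum_christoffel_trace hginv hdg q
  -- Pairing with w = Hv lowers the upper index of the target symbols, which leaves derivatives of H
  -- contracted with v.
  have hwΓ : ∀ β γ, ∑ k, w k * ΓN k β γ =
      ∑ δ, v δ * (1 / 2 * (dH β γ δ + dH γ β δ - dH δ β γ)) := by
    intro β γ
    simp only [hw, mulVec, dotProduct, ← hΓN, Finset.sum_mul, Finset.mul_sum]
    rw [Finset.sum_comm]
    refine Finset.sum_congr rfl fun δ _ ↦ Finset.sum_congr rfl fun k _ ↦ ?_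
    rw [hH k δ]
    ring
  -- The target Christoffel term is the derivative of H along u, needed by the product rule for div
  -- X (`h2`), minus half its derivative along v, which cancels the H' part of the time derivative
  -- of the density (`h5`).
  have ht3 : ((of fun i l ↦ ∑ k, w k * ∑ β, ∑ γ, ΓN k β γ * J β i * Q γ l :
        Matrix (Fin m) (Fin m) ℝ) * g * ginv).trace =
      ∑ β, ∑ γ, (∑ δ, v δ * dH β γ δ) * (Q * Jᵀ) β γ -
        1 / 2 * ∑ β, ∑ γ, (∑ δ, v δ * dH δ β γ) * (Q * Jᵀ) β γ := by
    rw [hgg, ← sum_christoffel_target (Q * Jᵀ) hN v]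
    simp only [← hwΓ, Matrix.trace, diag_apply, of_apply]
    have : ∀ β γ, (∑ k, w k * ΓN k β γ) * (Q * Jᵀ) β γ =
        ∑ k, ∑ i, w k * (ΓN k β γ * J β i * Q γ i) := by
      intro β γ
      rw [hN, Matrix.mul_apply, Finset.sum_mul]
      refine Finset.sum_congr rfl fun k _ ↦ ?_
      rw [Finset.mul_sum]
      exact Finset.sum_congr rfl fun i _ ↦ by rw [transpose_apply]; ring
    simp only [this, Finset.mul_sum]
    rw [Finset.sum_comm]
    conv_lhs => enter [2, k]; rw [Finset.sum_comm]
    conv_lhs => enter [2, k, 2, β]; rw [Finset.sum_comm]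
    rw [Finset.sum_comm]
    refine Finset.sum_congr rfl fun β _ ↦ ?_
    rw [Finset.sum_comm]
  have h2 : ∑ i, ∑ α, Q α i * ∑ β, (∑ γ, J γ i * dH γ α β) * v β =
      ∑ β, ∑ γ, (∑ δ, v δ * dH β γ δ) * (Q * Jᵀ) β γ := by
    have : ∀ β γ, (∑ δ, v δ * dH β γ δ) * (Q * Jᵀ) β γ =
        ∑ δ, ∑ i, v δ * dH β γ δ * (Q γ i * J β i) := by
      intro β γ
      rw [hN, Matrix.mul_apply, Finset.sum_mul]
      exact Finset.sum_congr rfl fun δ _ ↦ Finset.mul_sum _ _ _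
    simp only [this, Finset.mul_sum, Finset.sum_mul]
    rw [Finset.sum_comm]
    conv_lhs => enter [2, α]; rw [Finset.sum_comm]
    conv_lhs => enter [2, α, 2, β]; rw [Finset.sum_comm]
    conv_lhs => enter [2, α]; rw [Finset.sum_comm]
    rw [Finset.sum_comm]
    exact Finset.sum_congr rfl fun _ _ ↦ Finset.sum_congr rfl fun _ _ ↦
      Finset.sum_congr rfl fun _ _ ↦ Finset.sum_congr rfl fun _ _ ↦ by ring
  have h3 : ∑ i, ∑ α, Q α i * ∑ β, H α β * J' β i = (Qᵀ * H * J').trace := by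
    rw [Matrix.mul_assoc]
    rfl
  have h5 : (Qᵀ * (of fun α β ↦ ∑ γ, v γ * dH γ α β : Matrix (Fin n) (Fin n) ℝ) * J).trace =
      ∑ β, ∑ γ, (∑ δ, v δ * dH δ β γ) * (Q * Jᵀ) β γ := by
    rw [trace_mul_comm, ← Matrix.mul_assoc, trace_mul_comm, Matrix.trace]
    refine Finset.sum_congr rfl fun β _ ↦ ?_
    rw [diag_apply, Matrix.mul_apply]
    refine Finset.sum_congr rfl fun γ _ ↦ ?_
    simp only [of_apply, Matrix.mul_apply, transpose_apply, mul_comm]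
  rw [hsplit, Matrix.sub_mul, Matrix.add_mul, Matrix.add_mul, trace_sub, trace_add, trace_add,
    ht1, ht3, h5]
  simp only [Finset.sum_add_distrib]
  rw [h2, h3]
  have hq' : ∑ i, 1 / 2 * ((∑ k, Q k i * w k) * (ginv * dg i).trace) =
      ∑ p, 1 / 2 * (q p * (ginv * dg p).trace) := by
    refine Finset.sum_congr rfl fun i _ ↦ ?_
    simp only [hq, mul_comm]
  rw [hq']
  linarith

end TensorAlgebra

/-! ### The variation field, the flux field and the Levi-Civita connection in charts -/

section FirstVariationDensity

open Matrix

variable {m n : ℕ} {M : Type*} [TopologicalSpace M] [ChartedSpace (Eu m) M]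
  [IsManifold (𝓡 m) ∞ M] {N : Type*} [TopologicalSpace N] [ChartedSpace (Eu n) N]
  [IsManifold (𝓡 n) ∞ N]

theorem apply_eq_sum_single {m : ℕ} (L : Eu m →L[ℝ] ℝ) (ξ : Eu m) :
    L ξ = ∑ i, ξ i * L (EuclideanSpace.single i (1 : ℝ)) := by
  conv_lhs => rw [← (EuclideanSpace.basisFun (Fin m) ℝ).sum_repr ξ]
  simp

theorem mulVec_col_dotProduct_col {ι κ μ ν : Type*} [Fintype ι] [Fintype κ]
    (A : Matrix κ ι ℝ) (E : Matrix ι μ ℝ) (W : Matrix κ ν ℝ) (s : μ) (t : ν) :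
    (A *ᵥ E.col s) ⬝ᵥ W.col t = (Eᵀ * (Aᵀ * W)) s t := by
  rw [← Matrix.mul_assoc, ← transpose_mul]
  rfl

/-- The derivative of a function given in the chart at `x₀`. -/
theorem mvfderiv_comp_extChartAt {x₀ x : M} (hx : x ∈ (extChartAt (𝓡 m) x₀).source)
    {F : Eu m → ℝ} (hF : DifferentiableAt ℝ F (extChartAt (𝓡 m) x₀ x))
    (a : TangentSpace (𝓡 m) x) :
    mvfderiv (𝓡 m) (fun z ↦ F (extChartAt (𝓡 m) x₀ z)) x a =
      ∑ i, coordComp m x₀ i x a *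
        fderiv ℝ F (extChartAt (𝓡 m) x₀ x) (EuclideanSpace.single i (1 : ℝ)) := by
  have h1 : HasMFDerivAt (𝓡 m) 𝓘(ℝ, Eu m) (extChartAt (𝓡 m) x₀) x
      (mfderiv (𝓡 m) 𝓘(ℝ, Eu m) (extChartAt (𝓡 m) x₀) x) :=
    (mdifferentiableAt_extChartAt (by simpa using hx)).hasMFDerivAt
  have h2 := (HasMFDerivAt.comp x hF.hasFDerivAt.hasMFDerivAt h1).mfderiv
  have h3 : mvfderiv (𝓡 m) (fun z ↦ F (extChartAt (𝓡 m) x₀ z)) x a =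
      fderiv ℝ F (extChartAt (𝓡 m) x₀ x)
        (show Eu m from mfderiv (𝓡 m) 𝓘(ℝ, Eu m) (extChartAt (𝓡 m) x₀) x a) :=
    congrArg (fun L : TangentSpace (𝓡 m) x →L[ℝ] ℝ ↦ L a) h2
  rw [h3]
  simp only [coordComp_eq_mfderiv hx]
  exact apply_eq_sum_single _ _

theorem mvfderiv_congr {f g : M → ℝ} {x : M} (h : f =ᶠ[𝓝 x] g) (a : TangentSpace (𝓡 m) x) :
    mvfderiv (𝓡 m) f x a = mvfderiv (𝓡 m) g x a := by
  have h1 := h.mfderiv_eq (I := 𝓡 m) (I' := 𝓘(ℝ, ℝ))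
  exact congrArg (fun L : Eu m →L[ℝ] ℝ ↦ L a) h1

/-- `FiberBundle.extend` transports b through the trivialization at x. With constant components,
covariant differentiation of the extension leaves only Christoffel terms. -/
theorem coordTuple_extend {x z : M} (hz : z ∈ (extChartAt (𝓡 m) x).source)
    (b : TangentSpace (𝓡 m) x) :
    coordTuple m x z (FiberBundle.extend (Eu m) b z) = coordTuple m x x b := by
  funext i
  simp only [coordTuple, coordComp, FiberBundle.extend]
  rw [Trivialization.apply_mk_symm _ (mem_baseSet hz)]

variable {u : M → N} {δ : ℝ} {K : Set M} {U : ℝ → M → N} {x₀ : M} {q₀ : N}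

theorem zero_mem_Ioo (hU : IsVariation m n u δ K U) : (0 : ℝ) ∈ Ioo (-δ) δ :=
  ⟨neg_lt_zero.2 hU.pos, hU.pos⟩

variable (m n) in
/-- The components of the velocity of a family of maps, in charts, as a column matrix. -/
def localVel (x₀ : M) (q₀ : N) (U : ℝ → M → N) (p : ℝ × Eu m) : Matrix (Fin n) (Fin 1) ℝ :=
  of fun α _ ↦ fderiv ℝ (localMap m n x₀ q₀ U) p (1, 0) α

theorem IsVariation.coordComp_variationField (hU : IsVariation m n u δ K U) {x : M}
    (hx : x ∈ (extChartAt (𝓡 m) x₀).source) (hq : U 0 x ∈ (extChartAt (𝓡 n) q₀).source)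
    (α : Fin n) :
    coordComp n q₀ α (U 0 x) (variationField n U x) =
      localVel m n x₀ q₀ U (0, extChartAt (𝓡 m) x₀ x) α 0 := by
  have ht := zero_mem_Ioo hU
  rw [coordComp_eq_mfderiv hq, variationField]
  have h1 : MDifferentiableAt 𝓘(ℝ, ℝ) (𝓡 n) (fun t : ℝ ↦ U t x) 0 := by
    have h : ContMDiffOn 𝓘(ℝ, ℝ) (𝓡 n) ∞ (fun t : ℝ ↦ U t x) (Ioo (-δ) δ) :=
      hU.smooth.comp (contMDiffOn_id.prodMk contMDiffOn_const) fun t ht ↦ ⟨ht, mem_univ _⟩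
    exact (h.contMDiffAt (isOpen_Ioo.mem_nhds ht)).mdifferentiableAt (by simp)
  have h2 : HasMFDerivAt (𝓡 n) 𝓘(ℝ, Eu n) (extChartAt (𝓡 n) q₀) (U 0 x)
      (mfderiv (𝓡 n) 𝓘(ℝ, Eu n) (extChartAt (𝓡 n) q₀) (U 0 x)) :=
    (mdifferentiableAt_extChartAt (by simpa using hq)).hasMFDerivAt
  have h3 := (HasMFDerivAt.comp (f := fun t : ℝ ↦ U t x) (0 : ℝ) h2 h1.hasMFDerivAt).mfderiv
  rw [mfderiv_eq_fderiv] at h3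
  have h4 : HasDerivAt (fun t ↦ extChartAt (𝓡 n) q₀ (U t x))
      (fderiv ℝ (localMap m n x₀ q₀ U) (0, extChartAt (𝓡 m) x₀ x) (1, 0)) 0 := by
    refine (hasDerivAt_slice
      (hU.differentiableAt_localMap (mem_localDom ht hx hq))).congr_of_eventuallyEq ?_
    exact Filter.Eventually.of_forall fun t ↦ (localMap_extChartAt q₀ U t hx).symm
  have h5 := congrArg (fun L : ℝ →L[ℝ] Eu n ↦ L 1 α) h3
  refine h5.symm.trans ?_
  have h6 : fderiv ℝ (fun t ↦ extChartAt (𝓡 n) q₀ (U t x)) 0 1 =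
      fderiv ℝ (localMap m n x₀ q₀ U) (0, extChartAt (𝓡 m) x₀ x) (1, 0) := by
    rw [h4.hasFDerivAt.fderiv]
    simp
  exact congrArg (fun ξ : Eu n ↦ ξ α) h6

variable [RiemannianBundle (fun x : M ↦ TangentSpace (𝓡 m) x)]
  [RiemannianBundle (fun y : N ↦ TangentSpace (𝓡 n) y)]

variable (m n) in
/-- The vector field `∑ₛ h(v, d_(3)u(e_s)) e_s` dual to the form `h(v, d_(3)u(·))`. -/
def fluxField (U : ℝ → M → N) (x : M) : TangentSpace (𝓡 m) x :=
  ∑ s, inner ℝ (variationField n U x) (dThree m n (U 0) x (orthoBasis m x s)) • orthoBasis m x s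

variable (m n) in
/-- The components of `fluxField` in charts, as a column matrix. -/
def localFluxField (x₀ : M) (q₀ : N) (U : ℝ → M → N) (p : ℝ × Eu m) : Matrix (Fin m) (Fin 1) ℝ :=
  (localFlux m n x₀ q₀ U p)ᵀ * (localTargetMetric m n x₀ q₀ U p * localVel m n x₀ q₀ U p)

/-- The pairings with the basis form the column Eᵀ g QᵀHv. Reassembling the vector multiplies by E,
and E Eᵀ g = 1 leaves QᵀHv: both the basis and the metric of M disappear. -/
theorem IsVariation.coordComp_fluxField (hU : IsVariation m n u δ K U) {x : M}
    (hx : x ∈ (extChartAt (𝓡 m) x₀).source) (hq : U 0 x ∈ (extChartAt (𝓡 n) q₀).source)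
    (i : Fin m) :
    coordComp m x₀ i x (fluxField m n U x) =
      localFluxField m n x₀ q₀ U (0, extChartAt (𝓡 m) x₀ x) i 0 := by
  have ht := zero_mem_Ioo hU
  set p : ℝ × Eu m := (0, extChartAt (𝓡 m) x₀ x) with hp
  set E := frameMatrix m x₀ x (orthoBasis m x) with hE
  set G := metricMatrix m x₀ (extChartAt (𝓡 m) x₀ x) with hG
  set Q := localFlux m n x₀ q₀ U p with hQ
  set V := localVel m n x₀ q₀ U p with hV
  have hH : metricMatrix n q₀ (extChartAt (𝓡 n) q₀ (U 0 x)) = localTargetMetric m n x₀ q₀ U p := by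
    rw [localTargetMetric, localMap_extChartAt q₀ U 0 hx]
  set H := localTargetMetric m n x₀ q₀ U p
  have hv : coordTuple n q₀ (U 0 x) (variationField n U x) = fun α ↦ V α 0 :=
    funext fun α ↦ hU.coordComp_variationField hx hq α
  have h1 : ∀ s, inner ℝ (variationField n U x) (dThree m n (U 0) x (orthoBasis m x s)) =
      (Eᵀ * (G * (Qᵀ * (H * V)))) s 0 := by
    intro s
    rw [real_inner_comm, inner_eq_dotProduct_metricMatrix hq, hU.coordTuple_dThree ht hx hq, hv,
      hH, ← hQ, ← hG]
    refine (mulVec_col_dotProduct_col (Q * G) E (H * V) s 0).trans ?_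
    rw [transpose_mul, hG, transpose_metricMatrix, Matrix.mul_assoc]
  rw [fluxField, coordComp_sum _ hx]
  simp only [coordComp_smul hx, h1]
  have h2 : localFluxField m n x₀ q₀ U p = E * (Eᵀ * (G * (Qᵀ * (H * V)))) := by
    rw [← Matrix.mul_assoc E, hE, frameMatrix_mul_transpose hx, ← Matrix.mul_assoc _ G,
      nonsing_inv_mul _ (isUnit_det_metricMatrix ((extChartAt (𝓡 m) x₀).map_source hx)),
      Matrix.one_mul]
    rfl
  rw [h2, Matrix.mul_apply]
  exact Finset.sum_congr rfl fun s _ ↦ mul_comm _ _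

/-- Lowering the upper index cancels the inverse metric in the definition. This is the only property
of the Christoffel symbols used in `divergence_algebra`. -/
theorem sum_metricMatrix_mul_christoffel {x₀ : M} {y : Eu m}
    (hy : y ∈ (extChartAt (𝓡 m) x₀).target) (p i j : Fin m) :
    ∑ l, metricMatrix m x₀ y p l * christoffel m x₀ y l i j =
      1 / 2 * (metricDeriv m x₀ y i j p + metricDeriv m x₀ y j i p - metricDeriv m x₀ y p i j) := by
  set c : Fin m → ℝ := fun l ↦
    metricDeriv m x₀ y i j l + metricDeriv m x₀ y j i l - metricDeriv m x₀ y l i j with hc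
  have h1 : ∀ l, christoffel m x₀ y l i j = 1 / 2 * ((metricMatrix m x₀ y)⁻¹ *ᵥ c) l := fun l ↦ rfl
  have h2 : metricMatrix m x₀ y *ᵥ ((metricMatrix m x₀ y)⁻¹ *ᵥ c) = c := by
    rw [mulVec_mulVec, mul_nonsing_inv _ (isUnit_det_metricMatrix hy), one_mulVec]
  have h3 := congrFun h2 p
  simp only [h1]
  rw [← hc] at *
  calc _ = 1 / 2 * (metricMatrix m x₀ y *ᵥ ((metricMatrix m x₀ y)⁻¹ *ᵥ c)) p := by
        simp only [mulVec, dotProduct, Finset.mul_sum]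
        exact Finset.sum_congr rfl fun _ _ ↦ Finset.sum_congr rfl fun _ _ ↦ by ring
    _ = _ := by rw [h3]

theorem metricDeriv_comm (x₀ : M) (y : Eu m) (l i j : Fin m) :
    metricDeriv m x₀ y l i j = metricDeriv m x₀ y l j i := by
  simp only [metricDeriv, metricMatrix_comm x₀ _ i j]

theorem coordComp_leviCivita_extend {x : M} (a b : TangentSpace (𝓡 m) x) (k : Fin m) :
    coordComp m x k x (leviCivita m (FiberBundle.extend (Eu m) b) x a) =
      ∑ i, ∑ j, christoffel m x (extChartAt (𝓡 m) x x) k i j *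
        coordComp m x i x a * coordComp m x j x b := by
  have hs := mem_extChartAt_source (I := 𝓡 m) x
  have hid : differential m m (fun z : M ↦ z) x = ContinuousLinearMap.id ℝ _ := mfderiv_id
  rw [leviCivita, pullbackCov, coordComp_sum _ hs]
  simp only [coordComp_smul hs, coordComp_coordVec hs, mul_ite, mul_one, mul_zero,
    Finset.sum_ite_eq, Finset.mem_univ, if_true]
  have h1 : (fun z : M ↦ coordComp m x k z (FiberBundle.extend (Eu m) b z)) =ᶠ[𝓝 x]
      fun z ↦ (fun _ : Eu m ↦ coordComp m x k x b) (extChartAt (𝓡 m) x z) :=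
    Filter.eventually_of_mem (extChartAt_source_mem_nhds x) fun z hz ↦
      congrFun (coordTuple_extend hz b) k
  rw [mvfderiv_congr h1, mvfderiv_comp_extChartAt hs (differentiableAt_const _), hid,
    FiberBundle.extend_apply_self]
  simp

end FirstVariationDensity

/-! ### The tension field in charts and the divergence of the flux field -/

section TensionInCharts

open Matrix

/-- The covariant derivative of a form is bilinear in the direction a and the argument b. Exhibiting
its matrix makes the sum over an orthonormal basis a trace with g⁻¹. -/
theorem sum_covDeriv_eq_dotProduct {m n : ℕ} (w : Fin n → ℝ) (a b : Fin m → ℝ)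
    (D : Fin m → Matrix (Fin n) (Fin m) ℝ) (J P : Matrix (Fin n) (Fin m) ℝ)
    (ΓM : Fin m → Fin m → Fin m → ℝ) (ΓN : Fin n → Fin n → Fin n → ℝ) :
    ∑ k, w k * ((∑ i, a i * ∑ j, D i k j * b j) +
        (∑ β, ∑ γ, ΓN k β γ * (J *ᵥ a) β * (P *ᵥ b) γ) -
        ∑ l, P k l * ∑ i, ∑ j, ΓM l i j * a i * b j) =
      a ⬝ᵥ ((of fun i j ↦ ∑ k, w k * (D i k j + ∑ β, ∑ γ, ΓN k β γ * J β i * P γ j -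
        ∑ l, P k l * ΓM l i j) : Matrix (Fin m) (Fin m) ℝ) *ᵥ b) := by
  have h : ∀ k, (∑ i, a i * ∑ j, D i k j * b j) +
      (∑ β, ∑ γ, ΓN k β γ * (J *ᵥ a) β * (P *ᵥ b) γ) -
      ∑ l, P k l * ∑ i, ∑ j, ΓM l i j * a i * b j = ∑ i, ∑ j, a i * (D i k j +
        ∑ β, ∑ γ, ΓN k β γ * J β i * P γ j - ∑ l, P k l * ΓM l i j) * b j := by
    intro k
    have h2 : ∑ β, ∑ γ, ΓN k β γ * (J *ᵥ a) β * (P *ᵥ b) γ =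
        ∑ i, ∑ j, a i * (∑ β, ∑ γ, ΓN k β γ * J β i * P γ j) * b j := by
      have h21 : ∀ β γ, ΓN k β γ * (J *ᵥ a) β * (P *ᵥ b) γ =
          ∑ i, ∑ j, a i * (ΓN k β γ * J β i * P γ j) * b j := by
        intro β γ
        simp only [mulVec, dotProduct, Finset.mul_sum, Finset.sum_mul]
        rw [Finset.sum_comm]
        exact Finset.sum_congr rfl fun _ _ ↦ Finset.sum_congr rfl fun _ _ ↦ by ring
      simp only [h21, Finset.mul_sum, Finset.sum_mul]
      conv_lhs => enter [2, β]; rw [Finset.sum_comm]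
      rw [Finset.sum_comm]
      refine Finset.sum_congr rfl fun i _ ↦ ?_
      conv_lhs => enter [2, β]; rw [Finset.sum_comm]
      rw [Finset.sum_comm]
    have h3 : ∑ l, P k l * ∑ i, ∑ j, ΓM l i j * a i * b j =
        ∑ i, ∑ j, a i * (∑ l, P k l * ΓM l i j) * b j := by
      simp only [Finset.mul_sum, Finset.sum_mul]
      rw [Finset.sum_comm]
      refine Finset.sum_congr rfl fun i _ ↦ ?_
      rw [Finset.sum_comm]
      exact Finset.sum_congr rfl fun _ _ ↦ Finset.sum_congr rfl fun _ _ ↦ by ring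
    have h1 : ∑ i, a i * ∑ j, D i k j * b j = ∑ i, ∑ j, a i * D i k j * b j := by
      simp only [Finset.mul_sum, mul_assoc]
    rw [h1, h2, h3]
    simp only [← Finset.sum_add_distrib, ← Finset.sum_sub_distrib]
    exact Finset.sum_congr rfl fun _ _ ↦ Finset.sum_congr rfl fun _ _ ↦ by ring
  simp only [h]
  simp only [dotProduct, mulVec, of_apply, Finset.mul_sum]
  rw [Finset.sum_comm]
  refine Finset.sum_congr rfl fun i _ ↦ ?_
  rw [Finset.sum_comm]
  refine Finset.sum_congr rfl fun j _ ↦ ?_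
  rw [Finset.sum_mul, Finset.mul_sum]
  exact Finset.sum_congr rfl fun _ _ ↦ by ring

variable {m n : ℕ} {M : Type*} [TopologicalSpace M] [ChartedSpace (Eu m) M]
  [IsManifold (𝓡 m) ∞ M] {N : Type*} [TopologicalSpace N] [ChartedSpace (Eu n) N]
  [IsManifold (𝓡 n) ∞ N]

variable {u : M → N} {δ : ℝ} {K : Set M} {U : ℝ → M → N} {x₀ : M} {q₀ : N}

theorem coordComp_sub {x₀ x : M} (hx : x ∈ (extChartAt (𝓡 m) x₀).source) (i : Fin m)
    (a b : TangentSpace (𝓡 m) x) :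
    coordComp m x₀ i x (a - b) = coordComp m x₀ i x a - coordComp m x₀ i x b := by
  simp only [coordComp_eq_continuousLinearMapAt hx, map_sub]
  rfl

theorem matrixDeriv_slice {ι κ : Type*} [Fintype ι] [Fintype κ] {F : ℝ × Eu m → Matrix ι κ ℝ}
    {t : ℝ} {y : Eu m} (hF : DiffMatrixAt F (t, y)) (e : Eu m) :
    matrixDeriv (fun z ↦ F (t, z)) y e = matrixDeriv F (t, y) (0, e) := by
  ext i j
  exact fderiv_slice (hF i j) e

theorem DiffMatrixAt.slice {ι κ : Type*} [Fintype ι] [Fintype κ] {F : ℝ × Eu m → Matrix ι κ ℝ}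
    {t : ℝ} {y : Eu m} (hF : DiffMatrixAt F (t, y)) : DiffMatrixAt (fun z ↦ F (t, z)) y :=
  fun i j ↦ (hF i j).comp y (hasFDerivAt_prodMk_right (𝕜 := ℝ) t y).differentiableAt

theorem IsVariation.smoothMatrixOn_localVel (hU : IsVariation m n u δ K U) (x₀ : M) (q₀ : N) :
    SmoothMatrixOn (localVel m n x₀ q₀ U) (localDom m n x₀ q₀ U δ) :=
  fun α _ ↦ hU.contDiffOn_fderiv_localMap x₀ q₀ _ α

/-- Mixed partial derivatives commute. -/
theorem IsVariation.matrixDeriv_localVel (hU : IsVariation m n u δ K U) {p : ℝ × Eu m}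
    (hp : p ∈ localDom m n x₀ q₀ U δ) (i : Fin m) (α : Fin n) :
    matrixDeriv (localVel m n x₀ q₀ U) p (0, EuclideanSpace.single i (1 : ℝ)) α 0 =
      matrixDeriv (jac (localMap m n x₀ q₀ U)) p (1, 0) α i := by
  have hw : ContDiffAt ℝ ∞ (localMap m n x₀ q₀ U) p :=
    (hU.contDiffOn_localMap x₀ q₀).contDiffAt ((hU.isOpen_localDom x₀ q₀).mem_nhds hp)
  have h : ContDiffAt ℝ 1 (fderiv ℝ (localMap m n x₀ q₀ U)) p :=
    (hw.of_le (m := 2) (by norm_cast)).fderiv_right (by norm_num)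
  have hd := h.differentiableAt (by simp)
  have key : ∀ a b : ℝ × Eu m, fderiv ℝ (fun z ↦ fderiv ℝ (localMap m n x₀ q₀ U) z b α) p a =
      fderiv ℝ (fderiv ℝ (localMap m n x₀ q₀ U)) p a b α := by
    intro a b
    have h1 := (hd.hasFDerivAt.clm_apply (hasFDerivAt_const b p))
    have h2 := ((EuclideanSpace.proj (𝕜 := ℝ) α).hasFDerivAt.comp p h1).fderiv
    have h3 := congrArg (fun L : ℝ × Eu m →L[ℝ] ℝ ↦ L a) h2
    refine Eq.trans ?_ (h3.trans ?_)
    · rfl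
    · simp
  simp only [matrixDeriv, localVel, jac, of_apply, key]
  rw [((hw.of_le (m := 2) (by norm_cast)).isSymmSndFDerivAt (by simp)).eq]

variable [RiemannianBundle (fun x : M ↦ TangentSpace (𝓡 m) x)]
  [RiemannianBundle (fun y : N ↦ TangentSpace (𝓡 n) y)]
  [IsContMDiffRiemannianBundle (𝓡 m) ∞ (Eu m) (fun x : M ↦ TangentSpace (𝓡 m) x)]
  [IsContMDiffRiemannianBundle (𝓡 n) ∞ (Eu n) (fun y : N ↦ TangentSpace (𝓡 n) y)]

theorem IsVariation.smoothMatrixOn_localFluxField (hU : IsVariation m n u δ K U) (x₀ : M)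
    (q₀ : N) : SmoothMatrixOn (localFluxField m n x₀ q₀ U) (localDom m n x₀ q₀ U δ) :=
  (hU.smoothMatrixOn_localFlux x₀ q₀).transpose.mul
    ((hU.smoothMatrixOn_localTargetMetric x₀ q₀).mul (hU.smoothMatrixOn_localVel x₀ q₀))

theorem IsVariation.isOpen_slice (hU : IsVariation m n u δ K U) (x₀ : M) (q₀ : N) (t : ℝ) :
    IsOpen {y : Eu m | (t, y) ∈ localDom m n x₀ q₀ U δ} :=
  (hU.isOpen_localDom x₀ q₀).preimage (by fun_prop)

theorem IsVariation.fieldComp_fluxField (hU : IsVariation m n u δ K U) {y : Eu m}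
    (hy : ((0 : ℝ), y) ∈ localDom m n x₀ q₀ U δ) (i : Fin m) :
    fieldComp (fluxField m n U) x₀ i y = localFluxField m n x₀ q₀ U (0, y) i 0 := by
  have hs := (extChartAt (𝓡 m) x₀).map_target hy.1.2
  have h := hU.coordComp_fluxField hs hy.2 i
  rw [(extChartAt (𝓡 m) x₀).right_inv hy.1.2] at h
  exact h

theorem IsVariation.isC1Field_fluxField (hU : IsVariation m n u δ K U) :
    IsC1Field (fluxField m n U) := by
  intro x₀ i y hy
  -- Regularity is local, so the chart of N may be chosen at the image of the point in question; no
  -- single chart of N need contain the image of the whole chart domain.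
  set q₀ := U 0 ((extChartAt (𝓡 m) x₀).symm y) with hq₀
  have hp : ((0 : ℝ), y) ∈ localDom m n x₀ q₀ U δ :=
    ⟨⟨zero_mem_Ioo hU, hy⟩, mem_extChartAt_source _⟩
  have h1 : ContDiffOn ℝ ∞ (fun z ↦ localFluxField m n x₀ q₀ U (0, z) i 0)
      {z : Eu m | ((0 : ℝ), z) ∈ localDom m n x₀ q₀ U δ} :=
    (hU.smoothMatrixOn_localFluxField x₀ q₀ i 0).comp (contDiff_prodMk_right 0).contDiffOn
      fun _ hz ↦ hz
  have hn := (hU.isOpen_slice x₀ q₀ 0).mem_nhds hp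
  refine ContDiffAt.contDiffWithinAt ?_
  refine ((h1.contDiffAt hn).of_le (by simp)).congr_of_eventuallyEq ?_
  exact Filter.eventually_of_mem hn fun z hz ↦ hU.fieldComp_fluxField hz i

/-- The derivatives `∂ᵢ g` of the metric in the chart at `x₀`, as matrices. -/
def metricDerivMatrix (x₀ : M) (y : Eu m) (i : Fin m) : Matrix (Fin m) (Fin m) ℝ :=
  of fun a b ↦ metricDeriv m x₀ y i a b

/-- On the extension of b with constant components, d_(3)u has the components (Qg)b. The product
rule for Qg gives the derivative terms, and the two connections add the Christoffel terms of N and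
of M. -/
theorem IsVariation.coordComp_covDerivForm (hU : IsVariation m n u δ K U) {x : M}
    (a b : TangentSpace (𝓡 m) x) {p : ℝ × Eu m} (hp : p = (0, extChartAt (𝓡 m) x x))
    (k : Fin n) :
    coordComp n (U 0 x) k (U 0 x) (covDerivForm m n (U 0) (dThree m n (U 0)) x a b) =
      (∑ i, coordTuple m x x a i * ∑ j,
        (matrixDeriv (localFlux m n x (U 0 x) U) p (0, EuclideanSpace.single i (1 : ℝ)) *
            metricMatrix m x p.2 +
          localFlux m n x (U 0 x) U p * metricDerivMatrix x p.2 i) k j *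
        coordTuple m x x b j) +
      (∑ β, ∑ γ, christoffel n (U 0 x) (localMap m n x (U 0 x) U p) k β γ *
        (jac (localMap m n x (U 0 x) U) p *ᵥ coordTuple m x x a) β *
        ((localFlux m n x (U 0 x) U p * metricMatrix m x p.2) *ᵥ coordTuple m x x b) γ) -
      ∑ l, (localFlux m n x (U 0 x) U p * metricMatrix m x p.2) k l *
        ∑ i, ∑ j, christoffel m x p.2 l i j * coordTuple m x x a i * coordTuple m x x b j := by
  have hs := mem_extChartAt_source (I := 𝓡 m) x
  have hqs := mem_extChartAt_source (I := 𝓡 n) (U 0 x)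
  have ht := zero_mem_Ioo hU
  have hpd : p ∈ localDom m n x (U 0 x) U δ := by
    rw [hp]
    exact mem_localDom ht hs hqs
  have hQ := (hU.smoothMatrixOn_localFlux x (U 0 x)).diffMatrixAt
    ((hU.isOpen_localDom x (U 0 x)).mem_nhds hpd)
  have hg : DiffMatrixAt (metricMatrix m x) p.2 :=
    (smoothMatrixOn_metricMatrix x).diffMatrixAt (extChartAt_target_mem_nhds_of_mem hpd.1.2)
  have hmap : localMap m n x (U 0 x) U p = extChartAt (𝓡 n) (U 0 x) (U 0 x) := by
    rw [hp, localMap_extChartAt _ _ _ hs]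
  have hp2 : extChartAt (𝓡 m) x x = p.2 := by rw [hp]
  rw [covDerivForm, coordComp_sub hqs]
  congr 1
  · rw [pullbackCov, coordComp_sum _ hqs]
    simp only [coordComp_smul hqs, coordComp_coordVec hqs, mul_ite, mul_one, mul_zero,
      Finset.sum_ite_eq, Finset.mem_univ, if_true]
    congr 1
    · have hP : DiffMatrixAt (fun y ↦ localFlux m n x (U 0 x) U (0, y) * metricMatrix m x y)
          (extChartAt (𝓡 m) x x) := by
        subst hp
        exact hQ.slice.mul hg
      -- Near x the map stays in the chart of N at its value there, by continuity, so the matrix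
      -- formula for d_(3)u may be differentiated.
      have h1 : (fun z : M ↦ coordComp n (U 0 x) k (U 0 z)
          (dThree m n (U 0) z (FiberBundle.extend (Eu m) b z))) =ᶠ[𝓝 x]
          fun z ↦ (fun y ↦ ((localFlux m n x (U 0 x) U (0, y) * metricMatrix m x y) *ᵥ
            coordTuple m x x b) k) (extChartAt (𝓡 m) x z) := by
        have hc : Tendsto (U 0) (𝓝 x) (𝓝 (U 0 x)) :=
          ((hU.contMDiff ht).continuous).continuousAt
        filter_upwards [extChartAt_source_mem_nhds (I := 𝓡 m) x,
          hc (extChartAt_source_mem_nhds (I := 𝓡 n) (U 0 x))] with z hz hz'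
        have := congrFun (hU.coordTuple_dThree ht hz hz' (FiberBundle.extend (Eu m) b z)) k
        rw [coordTuple_extend hz] at this
        exact this
      have hF : DifferentiableAt ℝ (fun y ↦ ((localFlux m n x (U 0 x) U (0, y) *
          metricMatrix m x y) *ᵥ coordTuple m x x b) k) (extChartAt (𝓡 m) x x) := by
        simp only [mulVec, dotProduct]
        exact DifferentiableAt.fun_sum fun j _ ↦ (hP k j).mul_const _
      rw [mvfderiv_congr h1, mvfderiv_comp_extChartAt hs hF]
      refine Finset.sum_congr rfl fun i _ ↦ ?_
      congr 1
      simp only [mulVec, dotProduct]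
      rw [fderiv_fun_sum fun j _ ↦ (hP k j).mul_const _, _root_.sum_apply]
      refine Finset.sum_congr rfl fun j _ ↦ ?_
      rw [fderiv_mul_const (hP k j), _root_.smul_apply, smul_eq_mul, mul_comm]
      congr 1
      have h2 : fderiv ℝ (fun y ↦ (localFlux m n x (U 0 x) U (0, y) * metricMatrix m x y) k j)
          (extChartAt (𝓡 m) x x) (EuclideanSpace.single i (1 : ℝ)) =
          matrixDeriv (fun y ↦ localFlux m n x (U 0 x) U (0, y) * metricMatrix m x y)
            (extChartAt (𝓡 m) x x) (EuclideanSpace.single i (1 : ℝ)) k j := rfl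
      rw [h2]
      subst hp
      rw [matrixDeriv_mul hQ.slice hg, matrixDeriv_slice hQ]
      rfl
    · rw [FiberBundle.extend_apply_self, ← hmap]
      have h1 : ∀ β, coordComp n (U 0 x) β (U 0 x) (differential m n (U 0) x a) =
          (jac (localMap m n x (U 0 x) U) p *ᵥ coordTuple m x x a) β := fun β ↦ by
        have := congrFun (coordTuple_differential hs hqs a) β
        rw [hU.diffMatrix_eq_jac ht hs hqs, ← hp] at this
        exact this
      have h2 : ∀ γ, coordComp n (U 0 x) γ (U 0 x) (dThree m n (U 0) x b) =
          ((localFlux m n x (U 0 x) U p * metricMatrix m x p.2) *ᵥ coordTuple m x x b) γ :=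
        fun γ ↦ by
          have := congrFun (hU.coordTuple_dThree ht hs hqs b) γ
          rw [← hp, hp2] at this
          exact this
      simp only [h1, h2]
  · have h := congrFun (hU.coordTuple_dThree ht hs hqs
      (leviCivita m (FiberBundle.extend (Eu m) b) x a)) k
    rw [← hp, hp2] at h
    refine h.trans ?_
    simp only [mulVec, dotProduct, coordTuple, coordComp_leviCivita_extend, hp2]

/-- The product of the variation field with the tension field, in charts. -/
theorem IsVariation.inner_variationField_tension (hU : IsVariation m n u δ K U) {x : M}
    {p : ℝ × Eu m} (hp : p = (0, extChartAt (𝓡 m) x x)) :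
    inner ℝ (variationField n U x) (tension m n (U 0) x) =
      ((of fun i j ↦ ∑ k, (localTargetMetric m n x (U 0 x) U p *ᵥ
          fun α ↦ localVel m n x (U 0 x) U p α 0) k *
        ((matrixDeriv (localFlux m n x (U 0 x) U) p (0, EuclideanSpace.single i (1 : ℝ)) *
            metricMatrix m x p.2 +
          localFlux m n x (U 0 x) U p * metricDerivMatrix x p.2 i) k j +
        ∑ β, ∑ γ, christoffel n (U 0 x) (localMap m n x (U 0 x) U p) k β γ *
          jac (localMap m n x (U 0 x) U) p β i *
          (localFlux m n x (U 0 x) U p * metricMatrix m x p.2) γ j -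
        ∑ l, (localFlux m n x (U 0 x) U p * metricMatrix m x p.2) k l *
          christoffel m x p.2 l i j) : Matrix (Fin m) (Fin m) ℝ) *
      (metricMatrix m x p.2)⁻¹).trace := by
  have hs := mem_extChartAt_source (I := 𝓡 m) x
  have hqs := mem_extChartAt_source (I := 𝓡 n) (U 0 x)
  have hp2 : p.2 = extChartAt (𝓡 m) x x := by rw [hp]
  have hv : coordTuple n (U 0 x) (U 0 x) (variationField n U x) =
      fun α ↦ localVel m n x (U 0 x) U p α 0 :=
    funext fun α ↦ by rw [hp]; exact hU.coordComp_variationField hs hqs α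
  have hH : metricMatrix n (U 0 x) (extChartAt (𝓡 n) (U 0 x) (U 0 x)) =
      localTargetMetric m n x (U 0 x) U p := by
    rw [localTargetMetric, hp, localMap_extChartAt _ U 0 hs]
  have h1 : ∀ a b : TangentSpace (𝓡 m) x, inner ℝ (variationField n U x)
      (covDerivForm m n (U 0) (dThree m n (U 0)) x a b) =
      ∑ k, (localTargetMetric m n x (U 0 x) U p *ᵥ
          fun α ↦ localVel m n x (U 0 x) U p α 0) k *
        coordComp n (U 0 x) k (U 0 x)
          (covDerivForm m n (U 0) (dThree m n (U 0)) x a b) := fun a b ↦ by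
    rw [real_inner_comm, inner_eq_dotProduct_metricMatrix hqs, hv, hH, dotProduct_comm]
    rfl
  rw [tension, formDiv, inner_sum]
  simp only [h1, hU.coordComp_covDerivForm _ _ hp, sum_covDeriv_eq_dotProduct]
  rw [sum_inner_eq_trace hs, ← hp2]

/-- The first variation of the energy density is the divergence of the flux field minus the product
of the variation field and the tension field. -/
theorem IsVariation.fieldDiv_fluxField (hU : IsVariation m n u δ K U) (x : M) :
    fieldDiv (fluxField m n U) x =
      fderiv ℝ (localDensity m n x (U 0 x) U) (0, extChartAt (𝓡 m) x x) (1, 0) +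
        inner ℝ (variationField n U x) (tension m n (U 0) x) := by
  have hs := mem_extChartAt_source (I := 𝓡 m) x
  have hqs := mem_extChartAt_source (I := 𝓡 n) (U 0 x)
  have ht := zero_mem_Ioo hU
  set p : ℝ × Eu m := (0, extChartAt (𝓡 m) x x) with hp
  set q₀ := U 0 x with hq₀
  have hpd : p ∈ localDom m n x q₀ U δ := mem_localDom ht hs hqs
  have hn := (hU.isOpen_localDom x q₀).mem_nhds hpd
  have hQ := (hU.smoothMatrixOn_localFlux x q₀).diffMatrixAt hn
  have hH := (hU.smoothMatrixOn_localTargetMetric x q₀).diffMatrixAt hn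
  have hV := (hU.smoothMatrixOn_localVel x q₀).diffMatrixAt hn
  have hF := (hU.smoothMatrixOn_localFluxField x q₀).diffMatrixAt hn
  have hg : DiffMatrixAt (metricMatrix m x) p.2 :=
    (smoothMatrixOn_metricMatrix x).diffMatrixAt (extChartAt_target_mem_nhds_of_mem hpd.1.2)
  have hdet := isUnit_det_metricMatrix hpd.1.2
  have h1 : ∀ i, fderiv ℝ (fieldComp (fluxField m n U) x i) p.2
      (EuclideanSpace.single i (1 : ℝ)) =
      matrixDeriv (localFluxField m n x q₀ U) p (0, EuclideanSpace.single i (1 : ℝ)) i 0 := by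
    intro i
    have h11 : fieldComp (fluxField m n U) x i =ᶠ[𝓝 p.2]
        fun z ↦ localFluxField m n x q₀ U (0, z) i 0 :=
      Filter.eventually_of_mem ((hU.isOpen_slice x q₀ 0).mem_nhds hpd) fun z hz ↦
        hU.fieldComp_fluxField hz i
    rw [h11.fderiv_eq, fderiv_slice (hF i 0)]
    rfl
  have h2 : ∀ e, matrixDeriv (localFluxField m n x q₀ U) p e =
      (matrixDeriv (localFlux m n x q₀ U) p e)ᵀ *
        (localTargetMetric m n x q₀ U p * localVel m n x q₀ U p) +
      (localFlux m n x q₀ U p)ᵀ * (matrixDeriv (localTargetMetric m n x q₀ U) p e *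
        localVel m n x q₀ U p + localTargetMetric m n x q₀ U p *
        matrixDeriv (localVel m n x q₀ U) p e) := by
    intro e
    change matrixDeriv (fun z ↦ (localFlux m n x q₀ U z)ᵀ *
      (localTargetMetric m n x q₀ U z * localVel m n x q₀ U z)) p e = _
    rw [matrixDeriv_mul hQ.transpose (hH.mul hV), matrixDeriv_mul hH hV, matrixDeriv_transpose]
  have h3 : ∀ i, fieldComp (fluxField m n U) x i p.2 =
      ∑ k, localFlux m n x q₀ U p k i * (localTargetMetric m n x q₀ U p *ᵥ
        fun α ↦ localVel m n x q₀ U p α 0) k := fun i ↦ hU.fieldComp_fluxField hpd i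
  have h4 : ∀ i, fderiv ℝ (fun z ↦ Real.log (metricMatrix m x z).det) p.2
      (EuclideanSpace.single i (1 : ℝ)) =
      ((metricMatrix m x p.2)⁻¹ * metricDerivMatrix x p.2 i).trace :=
    fun i ↦ fderiv_log_det hg hdet _
  have h5 : matrixDeriv (localTargetMetric m n x q₀ U) p (1, 0) = of fun α β ↦
      ∑ γ, localVel m n x q₀ U p γ 0 * metricDeriv n q₀ (localMap m n x q₀ U p) γ α β := by
    ext α β
    exact hU.matrixDeriv_localTargetMetric hpd (1, 0) α β
  have hginv : ∀ i j, (metricMatrix m x p.2)⁻¹ i j = (metricMatrix m x p.2)⁻¹ j i := fun i j ↦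
    congrFun (congrFun (transpose_localInvMetric x p) j) i
  -- Q Jᵀ = J B Jᵀ inherits the symmetry of B.
  have hN : ∀ α β, (localFlux m n x q₀ U p * (jac (localMap m n x q₀ U) p)ᵀ) α β =
      (localFlux m n x q₀ U p * (jac (localMap m n x q₀ U) p)ᵀ) β α := fun α β ↦ by
    have h : (localFlux m n x q₀ U p * (jac (localMap m n x q₀ U) p)ᵀ)ᵀ =
        localFlux m n x q₀ U p * (jac (localMap m n x q₀ U) p)ᵀ := by
      rw [localFlux, transpose_mul, transpose_mul, transpose_transpose, transpose_localTensor,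
        Matrix.mul_assoc]
    exact congrFun (congrFun h β) α
  have key := divergence_algebra (g := metricMatrix m x p.2) (ginv := (metricMatrix m x p.2)⁻¹)
    (dg := metricDerivMatrix x p.2) (H := localTargetMetric m n x q₀ U p)
    (dH := fun γ ↦ of fun α β ↦ metricDeriv n q₀ (localMap m n x q₀ U p) γ α β)
    (Q := localFlux m n x q₀ U p) (J := jac (localMap m n x q₀ U) p)
    (J' := matrixDeriv (jac (localMap m n x q₀ U)) p (1, 0))
    (dQ := fun i ↦ matrixDeriv (localFlux m n x q₀ U) p (0, EuclideanSpace.single i (1 : ℝ)))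
    (v := fun α ↦ localVel m n x q₀ U p α 0)
    (ΓM := christoffel m x p.2) (ΓN := christoffel n q₀ (localMap m n x q₀ U p))
    (mul_nonsing_inv _ hdet) hginv (fun l i j ↦ metricDeriv_comm x p.2 l i j)
    (fun i j ↦ metricMatrix_comm q₀ _ i j) hN
    (fun a i j ↦ sum_metricMatrix_mul_christoffel hpd.1.2 a i j)
    (fun a i j ↦ sum_metricMatrix_mul_christoffel (localMap_mem_target hpd) a i j)
  rw [hU.inner_variationField_tension hp, hU.fderiv_localDensity_time hpd, h5]
  refine Eq.trans ?_ key
  rw [fieldDiv, chartDiv]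
  refine Finset.sum_congr rfl fun i _ ↦ ?_
  rw [h1, h2, h3, h4]
  congr 1
  rw [Matrix.mul_add, Matrix.add_apply, Matrix.add_apply, ← add_assoc]
  congr 1
  · refine congrArg₂ (· + ·) rfl ?_
    rw [Matrix.mul_apply]
    refine Finset.sum_congr rfl fun α _ ↦ congrArg₂ (· * ·) rfl ?_
    rw [Matrix.mul_apply]
    refine Finset.sum_congr rfl fun β _ ↦ ?_
    rw [hU.matrixDeriv_localTargetMetric hpd]
    rfl
  · rw [Matrix.mul_apply]
    refine Finset.sum_congr rfl fun α _ ↦ congrArg₂ (· * ·) rfl ?_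
    rw [Matrix.mul_apply]
    refine Finset.sum_congr rfl fun β _ ↦ ?_
    -- Mixed partials commute: the spatial derivative of the velocity is the time derivative of the
    -- Jacobian, which is the J' of the algebraic identity.
    rw [hU.matrixDeriv_localVel hpd]

end TensionInCharts

/-! ### The Riemannian volume measure -/

section Volume

variable {m : ℕ} {M : Type*} [TopologicalSpace M] [ChartedSpace (Eu m) M]
  [IsManifold (𝓡 m) ∞ M] [RiemannianBundle (fun x : M ↦ TangentSpace (𝓡 m) x)]

variable (m) in
/-- The density `√det(g_ij)` of the volume in the chart at `x₀`. -/
def volDensity (x₀ : M) (y : Eu m) : ℝ :=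
  Real.sqrt (metricMatrix m x₀ y).det

theorem volDensity_pos {x₀ : M} {y : Eu m} (hy : y ∈ (extChartAt (𝓡 m) x₀).target) :
    0 < volDensity m x₀ y :=
  Real.sqrt_pos.2 (posDef_metricMatrix hy).det_pos

theorem volDensity_transition {x₀ x₁ : M} {y : Eu m} (hy : y ∈ transitionDom m x₀ x₁) :
    volDensity m x₀ y = |(fderiv ℝ (transition m x₀ x₁) y).det| *
      volDensity m x₁ (transition m x₀ x₁ y) := by
  rw [volDensity, det_metricMatrix_transition hy, Real.sqrt_mul (sq_nonneg _), Real.sqrt_sq_eq_abs,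
    det_jacobian, volDensity]

variable [IsContMDiffRiemannianBundle (𝓡 m) ∞ (Eu m) (fun x : M ↦ TangentSpace (𝓡 m) x)]

theorem contDiffOn_volDensity (x₀ : M) :
    ContDiffOn ℝ ∞ (volDensity m x₀) (extChartAt (𝓡 m) x₀).target :=
  (smoothMatrixOn_metricMatrix x₀).det.sqrt fun _ hy ↦ (posDef_metricMatrix hy).det_pos.ne'

theorem measurableSet_extChartAt_target (x₀ : M) : MeasurableSet (extChartAt (𝓡 m) x₀).target :=
  (isOpen_extChartAt_target x₀).measurableSet

theorem aemeasurable_volDensity (x₀ : M) :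
    AEMeasurable (fun y ↦ ENNReal.ofReal (volDensity m x₀ y))
      (volume.restrict (extChartAt (𝓡 m) x₀).target) :=
  ((contDiffOn_volDensity x₀).continuousOn.aemeasurable
    (measurableSet_extChartAt_target x₀)).ennreal_ofReal

variable [MeasurableSpace M] [BorelSpace M]

theorem aemeasurable_extChartAt_symm (x₀ : M) :
    AEMeasurable (extChartAt (𝓡 m) x₀).symm (volume.restrict (extChartAt (𝓡 m) x₀).target) :=
  (continuousOn_extChartAt_symm x₀).aemeasurable (measurableSet_extChartAt_target x₀)

theorem chartVolume_apply (x₀ : M) {A : Set M} (hA : MeasurableSet A) :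
    chartVolume m x₀ A = ∫⁻ y in (extChartAt (𝓡 m) x₀).target ∩ (extChartAt (𝓡 m) x₀).symm ⁻¹' A,
      ENNReal.ofReal (volDensity m x₀ y) := by
  have hs := aemeasurable_extChartAt_symm (m := m) x₀
  rw [chartVolume, Measure.map_apply_of_aemeasurable
    (hs.mono_ac (withDensity_absolutelyContinuous _ _)) hA, withDensity_apply₀, 
    Measure.restrict_restrict₀, inter_comm]
  · rfl
  · exact hs.nullMeasurableSet_preimage hA
  · exact hs.nullMeasurableSet_preimage hA

theorem chartVolume_compl_source (x₀ : M) :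
    chartVolume m x₀ (extChartAt (𝓡 m) x₀).sourceᶜ = 0 := by
  rw [chartVolume_apply x₀ (isOpen_extChartAt_source x₀).measurableSet.compl]
  have : (extChartAt (𝓡 m) x₀).target ∩
      (extChartAt (𝓡 m) x₀).symm ⁻¹' (extChartAt (𝓡 m) x₀).sourceᶜ = ∅ := by
    ext y
    simp only [mem_inter_iff, mem_preimage, mem_compl_iff, mem_empty_iff_false, iff_false, not_and,
      not_not]
    exact fun hy ↦ (extChartAt (𝓡 m) x₀).map_target hy
  rw [this, Measure.restrict_empty, lintegral_zero_measure]

theorem symm_transition {x₀ x₁ : M} {y : Eu m} (hy : y ∈ transitionDom m x₀ x₁) :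
    (extChartAt (𝓡 m) x₁).symm (transition m x₀ x₁ y) = (extChartAt (𝓡 m) x₀).symm y :=
  (extChartAt (𝓡 m) x₁).left_inv hy.2

theorem transition_mem {x₀ x₁ : M} {y : Eu m} (hy : y ∈ transitionDom m x₀ x₁) :
    transition m x₀ x₁ y ∈ transitionDom m x₁ x₀ := by
  refine ⟨(extChartAt (𝓡 m) x₁).map_source hy.2, ?_⟩
  rw [mem_preimage, symm_transition hy]
  exact (extChartAt (𝓡 m) x₀).map_target hy.1

theorem transition_transition {x₀ x₁ : M} {y : Eu m} (hy : y ∈ transitionDom m x₀ x₁) :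
    transition m x₁ x₀ (transition m x₀ x₁ y) = y := by
  rw [transition, symm_transition hy]
  exact (extChartAt (𝓡 m) x₀).right_inv hy.1

/-- Change of variables along the transition map: the factor |det T'| is exactly the factor by which
√det g changes. -/
theorem chartVolume_eq_of_subset {x₀ x₁ : M} {A : Set M} (hA : MeasurableSet A)
    (h : A ⊆ (extChartAt (𝓡 m) x₀).source ∩ (extChartAt (𝓡 m) x₁).source) :
    chartVolume m x₁ A = chartVolume m x₀ A := by
  set B := (extChartAt (𝓡 m) x₀).target ∩ (extChartAt (𝓡 m) x₀).symm ⁻¹' A with hB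
  have hsub : B ⊆ transitionDom m x₀ x₁ := fun y hy ↦ ⟨hy.1, (h hy.2).2⟩
  -- The inverse chart is continuous on its target only, so measurability is obtained on the subtype
  -- and carried back.
  have hBm : MeasurableSet B := by
    have h1 := (continuousOn_iff_continuous_domRestrict.1
      (continuousOn_extChartAt_symm (I := 𝓡 m) x₀)).measurable hA
    have h2 := MeasurableSet.subtype_image (measurableSet_extChartAt_target (m := m) x₀) h1
    rwa [Set.domRestrict_eq, preimage_comp, Subtype.image_preimage_coe] at h2
  have himg : transition m x₀ x₁ '' B =
      (extChartAt (𝓡 m) x₁).target ∩ (extChartAt (𝓡 m) x₁).symm ⁻¹' A := by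
    ext z
    constructor
    · rintro ⟨y, hy, rfl⟩
      refine ⟨(transition_mem (hsub hy)).1, ?_⟩
      rw [mem_preimage, symm_transition (hsub hy)]
      exact hy.2
    · rintro ⟨hz, hzA⟩
      have hz' : z ∈ transitionDom m x₁ x₀ := ⟨hz, (h hzA).1⟩
      refine ⟨transition m x₁ x₀ z, ⟨(transition_mem hz').1, ?_⟩, transition_transition hz'⟩
      rw [mem_preimage, symm_transition hz']
      exact hzA
  rw [chartVolume_apply x₁ hA, chartVolume_apply x₀ hA, ← himg,
    lintegral_image_eq_lintegral_abs_det_fderiv_mul volume hBm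
      (fun y hy ↦ ((contDiffAt_transition (hsub hy)).differentiableAt
        (by simp)).hasFDerivAt.hasFDerivWithinAt)
      (fun y hy z hz hyz ↦ by
        rw [← transition_transition (hsub hy), hyz, transition_transition (hsub hz)])]
  refine setLIntegral_congr_fun hBm fun y hy ↦ ?_
  simp only [volDensity_transition (hsub hy)]
  rw [ENNReal.ofReal_mul (abs_nonneg _)]

variable (M) in
theorem chartVolume_le_riemannianVolume (x₀ : M) : chartVolume m x₀ ≤ riemannianVolume m M :=
  le_iSup (fun x₀ : M ↦ chartVolume m x₀) x₀

/-- The supremum adds nothing inside one chart domain: any other chart measure charges only its own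
domain, and on the overlap it agrees with the measure of the given chart. -/
theorem riemannianVolume_restrict (x₀ : M) :
    (riemannianVolume m M).restrict (extChartAt (𝓡 m) x₀).source = chartVolume m x₀ := by
  set S := (extChartAt (𝓡 m) x₀).source with hS
  have hSm : MeasurableSet S := (isOpen_extChartAt_source x₀).measurableSet
  have h0 := chartVolume_compl_source (m := m) x₀
  -- It suffices to dominate every chart measure by one measure that, on the chosen domain, is the
  -- measure of its chart; off that domain the volume itself serves as the bound.
  have hle : riemannianVolume m M ≤ chartVolume m x₀ + (riemannianVolume m M).restrict Sᶜ := by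
    refine iSup_le fun x₁ ↦ Measure.le_iff.2 fun A hA ↦ ?_
    rw [Measure.add_apply, Measure.restrict_apply hA, ← measure_inter_add_sdiff A hSm]
    refine add_le_add ?_ ?_
    · set S₁ := (extChartAt (𝓡 m) x₁).source with hS₁
      have hS₁m : MeasurableSet S₁ := (isOpen_extChartAt_source x₁).measurableSet
      rw [← measure_inter_add_sdiff (A ∩ S) hS₁m, measure_mono_null
        (show (A ∩ S) \ S₁ ⊆ S₁ᶜ from fun x hx ↦ hx.2) (chartVolume_compl_source (m := m) x₁), add_zero,
        chartVolume_eq_of_subset (x₀ := x₀) ((hA.inter hSm).inter hS₁m) fun x hx ↦ ⟨hx.1.2, hx.2⟩]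
      exact measure_mono fun x hx ↦ hx.1.1
    · exact chartVolume_le_riemannianVolume M x₁ _
  refine le_antisymm ?_ ?_
  · refine Measure.le_iff.2 fun A hA ↦ ?_
    rw [Measure.restrict_apply hA]
    refine (hle _).trans ?_
    rw [Measure.add_apply, Measure.restrict_apply (hA.inter hSm)]
    have : A ∩ S ∩ Sᶜ = ∅ := by rw [inter_assoc, inter_compl_self, inter_empty]
    rw [this, measure_empty, add_zero]
    exact measure_mono inter_subset_left
  · refine Measure.le_iff.2 fun A hA ↦ ?_
    rw [Measure.restrict_apply hA, ← measure_inter_add_sdiff A hSm,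
      measure_mono_null (show A \ S ⊆ Sᶜ from fun x hx ↦ hx.2) h0, add_zero]
    exact chartVolume_le_riemannianVolume M x₀ _

/-- A small neighbourhood corresponds to a ball whose closure is compact in the chart target, where
the continuous density √det g has finite integral. -/
instance isLocallyFiniteMeasure_riemannianVolume :
    IsLocallyFiniteMeasure (riemannianVolume m M) := by
  refine ⟨fun x₀ ↦ ?_⟩
  obtain ⟨r, hr, hball⟩ := Metric.nhds_basis_closedBall.mem_iff.1
    (extChartAt_target_mem_nhds (I := 𝓡 m) x₀)
  set V := (extChartAt (𝓡 m) x₀).source ∩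
    extChartAt (𝓡 m) x₀ ⁻¹' Metric.ball (extChartAt (𝓡 m) x₀ x₀) r with hV
  have hVo : IsOpen V := (continuousOn_extChartAt x₀).isOpen_inter_preimage
    (isOpen_extChartAt_source x₀) Metric.isOpen_ball
  refine ⟨V, hVo.mem_nhds ⟨mem_extChartAt_source x₀, Metric.mem_ball_self hr⟩, ?_⟩
  rw [← inter_eq_self_of_subset_left (show V ⊆ (extChartAt (𝓡 m) x₀).source from inter_subset_left),
    ← Measure.restrict_apply hVo.measurableSet, riemannianVolume_restrict,
    chartVolume_apply x₀ hVo.measurableSet]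
  refine (lintegral_mono_set (t := Metric.closedBall (extChartAt (𝓡 m) x₀ x₀) r) ?_).trans_lt ?_
  · rintro y ⟨hy, -, hyV⟩
    rw [mem_preimage, (extChartAt (𝓡 m) x₀).right_inv hy] at hyV
    exact Metric.ball_subset_closedBall hyV
  · exact (((contDiffOn_volDensity x₀).continuousOn.mono hball).integrableOn_compact
      (isCompact_closedBall _ _)).lintegral_lt_top

/-- A nonempty open set contains a nonempty open piece of a chart, and √det g is positive there. The
converse direction for harmonic maps needs this to get a positive integral. -/
instance isOpenPosMeasure_riemannianVolume : (riemannianVolume m M).IsOpenPosMeasure := by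
  refine ⟨fun V hV ⟨x₀, hx₀⟩ h0 ↦ ?_⟩
  have h1 : chartVolume m x₀ V = 0 :=
    le_antisymm ((chartVolume_le_riemannianVolume M x₀ V).trans h0.le) zero_le
  have hVm := hV.measurableSet
  set B := (extChartAt (𝓡 m) x₀).target ∩ (extChartAt (𝓡 m) x₀).symm ⁻¹' V with hB
  have hBo : IsOpen B :=
    (continuousOn_extChartAt_symm x₀).isOpen_inter_preimage (isOpen_extChartAt_target x₀) hV
  have hne : B.Nonempty := ⟨extChartAt (𝓡 m) x₀ x₀, mem_extChartAt_target x₀, by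
    rwa [mem_preimage, extChartAt_to_inv]⟩
  rw [chartVolume_apply x₀ hVm, ← hB, lintegral_eq_zero_iff'
    ((aemeasurable_volDensity x₀).mono_set inter_subset_left), Filter.EventuallyEq,
    ae_restrict_iff' hBo.measurableSet] at h1
  refine (hBo.measure_pos volume hne).ne' (measure_mono_null (fun y hy ↦ ?_) h1)
  simp only [mem_compl_iff, mem_ofPred_eq, Classical.not_imp]
  refine ⟨hy, ?_⟩
  simpa using volDensity_pos hy.1

theorem integral_riemannianVolume_of_source (x₀ : M) {f : M → ℝ} (hf : Continuous f)
    (h : ∀ x ∉ (extChartAt (𝓡 m) x₀).source, f x = 0) :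
    ∫ x, f x ∂(riemannianVolume m M) = ∫ y in (extChartAt (𝓡 m) x₀).target,
      volDensity m x₀ y * f ((extChartAt (𝓡 m) x₀).symm y) := by
  have hs := aemeasurable_extChartAt_symm (m := m) x₀
  rw [← setIntegral_eq_integral_of_forall_compl_eq_zero h, riemannianVolume_restrict, chartVolume,
    integral_map (hs.mono_ac (withDensity_absolutelyContinuous _ _)) hf.aestronglyMeasurable]
  refine (integral_withDensity_eq_integral_toReal_smul₀ (aemeasurable_volDensity x₀) (by simp) _).trans ?_
  refine setIntegral_congr_fun (measurableSet_extChartAt_target x₀) fun y hy ↦ ?_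
  simp only [smul_eq_mul]
  rw [ENNReal.toReal_ofReal (volDensity_pos hy).le]

end Volume

/-! ### The divergence theorem for compactly supported fields -/

section DivergenceTheorem

/-- Integration by parts against the constant function 1. -/
theorem integral_fderiv_apply_eq_zero {E : Type*} [NormedAddCommGroup E] [NormedSpace ℝ E]
    [FiniteDimensional ℝ E] [MeasurableSpace E] [BorelSpace E] {μ : Measure E}
    [μ.IsAddHaarMeasure] {f : E → ℝ} (hf : ContDiff ℝ 1 f) (hc : HasCompactSupport f) (e : E) :
    Integrable (fun y ↦ fderiv ℝ f y e) μ ∧ ∫ y, fderiv ℝ f y e ∂μ = 0 := by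
  have hi : Integrable (fun y ↦ fderiv ℝ f y e) μ :=
    ((hf.continuous_fderiv (by simp)).clm_apply continuous_const).integrable_of_hasCompactSupport
      (hc.fderiv_apply ℝ e)
  refine ⟨hi, ?_⟩
  have h := integral_mul_fderiv_eq_neg_fderiv_mul_of_integrable (𝕜 := ℝ) (μ := μ)
    (f := fun _ : E ↦ (1 : ℝ)) (g := f) (v := e) (by simp) (by simpa using hi)
    (by simpa using hf.continuous.integrable_of_hasCompactSupport hc)
    (fun _ _ ↦ differentiableAt_const _) (fun x _ ↦ hf.differentiable (by simp) x)
  simpa using h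

variable {m : ℕ} {M : Type*} [TopologicalSpace M] [ChartedSpace (Eu m) M]
  [IsManifold (𝓡 m) ∞ M] [RiemannianBundle (fun x : M ↦ TangentSpace (𝓡 m) x)]

theorem fieldDiv_eq_zero {X : (x : M) → TangentSpace (𝓡 m) x} {x : M}
    (h : ∀ᶠ z in 𝓝 x, X z = 0) : fieldDiv X x = 0 := by
  have hs := mem_extChartAt_source (I := 𝓡 m) x
  have ht := (extChartAt (𝓡 m) x).map_source hs
  have hc : Tendsto (extChartAt (𝓡 m) x).symm (𝓝 (extChartAt (𝓡 m) x x)) (𝓝 x) := by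
    have := (continuousOn_extChartAt_symm (I := 𝓡 m) x).continuousAt
      (extChartAt_target_mem_nhds_of_mem ht)
    rwa [ContinuousAt, extChartAt_to_inv] at this
  have h0 : ∀ i, fieldComp X x i =ᶠ[𝓝 (extChartAt (𝓡 m) x x)] fun _ ↦ 0 := by
    intro i
    filter_upwards [hc.eventually h, extChartAt_target_mem_nhds_of_mem ht] with y hy hyt
    rw [fieldComp, hy, ← zero_smul ℝ (0 : TangentSpace (𝓡 m) ((extChartAt (𝓡 m) x).symm y)),
      coordComp_smul ((extChartAt (𝓡 m) x).map_target hyt), zero_mul]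
  rw [fieldDiv, chartDiv]
  refine Finset.sum_eq_zero fun i _ ↦ ?_
  rw [(h0 i).fderiv_eq, (h0 i).self_of_nhds]
  simp

theorem fieldDiv_eq_zero_of_notMem {X : (x : M) → TangentSpace (𝓡 m) x} {K : Set M}
    (hK : IsClosed K) (h : ∀ x ∉ K, X x = 0) {x : M} (hx : x ∉ K) : fieldDiv X x = 0 :=
  fieldDiv_eq_zero (Filter.eventually_of_mem (hK.isOpen_compl.mem_nhds hx) h)

theorem fieldDiv_sum {ι : Type*} (s : Finset ι) {X : ι → (x : M) → TangentSpace (𝓡 m) x}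
    (hX : ∀ a ∈ s, IsC1Field (X a)) (x : M) :
    fieldDiv (fun z ↦ ∑ a ∈ s, X a z) x = ∑ a ∈ s, fieldDiv (X a) x := by
  have hs := mem_extChartAt_source (I := 𝓡 m) x
  have ht := (extChartAt (𝓡 m) x).map_source hs
  have h0 : ∀ i, fieldComp (fun z ↦ ∑ a ∈ s, X a z) x i =ᶠ[𝓝 (extChartAt (𝓡 m) x x)]
      fun y ↦ ∑ a ∈ s, fieldComp (X a) x i y := fun i ↦
    Filter.eventually_of_mem (extChartAt_target_mem_nhds_of_mem ht) fun y hy ↦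
      coordComp_sum _ ((extChartAt (𝓡 m) x).map_target hy) _ _
  simp only [fieldDiv, chartDiv]
  rw [Finset.sum_comm]
  refine Finset.sum_congr rfl fun i _ ↦ ?_
  rw [(h0 i).fderiv_eq, (h0 i).self_of_nhds,
    fderiv_fun_sum fun a ha ↦ (hX a ha).differentiableAt i ht, _root_.sum_apply, Finset.sum_mul,
    Finset.mul_sum, Finset.sum_add_distrib]

variable [IsContMDiffRiemannianBundle (𝓡 m) ∞ (Eu m) (fun x : M ↦ TangentSpace (𝓡 m) x)]

/-- The logarithmic derivative of √det g is half that of det g, so the volume density turns the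
Riemannian divergence into the Euclidean divergence of √det g X. -/
theorem volDensity_mul_chartDiv {X : (x : M) → TangentSpace (𝓡 m) x} (hX : IsC1Field X) {x₀ : M}
    {y : Eu m} (hy : y ∈ (extChartAt (𝓡 m) x₀).target) :
    volDensity m x₀ y * chartDiv X x₀ y =
      ∑ i, fderiv ℝ (fun z ↦ volDensity m x₀ z * fieldComp X x₀ i z) y
        (EuclideanSpace.single i (1 : ℝ)) := by
  have hpos : 0 < (metricMatrix m x₀ y).det := (posDef_metricMatrix hy).det_pos
  have hd : DifferentiableAt ℝ (fun z ↦ (metricMatrix m x₀ z).det) y :=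
    ((smoothMatrixOn_metricMatrix x₀).det.contDiffAt
      (extChartAt_target_mem_nhds_of_mem hy)).differentiableAt (by simp)
  have h1 : HasFDerivAt (volDensity m x₀) _ y := hd.hasFDerivAt.sqrt hpos.ne'
  have h2 := hd.hasFDerivAt.log hpos.ne'
  rw [chartDiv, Finset.mul_sum]
  refine Finset.sum_congr rfl fun i _ ↦ ?_
  have hsq : (metricMatrix m x₀ y).det = volDensity m x₀ y * volDensity m x₀ y :=
    (Real.mul_self_sqrt hpos.le).symm
  have hv := (volDensity_pos hy).ne'
  rw [fderiv_fun_mul h1.differentiableAt (hX.differentiableAt i hy), h1.fderiv, h2.fderiv]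
  simp only [_root_.add_apply, _root_.smul_apply, smul_eq_mul]
  change _ = _ + _ * (1 / (2 * volDensity m x₀ y) * _)
  rw [hsq]
  field_simp

variable [MeasurableSpace M] [BorelSpace M]

/-- In the chart the integrand is a Euclidean divergence of functions that vanish off a compact
subset of the target. Their extensions by zero are C¹ on the whole space, where each partial
derivative integrates to zero. -/
theorem integral_fieldDiv_of_subset_source [T2Space M] [SecondCountableTopology M]
    {X : (x : M) → TangentSpace (𝓡 m) x} (hX : IsC1Field X) {x₀ : M} {C : Set M}
    (hC : IsCompact C) (hsub : C ⊆ (extChartAt (𝓡 m) x₀).source) (h : ∀ x ∉ C, X x = 0) :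
    ∫ x, fieldDiv X x ∂(riemannianVolume m M) = 0 := by
  set T := (extChartAt (𝓡 m) x₀).target with hT
  have hTm : MeasurableSet T := measurableSet_extChartAt_target x₀
  set B := extChartAt (𝓡 m) x₀ '' C with hB
  have hBc : IsCompact B := hC.image_of_continuousOn ((continuousOn_extChartAt x₀).mono hsub)
  set F : Fin m → Eu m → ℝ := fun i z ↦ volDensity m x₀ z * fieldComp X x₀ i z with hF
  have hF0 : ∀ i, ∀ y ∈ T, y ∉ B → F i y = 0 := by
    intro i y hy hyB
    have hs := (extChartAt (𝓡 m) x₀).map_target hy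
    have : (extChartAt (𝓡 m) x₀).symm y ∉ C := fun hc ↦
      hyB ⟨_, hc, (extChartAt (𝓡 m) x₀).right_inv hy⟩
    simp only [hF]
    rw [fieldComp, h _ this, ← zero_smul ℝ (0 : TangentSpace (𝓡 m) _), coordComp_smul hs, zero_mul,
      mul_zero]
  have hFd : ∀ i, ContDiffOn ℝ 1 (F i) T := fun i ↦
    ((contDiffOn_volDensity x₀).of_le (by simp)).mul (hX x₀ i)
  have hG0 : ∀ i, ∀ y ∉ B, T.indicator (F i) y = 0 := by
    intro i y hyB
    by_cases hy : y ∈ T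
    · rw [indicator_of_mem hy, hF0 i y hy hyB]
    · exact indicator_of_notMem hy _
  have hGe : ∀ i, ∀ y ∈ T, T.indicator (F i) =ᶠ[𝓝 y] F i := fun i y hy ↦
    Filter.eventually_of_mem (extChartAt_target_mem_nhds_of_mem hy) fun z hz ↦ indicator_of_mem hz _
  -- The target and the complement of the compact set B are open and cover the space; on the second
  -- the extension is zero.
  have hGd : ∀ i, ContDiff ℝ 1 (T.indicator (F i)) := by
    intro i
    refine contDiff_iff_contDiffAt.2 fun y ↦ ?_
    by_cases hy : y ∈ T
    · exact ((hFd i).contDiffAt (extChartAt_target_mem_nhds_of_mem hy)).congr_of_eventuallyEq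
        (hGe i y hy)
    · have hyB : y ∉ B := by
        rintro ⟨x, hx, rfl⟩
        exact hy ((extChartAt (𝓡 m) x₀).map_source (hsub hx))
      exact (contDiffAt_const (c := (0 : ℝ))).congr_of_eventuallyEq
        (Filter.eventually_of_mem (hBc.isClosed.isOpen_compl.mem_nhds hyB) fun z hz ↦ hG0 i z hz)
  have hGs : ∀ i, HasCompactSupport (T.indicator (F i)) := fun i ↦
    HasCompactSupport.intro hBc (hG0 i)
  rw [integral_riemannianVolume_of_source x₀ hX.continuous_fieldDiv fun x hx ↦
    fieldDiv_eq_zero_of_notMem hC.isClosed h fun hxC ↦ hx (hsub hxC)]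
  have e1 : ∫ y in T, volDensity m x₀ y * fieldDiv X ((extChartAt (𝓡 m) x₀).symm y) =
      ∫ y in T, ∑ i, fderiv ℝ (T.indicator (F i)) y (EuclideanSpace.single i (1 : ℝ)) := by
    refine setIntegral_congr_fun hTm fun y hy ↦ ?_
    rw [fieldDiv_eq_chartDiv hX ((extChartAt (𝓡 m) x₀).map_target hy),
      (extChartAt (𝓡 m) x₀).right_inv hy, volDensity_mul_chartDiv hX hy]
    exact Finset.sum_congr rfl fun i _ ↦ by rw [(hGe i y hy).fderiv_eq]
  rw [e1, setIntegral_eq_integral_of_forall_compl_eq_zero]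
  · rw [integral_finsetSum _ fun i _ ↦ (integral_fderiv_apply_eq_zero (hGd i) (hGs i) _).1]
    exact Finset.sum_eq_zero fun i _ ↦ (integral_fderiv_apply_eq_zero (hGd i) (hGs i) _).2
  · intro y hy
    have hyB : y ∉ B := by
      rintro ⟨x, hx, rfl⟩
      exact hy ((extChartAt (𝓡 m) x₀).map_source (hsub hx))
    refine Finset.sum_eq_zero fun i _ ↦ ?_
    have : T.indicator (F i) =ᶠ[𝓝 y] fun _ ↦ 0 :=
      Filter.eventually_of_mem (hBc.isClosed.isOpen_compl.mem_nhds hyB) fun z hz ↦ hG0 i z hz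
    rw [this.fderiv_eq]
    simp

/-- The divergence theorem for compactly supported vector fields. -/
theorem integral_fieldDiv_eq_zero [T2Space M] [SecondCountableTopology M]
    {X : (x : M) → TangentSpace (𝓡 m) x} (hX : IsC1Field X) {K : Set M}
    (hK : IsCompact K) (h : ∀ x ∉ K, X x = 0) :
    ∫ x, fieldDiv X x ∂(riemannianVolume m M) = 0 := by
  have : LocallyCompactSpace M := ChartedSpace.locallyCompactSpace (Eu m) M
  obtain ⟨t, -, ht⟩ := hK.elim_nhds_subcover (fun x ↦ (extChartAt (𝓡 m) x).source)
    fun x _ ↦ extChartAt_source_mem_nhds x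
  -- The partition sums to 1 on K only. That is enough, because X vanishes elsewhere, and the finite
  -- cover of K keeps the index set finite.
  obtain ⟨ρ, hρ⟩ := SmoothPartitionOfUnity.exists_isSubordinate (𝓡 m) hK.isClosed
    (fun a : t ↦ (extChartAt (𝓡 m) (a : M)).source) (fun a ↦ isOpen_extChartAt_source _)
    (fun x hx ↦ by
      obtain ⟨a, ha, hxa⟩ := mem_iUnion₂.1 (ht hx)
      exact mem_iUnion.2 ⟨⟨a, ha⟩, hxa⟩)
  have hXρ : ∀ a, IsC1Field (fun x ↦ ρ a x • X x) := fun a ↦ hX.smul (ρ a).contMDiff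
  have hsum : X = fun x ↦ ∑ a, ρ a x • X x := by
    funext x
    by_cases hx : x ∈ K
    · rw [← Finset.sum_smul, ← finsum_eq_sum_of_fintype, ρ.sum_eq_one hx, one_smul]
    · simp [h x hx]
  have hC : ∀ a, IsCompact (K ∩ tsupport (ρ a)) := fun a ↦ hK.inter_right (isClosed_tsupport _)
  have h0 : ∀ a, ∀ x ∉ K ∩ tsupport (ρ a), ρ a x • X x = 0 := by
    intro a x hx
    by_cases hxK : x ∈ K
    · rw [image_eq_zero_of_notMem_tsupport fun hx' ↦ hx ⟨hxK, hx'⟩, zero_smul]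
    · rw [h x hxK, smul_zero]
  have hdiv : fieldDiv X = fun x ↦ ∑ a, fieldDiv (fun z ↦ ρ a z • X z) x := by
    funext x
    conv_lhs => rw [hsum]
    exact fieldDiv_sum _ (fun a _ ↦ hXρ a) x
  rw [hdiv, integral_finsetSum]
  · exact Finset.sum_eq_zero fun a _ ↦ integral_fieldDiv_of_subset_source (hXρ a) (hC a)
      (fun x hx ↦ hρ a hx.2) (h0 a)
  · exact fun a _ ↦ (hXρ a).continuous_fieldDiv.integrable_of_hasCompactSupport
      (HasCompactSupport.intro (hC a) fun x hx ↦
        fieldDiv_eq_zero_of_notMem (hC a).isClosed (h0 a) hx)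

end DivergenceTheorem

/-! ### Differentiation of the energy -/

section FirstVariation

variable {m n : ℕ} {M : Type*} [TopologicalSpace M] [ChartedSpace (Eu m) M]
  {N : Type*} [TopologicalSpace N] [ChartedSpace (Eu n) N]
  [RiemannianBundle (fun x : M ↦ TangentSpace (𝓡 m) x)]
  [RiemannianBundle (fun y : N ↦ TangentSpace (𝓡 n) y)]

variable {u : M → N} {δ : ℝ} {K : Set M} {U : ℝ → M → N}

/-- Differentials of maps that agree near x take values in tangent spaces over propositionally equal
points, so they can only be compared by `HEq`. Writing the density as a function D of the point and
the linear map makes this sufficient. -/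
theorem energyDensity_congr {f g : M → N} {x : M} (h : f =ᶠ[𝓝 x] g) :
    energyDensity m n f x = energyDensity m n g x := by
  set D : (p : N) → (TangentSpace (𝓡 m) x →L[ℝ] TangentSpace (𝓡 n) p) → ℝ := fun p L ↦
    (∑ i, inner ℝ ((∑ j, ∑ k, inner ℝ (L (orthoBasis m x j)) (L (orthoBasis m x k)) •
      ((innerSL ℝ (L (orthoBasis m x j))).comp L).smulRight (L (orthoBasis m x k)))
        (orthoBasis m x i)) (L (orthoBasis m x i))) / 6 with hD
  have key : ∀ (p q : N) (L : TangentSpace (𝓡 m) x →L[ℝ] TangentSpace (𝓡 n) p)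
      (L' : TangentSpace (𝓡 m) x →L[ℝ] TangentSpace (𝓡 n) q), p = q → HEq L L' →
      D p L = D q L' := by
    rintro p q L L' rfl hL
    rw [eq_of_heq hL]
  exact key (f x) (g x) (differential m n f x) (differential m n g x) h.self_of_nhds
    (heq_of_eq (h.mfderiv_eq (I := 𝓡 m) (I' := 𝓡 n)))

/-- A single smooth map is a constant variation, so results about variations apply to u itself. -/
theorem isVariation_const (hu : ContMDiff (𝓡 m) (𝓡 n) ∞ u) :
    IsVariation m n u 1 ∅ (fun _ ↦ u) where
  pos := one_pos
  initial := rfl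
  smooth := (hu.comp contMDiff_snd).contMDiffOn
  isCompact := isCompact_empty
  eq_off _ _ _ _ := rfl

variable [IsManifold (𝓡 m) ∞ M] [IsManifold (𝓡 n) ∞ N]

variable (m n) in
/-- The rate of change of the energy density along a variation. -/
def energyRate (U : ℝ → M → N) (t : ℝ) (x : M) : ℝ :=
  deriv (fun s ↦ energyDensity m n (U s) x) t

/-- Continuity is checked near each (t, x) with the charts centred at x and at `U t x`; the points
of space-time where this pair of charts is usable form an open set. -/
theorem IsVariation.continuousOn_of_local (hU : IsVariation m n u δ K U) {F : ℝ × M → ℝ}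
    {G : M → N → ℝ × Eu m → ℝ} (hG : ∀ x₀ q₀, ContinuousOn (G x₀ q₀) (localDom m n x₀ q₀ U δ))
    (h : ∀ (x₀ : M) (q₀ : N) (t : ℝ) (x : M), t ∈ Ioo (-δ) δ → x ∈ (extChartAt (𝓡 m) x₀).source →
      U t x ∈ (extChartAt (𝓡 n) q₀).source → F (t, x) = G x₀ q₀ (t, extChartAt (𝓡 m) x₀ x)) :
    ContinuousOn F (Ioo (-δ) δ ×ˢ univ) := by
  rintro ⟨t, x⟩ ⟨ht, -⟩
  refine ContinuousAt.continuousWithinAt ?_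
  have hs := mem_extChartAt_source (I := 𝓡 m) x
  have hp := mem_localDom (x₀ := x) (q₀ := U t x) ht hs (mem_extChartAt_source (I := 𝓡 n) (U t x))
  have hφ : ContinuousOn (fun p : ℝ × M ↦ (p.1, extChartAt (𝓡 m) x p.2))
      (univ ×ˢ (extChartAt (𝓡 m) x).source) :=
    continuousOn_fst.prodMk ((continuousOn_extChartAt x).comp continuousOn_snd fun p hp ↦ hp.2)
  have hW := hφ.isOpen_inter_preimage (isOpen_univ.prod (isOpen_extChartAt_source x))
    (hU.isOpen_localDom x (U t x))
  refine ((((hG x (U t x)).comp (hφ.mono inter_subset_left) fun p hp ↦ hp.2).congr ?_).continuousAt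
    (hW.mem_nhds ⟨⟨mem_univ _, hs⟩, hp⟩))
  rintro ⟨s, z⟩ ⟨⟨-, hz⟩, hsz⟩
  have h1 : U s ((extChartAt (𝓡 m) x).symm (extChartAt (𝓡 m) x z)) ∈
    (extChartAt (𝓡 n) (U t x)).source := hsz.2
  rw [(extChartAt (𝓡 m) x).left_inv hz] at h1
  exact h x (U t x) s z hsz.1.1 hz h1

variable [IsContMDiffRiemannianBundle (𝓡 m) ∞ (Eu m) (fun x : M ↦ TangentSpace (𝓡 m) x)]
  [IsContMDiffRiemannianBundle (𝓡 n) ∞ (Eu n) (fun y : N ↦ TangentSpace (𝓡 n) y)]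

theorem IsVariation.hasDerivAt_energyDensity_local (hU : IsVariation m n u δ K U) {t : ℝ} {x x₀ : M}
    {q₀ : N} (ht : t ∈ Ioo (-δ) δ) (hx : x ∈ (extChartAt (𝓡 m) x₀).source)
    (hq : U t x ∈ (extChartAt (𝓡 n) q₀).source) :
    HasDerivAt (fun s ↦ energyDensity m n (U s) x)
      (fderiv ℝ (localDensity m n x₀ q₀ U) (t, extChartAt (𝓡 m) x₀ x) (1, 0)) t := by
  have hp := mem_localDom ht hx hq
  have ho := hU.isOpen_localDom x₀ q₀
  have h1 := hasDerivAt_slice (((hU.contDiffOn_localDensity x₀ q₀).contDiffAt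
    (ho.mem_nhds hp)).differentiableAt (by simp))
  refine h1.congr_of_eventuallyEq ?_
  have h2 : IsOpen {s : ℝ | (s, extChartAt (𝓡 m) x₀ x) ∈ localDom m n x₀ q₀ U δ} :=
    ho.preimage (by fun_prop)
  refine Filter.eventually_of_mem (h2.mem_nhds hp) fun s hs ↦ ?_
  have h3 : U s ((extChartAt (𝓡 m) x₀).symm (extChartAt (𝓡 m) x₀ x)) ∈
    (extChartAt (𝓡 n) q₀).source := hs.2
  rw [(extChartAt (𝓡 m) x₀).left_inv hx] at h3
  exact hU.energyDensity_eq hs.1.1 hx h3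

theorem IsVariation.hasDerivAt_energyDensity (hU : IsVariation m n u δ K U) {t : ℝ} (x : M)
    (ht : t ∈ Ioo (-δ) δ) :
    HasDerivAt (fun s ↦ energyDensity m n (U s) x) (energyRate m n U t x) t :=
  (hU.hasDerivAt_energyDensity_local ht (mem_extChartAt_source x)
    (mem_extChartAt_source (U t x))).differentiableAt.hasDerivAt

theorem IsVariation.continuousOn_energyDensity (hU : IsVariation m n u δ K U) :
    ContinuousOn (fun p : ℝ × M ↦ energyDensity m n (U p.1) p.2) (Ioo (-δ) δ ×ˢ univ) :=
  hU.continuousOn_of_local (fun x₀ q₀ ↦ (hU.contDiffOn_localDensity x₀ q₀).continuousOn)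
    fun _ _ _ _ ht hx hq ↦ hU.energyDensity_eq ht hx hq

theorem IsVariation.continuousOn_energyRate (hU : IsVariation m n u δ K U) :
    ContinuousOn (fun p : ℝ × M ↦ energyRate m n U p.1 p.2) (Ioo (-δ) δ ×ˢ univ) :=
  hU.continuousOn_of_local
    (G := fun x₀ q₀ p ↦ fderiv ℝ (localDensity m n x₀ q₀ U) p (1, 0))
    (fun x₀ q₀ ↦ ((hU.contDiffOn_localDensity x₀ q₀).continuousOn_fderiv_of_isOpen
      (hU.isOpen_localDom x₀ q₀) (by simp)).clm_apply continuousOn_const)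
    fun _ _ _ _ ht hx hq ↦ (hU.hasDerivAt_energyDensity_local ht hx hq).deriv

theorem IsVariation.continuous_energyDensity (hU : IsVariation m n u δ K U) {t : ℝ}
    (ht : t ∈ Ioo (-δ) δ) : Continuous (energyDensity m n (U t)) :=
  ContinuousOn.comp_continuous (f := fun x : M ↦ (t, x)) hU.continuousOn_energyDensity
    (Continuous.prodMk_right t) fun _ ↦ ⟨ht, mem_univ _⟩

theorem IsVariation.continuous_energyRate (hU : IsVariation m n u δ K U) {t : ℝ}
    (ht : t ∈ Ioo (-δ) δ) : Continuous (energyRate m n U t) :=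
  ContinuousOn.comp_continuous (f := fun x : M ↦ (t, x)) hU.continuousOn_energyRate
    (Continuous.prodMk_right t) fun _ ↦ ⟨ht, mem_univ _⟩

theorem IsVariation.fieldDiv_fluxField_eq (hU : IsVariation m n u δ K U) (x : M) :
    fieldDiv (fluxField m n U) x =
      energyRate m n U 0 x + inner ℝ (variationField n U x) (tension m n (U 0) x) := by
  rw [hU.fieldDiv_fluxField, energyRate, (hU.hasDerivAt_energyDensity_local (zero_mem_Ioo hU)
    (mem_extChartAt_source x) (mem_extChartAt_source (U 0 x))).deriv]

theorem IsVariation.variationField_eq_zero (hU : IsVariation m n u δ K U) {x : M} (hx : x ∉ K) :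
    variationField n U x = 0 := by
  have h : (fun t ↦ U t x) =ᶠ[𝓝 0] fun _ ↦ u x :=
    Filter.eventually_of_mem (isOpen_Ioo.mem_nhds (zero_mem_Ioo hU)) fun t ht ↦ hU.eq_off t ht x hx
  have h1 := (h.mfderiv_eq (I := 𝓘(ℝ, ℝ)) (I' := 𝓡 n)).trans mfderiv_const
  exact congrArg (fun L : ℝ →L[ℝ] Eu n ↦ L 1) h1

theorem IsVariation.fluxField_eq_zero (hU : IsVariation m n u δ K U) {x : M} (hx : x ∉ K) :
    fluxField m n U x = 0 := by
  simp [fluxField, hU.variationField_eq_zero hx]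

variable [T2Space M]

theorem IsVariation.energyDensity_eq_of_notMem (hU : IsVariation m n u δ K U) {t : ℝ}
    (ht : t ∈ Ioo (-δ) δ) {x : M} (hx : x ∉ K) :
    energyDensity m n (U t) x = energyDensity m n u x :=
  energyDensity_congr (Filter.eventually_of_mem (hU.isCompact.isClosed.isOpen_compl.mem_nhds hx)
    fun z hz ↦ hU.eq_off t ht z hz)

theorem IsVariation.energyRate_eq_zero (hU : IsVariation m n u δ K U) {x : M} (hx : x ∉ K) :
    energyRate m n U 0 x = 0 := by
  have h : (fun t ↦ energyDensity m n (U t) x) =ᶠ[𝓝 0] fun _ ↦ energyDensity m n u x :=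
    Filter.eventually_of_mem (isOpen_Ioo.mem_nhds (zero_mem_Ioo hU))
      fun t ht ↦ hU.energyDensity_eq_of_notMem ht hx
  rw [energyRate, h.deriv_eq, deriv_const]

/-- The tension field is defined with a different chart at each point. Continuity of its pairing
with v is read off from the first variation identity, as a difference of two continuous functions.
-/
theorem IsVariation.continuous_inner_tension (hU : IsVariation m n u δ K U) :
    Continuous fun x ↦ inner ℝ (variationField n U x) (tension m n (U 0) x) := by
  have h : (fun x ↦ inner ℝ (variationField n U x) (tension m n (U 0) x)) =
      fun x ↦ fieldDiv (fluxField m n U) x - energyRate m n U 0 x :=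
    funext fun x ↦ by rw [hU.fieldDiv_fluxField_eq]; ring
  rw [h]
  exact hU.isC1Field_fluxField.continuous_fieldDiv.sub (hU.continuous_energyRate (zero_mem_Ioo hU))

theorem IsVariation.hasCompactSupport_inner_tension (hU : IsVariation m n u δ K U) :
    HasCompactSupport fun x ↦ inner ℝ (variationField n U x) (tension m n (U 0) x) :=
  HasCompactSupport.intro hU.isCompact fun x hx ↦ by
    rw [hU.variationField_eq_zero hx, inner_zero_left]

variable [MeasurableSpace M] [BorelSpace M]

theorem IsVariation.integrable_inner_tension (hU : IsVariation m n u δ K U) :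
    Integrable (fun x ↦ inner ℝ (variationField n U x) (tension m n (U 0) x))
      (riemannianVolume m M) :=
  hU.continuous_inner_tension.integrable_of_hasCompactSupport hU.hasCompactSupport_inner_tension

theorem IsVariation.integrableOn_energyDensity_of_isCompact (hU : IsVariation m n u δ K U) {t : ℝ}
    (ht : t ∈ Ioo (-δ) δ) {D : Set M} (hD : IsCompact D) :
    IntegrableOn (energyDensity m n (U t)) D (riemannianVolume m M) :=
  (hU.continuous_energyDensity ht).continuousOn.integrableOn_compact hD

/-- On the compact set K the density is continuous, and off K it is that of u. -/
theorem IsVariation.integrableOn_energyDensity (hU : IsVariation m n u δ K U) {t : ℝ}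
    (ht : t ∈ Ioo (-δ) δ) {D : Set M} (hD : MeasurableSet D)
    (hi : IntegrableOn (energyDensity m n u) D (riemannianVolume m M)) :
    IntegrableOn (energyDensity m n (U t)) D (riemannianVolume m M) := by
  have h1 : IntegrableOn (energyDensity m n (U t)) (D \ K) (riemannianVolume m M) :=
    (hi.mono_set sdiff_subset).congr_fun
      (fun x hx ↦ (hU.energyDensity_eq_of_notMem ht hx.2).symm)
      (hD.diff hU.isCompact.measurableSet)
  exact ((hU.integrableOn_energyDensity_of_isCompact ht hU.isCompact).union h1).mono_set
    fun x hx ↦ by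
      by_cases hxK : x ∈ K
      · exact Or.inl hxK
      · exact Or.inr ⟨hx, hxK⟩

theorem IsVariation.energyOn_eq (hU : IsVariation m n u δ K U) {t : ℝ} (ht : t ∈ Ioo (-δ) δ)
    {D : Set M} (hD : MeasurableSet D) (hKD : K ⊆ D)
    (hi : IntegrableOn (energyDensity m n u) D (riemannianVolume m M)) :
    energyOn m n D (U t) = energyOn m n K (U t) + energyOn m n (D \ K) u := by
  have hKm : MeasurableSet K := hU.isCompact.measurableSet
  have h := hU.integrableOn_energyDensity ht hD hi
  have h1 : D = K ∪ D \ K := (union_sdiff_cancel hKD).symm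
  simp only [energyOn]
  conv_lhs => rw [h1]
  rw [setIntegral_union disjoint_sdiff_right (hD.diff hKm) (h.mono_set hKD) (h.mono_set sdiff_subset)]
  congr 1
  exact setIntegral_congr_fun (hD.diff hKm) fun x hx ↦ hU.energyDensity_eq_of_notMem ht hx.2

variable [SecondCountableTopology M]

/-- Dominated differentiation under the integral: the rate is continuous on space-time, hence
bounded by a constant on a compact set, and K has finite measure. -/
theorem IsVariation.hasDerivAt_energyOn_support (hU : IsVariation m n u δ K U) :
    HasDerivAt (fun t ↦ energyOn m n K (U t))
      (∫ x in K, energyRate m n U 0 x ∂(riemannianVolume m M)) 0 := by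
  have hpos := hU.pos
  have h0 := zero_mem_Ioo hU
  -- Halving the interval makes the set of times compact.
  have hsub : Icc (-(δ / 2)) (δ / 2) ⊆ Ioo (-δ) δ := fun t ht ↦
    ⟨by linarith [ht.1], by linarith [ht.2]⟩
  obtain ⟨C, hC⟩ := (isCompact_Icc.prod hU.isCompact).exists_bound_of_continuousOn
    (hU.continuousOn_energyRate.mono (prod_mono hsub (subset_univ K)))
  have hKm : MeasurableSet K := hU.isCompact.measurableSet
  refine (hasDerivAt_integral_of_dominated_loc_of_deriv_le (bound := fun _ ↦ C)
    (F := fun t x ↦ energyDensity m n (U t) x) (F' := fun t x ↦ energyRate m n U t x)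
    (s := Icc (-(δ / 2)) (δ / 2)) (Icc_mem_nhds (by linarith) (by linarith)) ?_ ?_ ?_ ?_ ?_ ?_).2
  · exact Filter.eventually_of_mem (isOpen_Ioo.mem_nhds h0) fun t ht ↦
      (hU.continuous_energyDensity ht).aestronglyMeasurable
  · exact hU.integrableOn_energyDensity_of_isCompact h0 hU.isCompact
  · exact (hU.continuous_energyRate h0).aestronglyMeasurable
  · exact (ae_restrict_iff' hKm).2 (Filter.Eventually.of_forall fun x hx t ht ↦ hC (t, x) ⟨ht, hx⟩)
  · exact integrableOn_const hU.isCompact.measure_lt_top.ne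
  · exact Filter.Eventually.of_forall fun x t ht ↦ hU.hasDerivAt_energyDensity x (hsub ht)

/-- The rate is the divergence of the flux field minus the pairing with τ, and the flux field
vanishes off K, so its divergence integrates to zero. -/
theorem IsVariation.integral_energyRate (hU : IsVariation m n u δ K U) :
    ∫ x in K, energyRate m n U 0 x ∂(riemannianVolume m M) =
      -∫ x, inner ℝ (variationField n U x) (tension m n (U 0) x) ∂(riemannianVolume m M) := by
  rw [setIntegral_eq_integral_of_forall_compl_eq_zero fun x hx ↦ hU.energyRate_eq_zero hx]
  have h1 : ∀ x, energyRate m n U 0 x = fieldDiv (fluxField m n U) x -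
      inner ℝ (variationField n U x) (tension m n (U 0) x) := fun x ↦ by
    rw [hU.fieldDiv_fluxField_eq]; ring
  have h2 : Integrable (fieldDiv (fluxField m n U)) (riemannianVolume m M) :=
    hU.isC1Field_fluxField.continuous_fieldDiv.integrable_of_hasCompactSupport
      (HasCompactSupport.intro hU.isCompact fun x hx ↦ fieldDiv_eq_zero_of_notMem
        hU.isCompact.isClosed (fun _ hz ↦ hU.fluxField_eq_zero hz) hx)
  simp only [h1]
  rw [integral_sub h2 hU.integrable_inner_tension, integral_fieldDiv_eq_zero hU.isC1Field_fluxField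
    hU.isCompact fun _ hz ↦ hU.fluxField_eq_zero hz, zero_sub]

/-- The first variation formula. -/
theorem IsVariation.hasDerivAt_energyOn (hU : IsVariation m n u δ K U) {D : Set M}
    (hD : MeasurableSet D) (hKD : K ⊆ D)
    (hi : IntegrableOn (energyDensity m n u) D (riemannianVolume m M)) :
    HasDerivAt (fun t ↦ energyOn m n D (U t))
      (-∫ x, inner ℝ (variationField n U x) (tension m n (U 0) x) ∂(riemannianVolume m M)) 0 := by
  rw [← hU.integral_energyRate]
  refine (hU.hasDerivAt_energyOn_support.add_const (energyOn m n (D \ K) u)).congr_of_eventuallyEq ?_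
  exact Filter.eventually_of_mem (isOpen_Ioo.mem_nhds (zero_mem_Ioo hU)) fun t ht ↦
    hU.energyOn_eq ht hD hKD hi

theorem integrableOn_energyDensity_of_contMDiff (hu : ContMDiff (𝓡 m) (𝓡 n) ∞ u) {D : Set M}
    (hD : IsCompact D) : IntegrableOn (energyDensity m n u) D (riemannianVolume m M) :=
  have h := isVariation_const hu
  h.integrableOn_energyDensity_of_isCompact (zero_mem_Ioo h) hD

end FirstVariation

/-! ### Variations in a chart direction and harmonicity -/

section Harmonic

open Matrix

variable {m n : ℕ} {M : Type*} [TopologicalSpace M] [ChartedSpace (Eu m) M]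
  {N : Type*} [TopologicalSpace N] [ChartedSpace (Eu n) N]

variable {u : M → N} {δ : ℝ} {K : Set M} {U : ℝ → M → N} {q₀ : N} {W : Set M} {η : M → ℝ} {c : Eu n}

open Classical in
/-- The variation that moves `u` on the set `W` in the direction of the constant vector `c` in the
chart at `q₀`, with the cut-off function `η`. -/
def chartVariation (q₀ : N) (u : M → N) (W : Set M) (η : M → ℝ) (c : Eu n) (t : ℝ) (x : M) : N :=
  if x ∈ W then (extChartAt (𝓡 n) q₀).symm (extChartAt (𝓡 n) q₀ (u x) + (t * η x) • c) else u x

theorem chartVariation_of_eq_zero (hW : ∀ x ∈ W, u x ∈ (extChartAt (𝓡 n) q₀).source) {t : ℝ}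
    {x : M} (hx : t * η x = 0) : chartVariation q₀ u W η c t x = u x := by
  rw [chartVariation]
  split_ifs with h
  · rw [hx, zero_smul, add_zero, (extChartAt (𝓡 n) q₀).left_inv (hW x h)]
  · rfl

theorem mul_mem_Ioo {t s : ℝ} (ht : t ∈ Ioo (-δ) δ) (hs : |s| ≤ 1) : t * s ∈ Ioo (-δ) δ := by
  rw [mem_Ioo, ← abs_lt] at ht ⊢
  rw [abs_mul]
  exact (mul_le_of_le_one_right (abs_nonneg t) hs).trans_lt ht

variable [IsManifold (𝓡 m) ∞ M] [IsManifold (𝓡 n) ∞ N]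

/-- On W the family is given by a smooth formula in the chart, and off the support of η it is u.
These two open sets cover M. The bound |η| ≤ 1 keeps t η(x) in the interval on which the chart
formula is admissible. -/
theorem isVariation_chartVariation (hu : ContMDiff (𝓡 m) (𝓡 n) ∞ u) (hδ : 0 < δ) (hWo : IsOpen W)
    (hW : ∀ x ∈ W, u x ∈ (extChartAt (𝓡 n) q₀).source)
    (hc : ∀ x ∈ W, ∀ t ∈ Ioo (-δ) δ, extChartAt (𝓡 n) q₀ (u x) + t • c ∈
      (extChartAt (𝓡 n) q₀).target)
    (hη : ContMDiff (𝓡 m) 𝓘(ℝ, ℝ) ∞ η) (hη1 : ∀ x, |η x| ≤ 1) (hηc : HasCompactSupport η)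
    (hηW : tsupport η ⊆ W) :
    IsVariation m n u δ (tsupport η) (chartVariation q₀ u W η c) where
  pos := hδ
  initial := funext fun x ↦ chartVariation_of_eq_zero hW (zero_mul _)
  isCompact := hηc
  eq_off t _ x hx := chartVariation_of_eq_zero hW (by
    rw [image_eq_zero_of_notMem_tsupport hx, mul_zero])
  smooth := by
    rintro ⟨t, x⟩ ⟨ht, -⟩
    refine ContMDiffAt.contMDiffWithinAt ?_
    by_cases hx : x ∈ W
    · have ho : IsOpen (Ioo (-δ) δ ×ˢ W) := isOpen_Ioo.prod hWo
      have h1 : ContMDiffOn (𝓘(ℝ, ℝ).prod (𝓡 m)) 𝓘(ℝ, Eu n) ∞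
          (fun p : ℝ × M ↦ extChartAt (𝓡 n) q₀ (u p.2) + (p.1 * η p.2) • c)
          (Ioo (-δ) δ ×ˢ W) := by
        have h2 : ContMDiffOn (𝓘(ℝ, ℝ).prod (𝓡 m)) 𝓘(ℝ, Eu n) ∞
            (fun p : ℝ × M ↦ extChartAt (𝓡 n) q₀ (u p.2)) (Ioo (-δ) δ ×ˢ W) :=
          contMDiffOn_extChartAt.comp (hu.comp contMDiff_snd).contMDiffOn
            fun p hp ↦ by simpa using hW p.2 hp.2
        have h3 : ContMDiff (𝓘(ℝ, ℝ).prod (𝓡 m)) 𝓘(ℝ, ℝ) ∞ (fun p : ℝ × M ↦ p.1 * η p.2) :=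
          contMDiff_fst.mul (hη.comp contMDiff_snd)
        exact h2.add (h3.smul contMDiff_const).contMDiffOn
      have h4 := (contMDiffOn_extChartAt_symm (I := 𝓡 n) (n := ∞) q₀).comp h1
        fun p hp ↦ hc p.2 hp.2 _ (mul_mem_Ioo hp.1 (hη1 p.2))
      exact (h4.congr fun p hp ↦ if_pos hp.2).contMDiffAt (ho.mem_nhds ⟨ht, hx⟩)
    · have ho : IsOpen (univ ×ˢ (tsupport η)ᶜ : Set (ℝ × M)) :=
        isOpen_univ.prod (isClosed_tsupport η).isOpen_compl
      have h1 : ContMDiff (𝓘(ℝ, ℝ).prod (𝓡 m)) (𝓡 n) ∞ (fun p : ℝ × M ↦ u p.2) :=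
        hu.comp contMDiff_snd
      refine (h1.contMDiffAt (x := (t, x))).congr_of_eventuallyEq ?_
      exact Filter.eventually_of_mem (ho.mem_nhds ⟨mem_univ _, fun h ↦ hx (hηW h)⟩) fun p hp ↦
        chartVariation_of_eq_zero hW (by rw [image_eq_zero_of_notMem_tsupport hp.2, mul_zero])

theorem coordComp_variationField_chartVariation
    (hU : IsVariation m n u δ K (chartVariation q₀ u W η c))
    (hW : ∀ x ∈ W, u x ∈ (extChartAt (𝓡 n) q₀).source)
    (hc : ∀ x ∈ W, ∀ t ∈ Ioo (-δ) δ, extChartAt (𝓡 n) q₀ (u x) + t • c ∈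
      (extChartAt (𝓡 n) q₀).target)
    (hη1 : ∀ x, |η x| ≤ 1) {x : M} (hx : x ∈ W) (α : Fin n) :
    coordComp n q₀ α (chartVariation q₀ u W η c 0 x)
      (variationField n (chartVariation q₀ u W η c) x) = η x * c α := by
  have hs := mem_extChartAt_source (I := 𝓡 m) x
  have h0 := zero_mem_Ioo hU
  have hq : chartVariation q₀ u W η c 0 x ∈ (extChartAt (𝓡 n) q₀).source := by
    rw [chartVariation_of_eq_zero hW (zero_mul _)]
    exact hW x hx
  rw [hU.coordComp_variationField hs hq, localVel, of_apply]
  have h1 := hasDerivAt_slice (hU.differentiableAt_localMap (mem_localDom h0 hs hq))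
  have h2 : HasDerivAt (fun t : ℝ ↦ extChartAt (𝓡 n) q₀ (u x) + (t * η x) • c) (η x • c) 0 := by
    have := (((hasDerivAt_id (0 : ℝ)).mul_const (η x)).smul_const c).const_add
      (extChartAt (𝓡 n) q₀ (u x))
    simpa using! this
  have h3 : (fun t ↦ localMap m n x q₀ (chartVariation q₀ u W η c) (t, extChartAt (𝓡 m) x x))
      =ᶠ[𝓝 0] fun t : ℝ ↦ extChartAt (𝓡 n) q₀ (u x) + (t * η x) • c := by
    refine Filter.eventually_of_mem (isOpen_Ioo.mem_nhds h0) fun t ht ↦ ?_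
    simp only [localMap_extChartAt q₀ _ t hs, chartVariation, if_pos hx]
    exact (extChartAt (𝓡 n) q₀).right_inv (hc x hx _ (mul_mem_Ioo ht (hη1 x)))
  rw [h1.unique (h2.congr_of_eventuallyEq h3)]
  simp

variable [RiemannianBundle (fun x : M ↦ TangentSpace (𝓡 m) x)]
  [RiemannianBundle (fun y : N ↦ TangentSpace (𝓡 n) y)]
  [IsContMDiffRiemannianBundle (𝓡 m) ∞ (Eu m) (fun x : M ↦ TangentSpace (𝓡 m) x)]
  [IsContMDiffRiemannianBundle (𝓡 n) ∞ (Eu n) (fun y : N ↦ TangentSpace (𝓡 n) y)]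

variable (m) in
/-- The inner product of the tension field of `u` with the vector field along `u` that has the
constant components `c` in the chart at `q₀`. -/
def tensionPairing (q₀ : N) (u : M → N) (c : Eu n) (x : M) : ℝ :=
  (fun i ↦ c i) ⬝ᵥ (metricMatrix n q₀ (extChartAt (𝓡 n) q₀ (u x)) *ᵥ
    coordTuple n q₀ (u x) (tension m n u x))

theorem inner_variationField_chartVariation
    (hU : IsVariation m n u δ (tsupport η) (chartVariation q₀ u W η c))
    (hW : ∀ x ∈ W, u x ∈ (extChartAt (𝓡 n) q₀).source)
    (hc : ∀ x ∈ W, ∀ t ∈ Ioo (-δ) δ, extChartAt (𝓡 n) q₀ (u x) + t • c ∈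
      (extChartAt (𝓡 n) q₀).target)
    (hη1 : ∀ x, |η x| ≤ 1) (hηW : tsupport η ⊆ W) (x : M) :
    inner ℝ (variationField n (chartVariation q₀ u W η c) x)
      (tension m n (chartVariation q₀ u W η c 0) x) = η x * tensionPairing m q₀ u c x := by
  by_cases hx : x ∈ W
  · have hq : chartVariation q₀ u W η c 0 x ∈ (extChartAt (𝓡 n) q₀).source := by
      rw [hU.initial]
      exact hW x hx
    have hv : coordTuple n q₀ (chartVariation q₀ u W η c 0 x)
        (variationField n (chartVariation q₀ u W η c) x) = η x • fun i ↦ c i :=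
      funext fun i ↦ coordComp_variationField_chartVariation hU hW hc hη1 hx i
    rw [inner_eq_dotProduct_metricMatrix hq, hv, smul_dotProduct, smul_eq_mul, hU.initial]
    rfl
  · have hx' : x ∉ tsupport η := fun h ↦ hx (hηW h)
    rw [hU.variationField_eq_zero hx', inner_zero_left, image_eq_zero_of_notMem_tsupport hx',
      zero_mul]

/-- Near a given point there are variations of `u` in the direction of any vector. -/
theorem exists_isVariation (hu : ContMDiff (𝓡 m) (𝓡 n) ∞ u) (x₀ : M) (c : Eu n) :
    ∃ W : Set M, IsOpen W ∧ x₀ ∈ W ∧ ∃ δ : ℝ, ∀ η : M → ℝ, ContMDiff (𝓡 m) 𝓘(ℝ, ℝ) ∞ η →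
      (∀ x, |η x| ≤ 1) → HasCompactSupport η → tsupport η ⊆ W →
      ∃ U, IsVariation m n u δ (tsupport η) U ∧
        ∀ x, inner ℝ (variationField n U x) (tension m n (U 0) x) =
          η x * tensionPairing m (u x₀) u c x := by
  set ψ := extChartAt (𝓡 n) (u x₀) with hψ
  obtain ⟨r, hr, hball⟩ := Metric.mem_nhds_iff.1 (extChartAt_target_mem_nhds (I := 𝓡 n) (u x₀))
  set O := ψ.source ∩ ψ ⁻¹' Metric.ball (ψ (u x₀)) (r / 2) with hO
  have hOo : IsOpen O := (continuousOn_extChartAt (u x₀)).isOpen_inter_preimage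
    (isOpen_extChartAt_source (u x₀)) Metric.isOpen_ball
  have hW : ∀ x ∈ u ⁻¹' O, u x ∈ ψ.source := fun x hx ↦ hx.1
  -- One half of the radius r is spent on the distance of u(x) from u(x₀) in the chart, the other on
  -- the displacement t c. Adding 1 avoids division by zero when c = 0.
  have hδ : 0 < r / (2 * (‖c‖ + 1)) := by positivity
  have hc : ∀ x ∈ u ⁻¹' O, ∀ t ∈ Ioo (-(r / (2 * (‖c‖ + 1)))) (r / (2 * (‖c‖ + 1))),
      ψ (u x) + t • c ∈ ψ.target := by
    intro x hx t ht
    refine hball ?_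
    have h1 : dist (ψ (u x)) (ψ (u x₀)) < r / 2 := hx.2
    have h2 : |t| < r / (2 * (‖c‖ + 1)) := abs_lt.2 ht
    have h3 : ‖t • c‖ ≤ r / 2 := by
      rw [norm_smul, Real.norm_eq_abs]
      calc |t| * ‖c‖ ≤ r / (2 * (‖c‖ + 1)) * (‖c‖ + 1) := by
            gcongr
            linarith
        _ = r / 2 := by field_simp
    rw [Metric.mem_ball, dist_eq_norm] at *
    calc ‖ψ (u x) + t • c - ψ (u x₀)‖ = ‖(ψ (u x) - ψ (u x₀)) + t • c‖ := by congr 1; abel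
      _ ≤ _ := norm_add_le _ _
      _ < r := by linarith
  refine ⟨u ⁻¹' O, hOo.preimage hu.continuous, ⟨mem_extChartAt_source (u x₀),
    Metric.mem_ball_self (by linarith)⟩, r / (2 * (‖c‖ + 1)), fun η hη hη1 hηc hηW ↦ ?_⟩
  have hU := isVariation_chartVariation hu hδ (hOo.preimage hu.continuous) hW hc hη hη1 hηc hηW
  exact ⟨_, hU, inner_variationField_chartVariation hU hW hc hη1 hηW⟩

variable [T2Space M] [SecondCountableTopology M] [MeasurableSpace M] [BorelSpace M]

theorem IsVariation.hasDerivAt_energyOn_self (hu : ContMDiff (𝓡 m) (𝓡 n) ∞ u)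
    (hU : IsVariation m n u δ K U) :
    HasDerivAt (fun t ↦ energyOn m n K (U t))
      (-∫ x, inner ℝ (variationField n U x) (tension m n (U 0) x) ∂(riemannianVolume m M)) 0 :=
  hU.hasDerivAt_energyOn hU.isCompact.measurableSet subset_rfl
    (integrableOn_energyDensity_of_contMDiff hu hU.isCompact)

/-- The fundamental lemma of the calculus of variations: if τ(x₀) ≠ 0, a variation in the direction
of τ(x₀) localized near x₀ has a nonzero derivative of the energy. -/
theorem IsHarmonic.tension_eq_zero (h : IsHarmonic m n u) (x₀ : M) : tension m n u x₀ = 0 := by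
  obtain ⟨hu, hcrit⟩ := h
  by_contra hne
  have hq := mem_extChartAt_source (I := 𝓡 n) (u x₀)
  -- With c the components of τ(x₀), the pairing q at x₀ is |τ(x₀)|², which is positive.
  set c : Eu n := WithLp.toLp 2 (coordTuple n (u x₀) (u x₀) (tension m n u x₀)) with hc
  obtain ⟨W, hWo, hxW, δ, hvar⟩ := exists_isVariation hu x₀ c
  set q := tensionPairing m (u x₀) u c with hqdef
  have hpos : 0 < q x₀ := by
    have h1 : q x₀ = inner ℝ (tension m n u x₀) (tension m n u x₀) :=
      (inner_eq_dotProduct_metricMatrix hq _ _).symm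
    rw [h1]
    exact real_inner_self_pos.2 hne
  have hbump : ∀ η : SmoothBumpFunction (𝓡 m) x₀, tsupport η ⊆ W →
      ∃ U, IsVariation m n u δ (tsupport η) U ∧
        ∀ x, inner ℝ (variationField n U x) (tension m n (U 0) x) = η x * q x := fun η hη ↦
    hvar η η.contMDiff (fun x ↦ abs_le.2 ⟨by linarith [η.nonneg (x := x)], η.le_one⟩)
      η.hasCompactSupport hη
  -- Continuity of q is not known directly, but η₁ q is the pairing of an actual variation and
  -- therefore continuous. Where η₁ q > 0 also q > 0, since η₁ ≥ 0; this provides an open set in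
  -- which to place the second bump.
  obtain ⟨η₁, -, hη₁⟩ := (SmoothBumpFunction.nhds_basis_tsupport (I := 𝓡 m) x₀).mem_iff.1
    (hWo.mem_nhds hxW)
  obtain ⟨U₁, hU₁, hv₁⟩ := hbump η₁ hη₁
  have hcont₁ : Continuous fun x ↦ η₁ x * q x := by
    simpa only [hv₁] using hU₁.continuous_inner_tension
  have hV : W ∩ {x | 0 < η₁ x * q x} ∈ 𝓝 x₀ :=
    (hWo.inter (isOpen_lt continuous_const hcont₁)).mem_nhds ⟨hxW, by simpa using hpos⟩
  obtain ⟨η₂, -, hη₂⟩ := (SmoothBumpFunction.nhds_basis_tsupport (I := 𝓡 m) x₀).mem_iff.1 hV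
  obtain ⟨U₂, hU₂, hv₂⟩ := hbump η₂ (hη₂.trans inter_subset_left)
  have hcont₂ : Continuous fun x ↦ η₂ x * q x := by
    simpa only [hv₂] using hU₂.continuous_inner_tension
  have hcs₂ : HasCompactSupport fun x ↦ η₂ x * q x := by
    simpa only [hv₂] using hU₂.hasCompactSupport_inner_tension
  -- The integrand is continuous, nonnegative because q is positive on the support of η₂, and
  -- nonzero at x₀; the volume charges open sets.
  have hint : 0 < ∫ x, η₂ x * q x ∂(riemannianVolume m M) := by
    refine hcont₂.integral_pos_of_hasCompactSupport_nonneg_nonzero (x := x₀) hcs₂ (fun x ↦ ?_)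
      (by simpa using hpos.ne')
    by_cases hx : x ∈ tsupport η₂
    · exact mul_nonneg η₂.nonneg (le_of_not_gt fun hlt ↦
        (hη₂ hx).2.not_ge (mul_nonpos_of_nonneg_of_nonpos η₁.nonneg hlt.le))
    · simp [image_eq_zero_of_notMem_tsupport hx]
  -- The derivative of the energy is minus this positive integral by the first variation formula,
  -- and zero by criticality.
  have h1 := (hU₂.hasDerivAt_energyOn_self hu).unique (hcrit δ _ U₂ hU₂)
  simp only [hv₂] at h1
  linarith

theorem isHarmonic_iff (hu : ContMDiff (𝓡 m) (𝓡 n) ∞ u) :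
    IsHarmonic m n u ↔ ∀ x, tension m n u x = 0 := by
  refine ⟨fun h ↦ h.tension_eq_zero, fun h ↦ ⟨hu, fun δ K U hU ↦ ?_⟩⟩
  have h1 := hU.hasDerivAt_energyOn_self hu
  rw [← hU.initial] at h
  simpa only [h, inner_zero_right, integral_zero, neg_zero] using h1

end Harmonic

end PhiThree

end

theorem theorem2p1 {m n : ℕ}
    {M : Type*} [TopologicalSpace M] [T2Space M] [SecondCountableTopology M]
    [ChartedSpace (EuclideanSpace ℝ (Fin m)) M] [IsManifold (𝓡 m) ∞ M]
    [RiemannianBundle (fun x : M ↦ TangentSpace (𝓡 m) x)]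
    [IsContMDiffRiemannianBundle (𝓡 m) ∞ (EuclideanSpace ℝ (Fin m))
      (fun x : M ↦ TangentSpace (𝓡 m) x)]
    [MeasurableSpace M] [BorelSpace M]
    {N : Type*} [TopologicalSpace N] [T2Space N] [SecondCountableTopology N]
    [ChartedSpace (EuclideanSpace ℝ (Fin n)) N] [IsManifold (𝓡 n) ∞ N]
    [RiemannianBundle (fun y : N ↦ TangentSpace (𝓡 n) y)]
    [IsContMDiffRiemannianBundle (𝓡 n) ∞ (EuclideanSpace ℝ (Fin n))
      (fun y : N ↦ TangentSpace (𝓡 n) y)]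
    (u : M → N) (hu : ContMDiff (𝓡 m) (𝓡 n) ∞ u) :
    (∀ D : Set M, IsCompact D →
      IntegrableOn (PhiThree.energyDensity m n u) D (PhiThree.riemannianVolume m M)) ∧
    (∀ (δ : ℝ) (K : Set M) (U : ℝ → M → N), PhiThree.IsVariation m n u δ K U →
      Integrable (fun x : M ↦
        inner ℝ (PhiThree.variationField n U x) (PhiThree.tension m n (U 0) x))
        (PhiThree.riemannianVolume m M) ∧
      ∀ D : Set M, MeasurableSet D → K ⊆ D →
        IntegrableOn (PhiThree.energyDensity m n u) D (PhiThree.riemannianVolume m M) →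
        (∀ t ∈ Set.Ioo (-δ) δ,
          IntegrableOn (PhiThree.energyDensity m n (U t)) D (PhiThree.riemannianVolume m M)) ∧
        HasDerivAt (fun t : ℝ ↦ PhiThree.energyOn m n D (U t))
          (-∫ x, inner ℝ (PhiThree.variationField n U x) (PhiThree.tension m n (U 0) x)
            ∂(PhiThree.riemannianVolume m M)) 0) ∧
    (PhiThree.IsHarmonic m n u ↔ ∀ x : M, PhiThree.tension m n u x = 0) := by
  refine ⟨fun D hD ↦ PhiThree.integrableOn_energyDensity_of_contMDiff hu hD,
    fun δ K U hU ↦ ⟨hU.integrable_inner_tension, fun D hD hKD hi ↦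
      ⟨fun t ht ↦ hU.integrableOn_energyDensity ht hD hi, hU.hasDerivAt_energyOn hD hKD hi⟩⟩,
    PhiThree.isHarmonic_iff hu⟩
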